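/- **Setting.** A *factor* over a finite set $\mathbf X_i$ of discrete variables, each with a finite non-empty set of values, assigns a non-negative rational number to every instantiation of $\mathbf X_i$. An input is a finite family $f_1(\mathbf X_1),\dots,f_n(\mathbf X_n)$ of factors given as tables; put $\mathbf X=\mathbf X_1\cup\dots\cup\mathbf X_n$ and $f=f_1\cdots f_n$, a factor over $\mathbf X$. The *size* $s$ of the input is the number of bits of its encoding (numbers of values of the variables, variables of each factor, and numerator and denominator of each table entry, with one extra bit for each number written). For $\mathbf Y\subseteq\mathbf X$ and an instantiation $\mathbf y$ of $\mathbf Y$, the *marginal* is $f(\mathbf y)=\sum_{\mathbf x} f(\mathbf x)$ over the instantiations $\mathbf x$ of $\mathbf X$ that agree with $\mathbf y$. An *MPE* of $f$ is an instantiation $\mathbf x$ of $\mathbf X$ that maximizes $f(\mathbf x)$. An *arithmetic circuit* over $\mathbf X$ is a rooted DAG whose internal nodes are labelled $+$ or $*$ and whose leaves are labelled with indicators $\lambda_{X=x}$ ($x$ a value of $X\in\mathbf X$) or non-negative rational parameters. Its value at $\mathbf y$ is obtained by setting $\lambda_{X=x}=1$ if $\mathbf y$ assigns $x$ or nothing to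 $X$, and $\lambda_{X=x}=0$ otherwise. It *computes the marginals of $f$* if its value at $\mathbf y$ is $f(\mathbf y)$ for every instantiation $\mathbf y$ of every $\mathbf Y\subseteq\mathbf X$. Let $\mathrm{vars}(n)$ be the set of variables with an indicator at or under the node $n$. The circuit is *decomposable* if any two children $c_1,c_2$ of a $*$-node have $\mathrm{vars}(c_1)\cap\mathrm{vars}(c_2)=\emptyset$, and *smooth* if it contains an indicator of every variable in $\mathbf X$ and $\mathrm{vars}(c)=\mathrm{vars}(n)$ for every child $c$ of every $+$-node $n$. A circuit is output as the list of its nodes, children before parents. Algorithms are programs of a random access machine on natural numbers with unit-cost addition, truncated subtraction, halving, array access, tests for zero, and writing of one output number; running time is the worst-case number of steps. **Theorem.** There is a polynomial $p$ with natural coefficients such that the following holds. Let $\Xi$ be an algorithm that, on every input $f_1,\dots,f_n$, returns a decomposable and smooth arithmetic circuit that computes the marginals of $f=f_1\cdots f_n$, and let $t:\mathbb N\to\mathbb R$ be such that the running time of $\Xi$ on inputs of size $s$ is $O(t(s))$. Then there is an algorithm that, on every input $f_1,\dots,f_n$, returns an MPE of $f$, with running time $O(t(p(s)))$ on inputs of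 size $s$. -/

import Mathlib

/-! ## Probabilistic graphical models: finite families of tabular factors -/

namespace ArithCirc

/-- A factor in tabular form. `scope` lists its variables (variables are named by natural
numbers), `table` lists its values, row after row, the last variable of `scope` varying
fastest. -/
structure Factor where
  scope : List ℕ
  table : List ℚ≥0

/-- A finite family of factors. The variables are `0, …, dom.length - 1`, and the variable `X`
has the values `0, …, dom[X] - 1`. -/
structure Model where
  dom : List ℕ
  factors : List Factor

namespace Model

/-- The number of values of the variable `X`. -/
def card (M : Model) (X : ℕ) : ℕ := M.dom.getD X 0

/-- Every variable has a value; every factor is a full table over distinct variables of the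
model; and the variables of the model are exactly those of its factors. -/
structure WF (M : Model) : Prop where
  card_pos : ∀ d ∈ M.dom, 0 < d
  scope_nodup : ∀ f ∈ M.factors, f.scope.Nodup
  scope_lt : ∀ f ∈ M.factors, ∀ X ∈ f.scope, X < M.dom.length
  table_length : ∀ f ∈ M.factors, f.table.length = (f.scope.map M.card).prod
  covered : ∀ X < M.dom.length, ∃ f ∈ M.factors, X ∈ f.scope

/-- Instantiations of all the variables. -/
abbrev Inst (M : Model) : Type := (X : Fin M.dom.length) → Fin (M.card X)

/-- Instantiations of some of the variables (`none`: no value is assigned). -/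
abbrev PInst (M : Model) : Type := (X : Fin M.dom.length) → Option (Fin (M.card X))

/-- The value that an instantiation gives to the variable named `X`. -/
def Inst.get {M : Model} (x : M.Inst) (X : ℕ) : ℕ :=
  if h : X < M.dom.length then (x ⟨X, h⟩ : ℕ) else 0

/-- The position, in the table of a factor with the given scope, of the row of `x`. -/
def rowIndex (M : Model) (x : M.Inst) (scope : List ℕ) : ℕ :=
  scope.foldl (fun r X => r * M.card X + x.get X) 0

/-- The value of one factor at `x`. -/
def factorValue (M : Model) (f : Factor) (x : M.Inst) : ℚ≥0 :=
  f.table.getD (M.rowIndex x f.scope) 0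

/-- The value at `x` of the product of the factors. -/
def value (M : Model) (x : M.Inst) : ℚ≥0 :=
  (M.factors.map fun f => M.factorValue f x).prod

/-- `x` agrees with the partial instantiation `y`. -/
def Compatible {M : Model} (y : M.PInst) (x : M.Inst) : Prop :=
  ∀ X, y X = none ∨ y X = some (x X)

open Classical in
/-- The marginal at `y` of the product of the factors. -/
noncomputable def marginal (M : Model) (y : M.PInst) : ℚ≥0 :=
  ∑ x : M.Inst with Compatible y x, M.value x

/-- `x` is a most probable explanation, i.e. a maximizer of the product of the factors. -/
def IsMPE (M : Model) (x : M.Inst) : Prop := ∀ x' : M.Inst, M.value x' ≤ M.value x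

end Model

/-- A factor as a sequence of numbers; a rational is written as its numerator and denominator. -/
def Factor.encode (f : Factor) : List ℕ :=
  f.scope.length :: f.scope ++
    f.table.length :: f.table.flatMap (fun q => [q.num, q.den])

/-- A model as a sequence of numbers. -/
def Model.encode (M : Model) : List ℕ :=
  M.dom.length :: M.dom ++ M.factors.length :: M.factors.flatMap Factor.encode

/-- The size of a model: the total number of bits in its encoding, plus one for each number. -/
def Model.size (M : Model) : ℕ := (M.encode.map fun w => w.size + 1).sum

/-! ## Arithmetic circuits -/

/-- The node of a circuit: an indicator `λ_x` for the value `x` of the variable `X`, a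
nonnegative rational parameter `num / den`, or a `+`-node or `*`-node with its children. -/
inductive Node where
  | ind (X x : ℕ)
  | param (num den : ℕ)
  | add (children : List ℕ)
  | mul (children : List ℕ)

namespace Node

/-- The children of a node. -/
def children : Node → List ℕ
  | ind _ _ => []
  | param _ _ => []
  | add cs => cs
  | mul cs => cs

/-- A node as a sequence of numbers. -/
def encode : Node → List ℕ
  | ind X x => [0, X, x]
  | param a b => [1, a, b]
  | add cs => 2 :: cs.length :: cs
  | mul cs => 3 :: cs.length :: cs

/-- The value of a node from the circuit input `Λ` and the values `vs` of the earlier nodes. -/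
def value (Λ : ℕ → ℕ → ℚ≥0) (vs : List ℚ≥0) : Node → ℚ≥0
  | ind X x => Λ X x
  | param a b => (a : ℚ≥0) / (b : ℚ≥0)
  | add cs => (cs.map fun c => vs.getD c 0).sum
  | mul cs => (cs.map fun c => vs.getD c 0).prod

/-- The variables of a node from the variables `vs` of the earlier nodes. -/
def vars (vs : List (Finset ℕ)) : Node → Finset ℕ
  | ind X _ => {X}
  | param _ _ => ∅
  | add cs => cs.toFinset.biUnion fun c => vs.getD c ∅
  | mul cs => cs.toFinset.biUnion fun c => vs.getD c ∅

end Node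

/-- A circuit is the list of its nodes in a topological order, children before parents; a child
is given by its position in the list, and the root is the last node. -/
abbrev Circuit : Type := List Node

/-- Bottom-up evaluation: the list of the values of the nodes of `C`. -/
def bottomUp {α : Type} (step : List α → Node → α) (C : Circuit) : List α :=
  C.foldl (fun vs nd => vs ++ [step vs nd]) []

namespace Circuit

/-- `C` is a rooted DAG over the variables of `M`, with proper labels. -/
structure WF (M : Model) (C : Circuit) : Prop where
  ne_nil : C ≠ []
  ind_lt : ∀ X x, Node.ind X x ∈ C → X < M.dom.length ∧ x < M.card X
  den_ne : ∀ a b, Node.param a b ∈ C → b ≠ 0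
  add_ne : ∀ cs, Node.add cs ∈ C → cs ≠ []
  mul_ne : ∀ cs, Node.mul cs ∈ C → cs ≠ []
  child_lt : ∀ (i : ℕ) (nd : Node), C[i]? = some nd → ∀ c ∈ nd.children, c < i
  rooted : ∀ i : ℕ, i + 1 < C.length → ∃ nd ∈ C, i ∈ nd.children

/-- The value of the root under the circuit input `Λ`. -/
def eval (C : Circuit) (Λ : ℕ → ℕ → ℚ≥0) : ℚ≥0 :=
  (bottomUp (fun vs nd => nd.value Λ vs) C).getLastD 0

/-- The variables with an indicator at or under node `i`. -/
def vars (C : Circuit) (i : ℕ) : Finset ℕ :=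
  (bottomUp (fun vs nd => nd.vars vs) C).getD i ∅

/-- Children of the same `*`-node share no variable. -/
def Decomposable (C : Circuit) : Prop :=
  ∀ (i : ℕ) (cs : List ℕ), C[i]? = some (Node.mul cs) →
    cs.Pairwise fun c c' => Disjoint (C.vars c) (C.vars c')

/-- There is an indicator for every variable of the model, and a `+`-node has the same
variables as each of its children. -/
def Smooth (M : Model) (C : Circuit) : Prop :=
  (∀ X < M.dom.length, ∃ x, Node.ind X x ∈ C) ∧
    ∀ (i : ℕ) (cs : List ℕ), C[i]? = some (Node.add cs) → ∀ c ∈ cs, C.vars i = C.vars c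

end Circuit

open Classical in
/-- The circuit input at a partial instantiation `y`: the indicator `λ_x` is `1` if `x` is
compatible with `y`, and `0` otherwise. -/
noncomputable def Model.PInst.input {M : Model} (y : M.PInst) (X x : ℕ) : ℚ≥0 :=
  if ∃ h : X < M.dom.length, ∀ v, y ⟨X, h⟩ = some v → (v : ℕ) = x then 1 else 0

namespace Circuit

/-- `C` computes the marginals of the product of the factors of `M`. -/
def ComputesMarginals (M : Model) (C : Circuit) : Prop :=
  ∀ y : M.PInst, C.eval (Model.PInst.input y) = M.marginal y

/-- A circuit as a sequence of numbers. -/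
def encode (C : Circuit) : List ℕ := C.flatMap Node.encode

end Circuit

/-! ## Algorithms: structured programs of a random access machine with unit costs

Registers and memory cells hold natural numbers. There are finitely many arrays in a program,
each with random access. The arithmetic is addition, truncated subtraction and halving (there is
no multiplication, so that one step makes numbers longer by at most one bit). -/

/-- The registers, the arrays, and the output written so far. -/
structure State where
  reg : ℕ → ℕ
  mem : ℕ → ℕ → ℕ
  out : List ℕ

/-- Basic instructions. -/
inductive Instr where
  | const (d n : ℕ)
  | add (d a b : ℕ)
  | sub (d a b : ℕ)
  | half (d a : ℕ)
  | load (d A a : ℕ)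
  | store (A a b : ℕ)
  | emit (a : ℕ)

/-- The effect of a basic instruction. -/
def Instr.run (σ : State) : Instr → State
  | const d n => { σ with reg := Function.update σ.reg d n }
  | add d a b => { σ with reg := Function.update σ.reg d (σ.reg a + σ.reg b) }
  | sub d a b => { σ with reg := Function.update σ.reg d (σ.reg a - σ.reg b) }
  | half d a => { σ with reg := Function.update σ.reg d (σ.reg a / 2) }
  | load d A a => { σ with reg := Function.update σ.reg d (σ.mem A (σ.reg a)) }
  | store A a b =>
      { σ with mem := Function.update σ.mem A (Function.update (σ.mem A) (σ.reg a) (σ.reg b)) }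
  | emit a => { σ with out := σ.out ++ [σ.reg a] }

/-- Programs; a test asks whether a register is nonzero. -/
inductive Prog where
  | basic (i : Instr)
  | seq (P Q : Prog)
  | cond (r : ℕ) (P Q : Prog)
  | loop (r : ℕ) (P : Prog)

/-- `Exec P σ σ' k`: started in `σ`, the program `P` halts in `σ'` after `k` steps, where every
basic instruction and every test counts as one step. -/
inductive Exec : Prog → State → State → ℕ → Prop where
  | basic (i : Instr) (σ : State) : Exec (.basic i) σ (i.run σ) 1
  | seq {P Q : Prog} {σ σ' σ'' : State} {k l : ℕ} :
      Exec P σ σ' k → Exec Q σ' σ'' l → Exec (.seq P Q) σ σ'' (k + l)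
  | cond_true {r : ℕ} {P Q : Prog} {σ σ' : State} {k : ℕ} :
      σ.reg r ≠ 0 → Exec P σ σ' k → Exec (.cond r P Q) σ σ' (k + 1)
  | cond_false {r : ℕ} {P Q : Prog} {σ σ' : State} {k : ℕ} :
      σ.reg r = 0 → Exec Q σ σ' k → Exec (.cond r P Q) σ σ' (k + 1)
  | loop_done {r : ℕ} {P : Prog} {σ : State} :
      σ.reg r = 0 → Exec (.loop r P) σ σ 1
  | loop_step {r : ℕ} {P : Prog} {σ σ' σ'' : State} {k l : ℕ} :
      σ.reg r ≠ 0 → Exec P σ σ' k → Exec (.loop r P) σ' σ'' l →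
        Exec (.loop r P) σ σ'' (k + l + 1)

/-- The initial state on input `w`: array `0` holds `w`, register `0` holds its length, and
everything else is `0`. -/
def State.init (w : List ℕ) : State where
  reg := fun r => if r = 0 then w.length else 0
  mem := fun A i => if A = 0 then w.getD i 0 else 0
  out := []

/-- On every family of factors the program `P` halts with an output as prescribed by `spec`, and
its worst-case running time on inputs of size `s` is `O(t(s))`. -/
def SolvesInTime (spec : Model → List ℕ → Prop) (P : Prog) (t : ℕ → ℝ) : Prop :=
  ∃ T : ℕ → ℕ,
    (∀ M : Model, M.WF → ∃ σ k, Exec P (State.init M.encode) σ k ∧ spec M σ.out ∧ k ≤ T M.size) ∧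
      (fun s => (T s : ℝ)) =O[Filter.atTop] t

/-- The output is a decomposable and smooth arithmetic circuit that computes the marginals of
the product of the factors. -/
def CompilationSpec (M : Model) (out : List ℕ) : Prop :=
  ∃ C : Circuit, out = C.encode ∧ C.WF M ∧ C.Decomposable ∧ C.Smooth M ∧ C.ComputesMarginals M

/-- The output is a most probable explanation, as the list of the values of the variables. -/
def MPESpec (M : Model) (out : List ℕ) : Prop :=
  ∃ x : M.Inst, out = List.ofFn (fun X => (x X : ℕ)) ∧ M.IsMPE x

end ArithCirc

/-! ## From marginals to most probable explanations

The circuit of a model may not be evaluated with maxima in place of sums, as its parameters may mix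
several rows of the factors. Therefore each factor is replaced by an indicator of its row, whose
index becomes a new variable. The product of these factors takes only the value `1` on its support,
and every instantiation of the original variables extends to a unique one in the support. In a
decomposable and smooth circuit for it, replace `+` by `max`, `*` by `+`, the nonzero parameters by
`0` and the zero parameters by `-∞`: the root becomes the maximum, over the support, of the sums of
the weights given to the chosen indicators. This uses only that the root vanishes exactly outside
the support.

An indicator of a row receives the logarithm of the entry in that row. As the algorithm has only
integers, logarithms are computed by repeated squaring of rounded mantissas, with so many bits that
different products of entries are still ordered correctly. An MPE is read off the maximum itself:
all weights of row indicators are multiplied by a large power of two, and the digits below hold the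
values of the original variables.

The algorithm writes the new model, runs the compilation algorithm on it, and evaluates the circuit.
A further variable with `s ^ 3` values forces the circuit to have `s ^ 3` indicators, such that the
time for compilation pays for everything else, and the last entry of its factor is padded such that
the new model has size exactly `16 * s ^ 3`, whatever the model of size `s`. -/

namespace ArithCirc

/-! ### Support and max-plus values of circuits -/

section BottomUp

variable {α : Type} (step : List α → Node → α)

theorem bottomUp_append_singleton (C : Circuit) (nd : Node) :
    bottomUp step (C ++ [nd]) = bottomUp step C ++ [step (bottomUp step C) nd] := by
  simp [bottomUp]

theorem length_bottomUp (C : Circuit) : (bottomUp step C).length = C.length := by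
  induction C using List.reverseRecOn with
  | nil => rfl
  | append_singleton C nd ih => simp [bottomUp_append_singleton, ih]

theorem getD_bottomUp {C : Circuit} {i : ℕ} {nd : Node} (h : C[i]? = some nd) (d : α) :
    (bottomUp step C).getD i d = step ((bottomUp step C).take i) nd := by
  induction C using List.reverseRecOn with
  | nil => simp at h
  | append_singleton C nd' ih =>
    have hlen := length_bottomUp step C
    rw [bottomUp_append_singleton]
    rcases lt_trichotomy i C.length with hi | rfl | hi
    · rw [List.getElem?_append_left hi] at h
      rw [List.getD_append _ _ _ _ (by omega), List.take_append_of_le_length (by omega), ih h]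
    · obtain rfl : nd' = nd := by simpa using h
      rw [List.getD_append_right _ _ _ _ hlen.le, List.take_append_of_le_length hlen.ge,
        List.take_of_length_le hlen.le, hlen]
      simp
    · simp [hi] at h

theorem bottomUp_congr {step step' : List α → Node → α} {C : Circuit}
    (h : ∀ nd ∈ C, ∀ vs, step vs nd = step' vs nd) : bottomUp step C = bottomUp step' C := by
  induction C using List.reverseRecOn with
  | nil => rfl
  | append_singleton C nd ih =>
    rw [bottomUp_append_singleton, bottomUp_append_singleton, ih fun nd hnd => h nd (by simp [hnd]),
      h nd (by simp)]

end BottomUp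

theorem getD_take_of_lt {α : Type*} {l : List α} {i c : ℕ} (h : c < i) (d : α) :
    (l.take i).getD c d = l.getD c d := by
  simp [List.getD_eq_getElem?_getD, h]

theorem sum_eq_sum_map_of_pairwise_disjoint {ι κ R : Type*} [AddCommMonoid R]
    {V : ι → Finset κ} {cs : List ι} {U : Finset κ}
    (hV : cs.Pairwise fun c c' => Disjoint (V c) (V c')) (hU : ∀ X, X ∈ U ↔ ∃ c ∈ cs, X ∈ V c)
    (g : κ → R) : ∑ X ∈ U, g X = (cs.map fun c => ∑ X ∈ V c, g X).sum := by
  classical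
  induction cs generalizing U with
  | nil =>
    obtain rfl : U = ∅ := by ext X; simp [hU]
    simp
  | cons c cs ih =>
    obtain ⟨hc, hcs⟩ := List.pairwise_cons.1 hV
    have hU' : ∀ X, X ∈ U \ V c ↔ ∃ c' ∈ cs, X ∈ V c' := fun X => by
      have := fun c' hc' => @Finset.disjoint_right.1 (hc c' hc') X
      simp only [Finset.mem_sdiff, hU, List.mem_cons, exists_eq_or_imp]
      grind
    rw [List.map_cons, List.sum_cons, ← ih hcs hU', add_comm, Finset.sum_sdiff]
    exact fun X hX => (hU X).2 ⟨c, by simp, hX⟩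

theorem sum_eq_bot_of_mem {R : Type*} [AddMonoid R] {l : List (WithBot R)} (h : ⊥ ∈ l) :
    l.sum = ⊥ := by
  induction l with
  | nil => simp at h
  | cons a l ih => obtain rfl | h := List.mem_cons.1 h <;> simp [*]

theorem coe_sum_map {ι R : Type*} [AddMonoid R] (f : ι → R) (l : List ι) :
    ((l.map f).sum : WithBot R) = (l.map fun c => (f c : WithBot R)).sum := by
  simpa [Function.comp_def] using map_list_sum (WithBot.addHom : R →+ WithBot R) (l.map f)

section MaxPlus

variable {R : Type} [AddCommMonoid R] [LinearOrder R]

/-- The value of a node in max-plus semantics, from the values `vs` of the earlier nodes: `+` is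
`max`, `*` is `+`, the indicator of the value `x` of the variable `X` weighs `ω X x`, and a
parameter counts only as zero (`⊥`) or nonzero (`0`). -/
def Node.maxPlus (ω : ℕ → ℕ → R) (vs : List (WithBot R)) : Node → WithBot R
  | ind X x => ω X x
  | param a _ => if a = 0 then ⊥ else 0
  | add cs => cs.toFinset.sup fun c => vs.getD c ⊥
  | mul cs => (cs.map fun c => vs.getD c ⊥).sum

/-- The value of node `i` in max-plus semantics. -/
def Circuit.maxPlus (C : Circuit) (ω : ℕ → ℕ → R) (i : ℕ) : WithBot R :=
  (bottomUp (Node.maxPlus ω) C).getD i ⊥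

end MaxPlus

namespace Circuit

/-- The value of node `i` under the circuit input `Λ`. -/
def nodeValue (C : Circuit) (Λ : ℕ → ℕ → ℚ≥0) (i : ℕ) : ℚ≥0 :=
  (bottomUp (fun vs nd => nd.value Λ vs) C).getD i 0

/-- The total assignment `x` supports node `i`: the node does not vanish when exactly the
indicators chosen by `x` are set to `1`. -/
def Supports (C : Circuit) (x : ℕ → ℕ) (i : ℕ) : Prop :=
  C.nodeValue (fun X v => if x X = v then 1 else 0) i ≠ 0

theorem eval_eq_nodeValue (C : Circuit) (Λ : ℕ → ℕ → ℚ≥0) :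
    C.eval Λ = C.nodeValue Λ (C.length - 1) := by
  rw [eval, nodeValue, ← length_bottomUp (fun vs nd => nd.value Λ vs) C, List.getLastD_eq_getLast?,
    List.getLast?_eq_getElem?, List.getD_eq_getElem?_getD]

theorem eval_congr {C : Circuit} {Λ Λ' : ℕ → ℕ → ℚ≥0}
    (h : ∀ X x, Node.ind X x ∈ C → Λ X x = Λ' X x) : C.eval Λ = C.eval Λ' := by
  rw [eval, eval, bottomUp_congr]
  rintro (⟨X, x⟩ | _ | _ | _) hnd vs
  exacts [h X x hnd, rfl, rfl, rfl]

namespace WF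

variable {M : Model} {C : Circuit} {i : ℕ}

@[elab_as_elim]
theorem induction (hC : C.WF M) {P : ℕ → Prop}
    (ind : ∀ i X x, C[i]? = some (.ind X x) → P i)
    (param : ∀ i a b, C[i]? = some (.param a b) → P i)
    (add : ∀ i cs, C[i]? = some (.add cs) → (∀ c ∈ cs, P c) → P i)
    (mul : ∀ i cs, C[i]? = some (.mul cs) → (∀ c ∈ cs, P c) → P i) (hi : i < C.length) : P i := by
  induction i using Nat.strong_induction_on with
  | _ i ih =>
    have hnd : C[i]? = some C[i] := List.getElem?_eq_getElem hi
    have hch : ∀ c ∈ C[i].children, P c := fun c hc =>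
      have hlt := hC.child_lt i _ hnd c hc
      ih c hlt (hlt.trans hi)
    cases hCi : C[i] <;> rw [hCi] at hnd hch
    exacts [ind _ _ _ hnd, param _ _ _ hnd, add _ _ hnd hch, mul _ _ hnd hch]

theorem nodeValue_add (hC : C.WF M) (Λ : ℕ → ℕ → ℚ≥0) {cs : List ℕ} (h : C[i]? = some (.add cs)) :
    C.nodeValue Λ i = (cs.map (C.nodeValue Λ)).sum :=
  (getD_bottomUp _ h 0).trans <| congrArg List.sum <| List.map_congr_left fun c hc =>
    getD_take_of_lt (hC.child_lt i _ h c hc) 0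

theorem nodeValue_mul (hC : C.WF M) (Λ : ℕ → ℕ → ℚ≥0) {cs : List ℕ} (h : C[i]? = some (.mul cs)) :
    C.nodeValue Λ i = (cs.map (C.nodeValue Λ)).prod :=
  (getD_bottomUp _ h 0).trans <| congrArg List.prod <| List.map_congr_left fun c hc =>
    getD_take_of_lt (hC.child_lt i _ h c hc) 0

theorem vars_add (hC : C.WF M) {cs : List ℕ} (h : C[i]? = some (.add cs)) :
    C.vars i = cs.toFinset.biUnion C.vars :=
  (getD_bottomUp _ h ∅).trans <| Finset.biUnion_congr rfl fun c hc =>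
    getD_take_of_lt (hC.child_lt i _ h c (List.mem_toFinset.1 hc)) ∅

theorem vars_mul (hC : C.WF M) {cs : List ℕ} (h : C[i]? = some (.mul cs)) :
    C.vars i = cs.toFinset.biUnion C.vars :=
  (getD_bottomUp _ h ∅).trans <| Finset.biUnion_congr rfl fun c hc =>
    getD_take_of_lt (hC.child_lt i _ h c (List.mem_toFinset.1 hc)) ∅

theorem maxPlus_add {R : Type} [AddCommMonoid R] [LinearOrder R] (hC : C.WF M) (ω : ℕ → ℕ → R)
    {cs : List ℕ} (h : C[i]? = some (.add cs)) :
    C.maxPlus ω i = cs.toFinset.sup (C.maxPlus ω) :=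
  (getD_bottomUp _ h ⊥).trans <| Finset.sup_congr rfl fun c hc =>
    getD_take_of_lt (hC.child_lt i _ h c (List.mem_toFinset.1 hc)) ⊥

theorem maxPlus_mul {R : Type} [AddCommMonoid R] [LinearOrder R] (hC : C.WF M) (ω : ℕ → ℕ → R)
    {cs : List ℕ} (h : C[i]? = some (.mul cs)) :
    C.maxPlus ω i = (cs.map (C.maxPlus ω)).sum :=
  (getD_bottomUp _ h ⊥).trans <| congrArg List.sum <| List.map_congr_left fun c hc =>
    getD_take_of_lt (hC.child_lt i _ h c hc) ⊥

end WF

section Leaves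

variable {C : Circuit} {i : ℕ} {x : ℕ → ℕ}

theorem vars_ind {X v : ℕ} (h : C[i]? = some (.ind X v)) : C.vars i = {X} :=
  getD_bottomUp _ h ∅

theorem vars_param {a b : ℕ} (h : C[i]? = some (.param a b)) : C.vars i = ∅ :=
  getD_bottomUp _ h ∅

theorem supports_ind {X v : ℕ} (h : C[i]? = some (.ind X v)) : C.Supports x i ↔ x X = v := by
  rw [Supports, nodeValue, getD_bottomUp _ h]
  simp [Node.value]

variable {M : Model} (hC : C.WF M)
include hC

theorem WF.supports_param {a b : ℕ} (h : C[i]? = some (.param a b)) :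
    C.Supports x i ↔ a ≠ 0 := by
  have hb : b ≠ 0 := hC.den_ne a b (List.mem_of_getElem? h)
  rw [Supports, nodeValue, getD_bottomUp _ h]
  simp [Node.value, hb]

theorem WF.supports_add {cs : List ℕ} (h : C[i]? = some (.add cs)) :
    C.Supports x i ↔ ∃ c ∈ cs, C.Supports x c := by
  simp [Supports, hC.nodeValue_add _ h, List.sum_eq_zero_iff]

theorem WF.supports_mul {cs : List ℕ} (h : C[i]? = some (.mul cs)) :
    C.Supports x i ↔ ∀ c ∈ cs, C.Supports x c := by
  simp [Supports, hC.nodeValue_mul _ h, List.prod_eq_zero_iff]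

theorem WF.supports_congr {x x' : ℕ → ℕ} (hi : i < C.length) :
    (∀ X ∈ C.vars i, x X = x' X) → (C.Supports x i ↔ C.Supports x' i) := by
  refine hC.induction (fun i X v h => ?ind) (fun i a b h => ?param) (fun i cs h ih => ?add)
    (fun i cs h ih => ?mul) hi
  case ind => simp +contextual [vars_ind h, supports_ind h]
  case param => simp [hC.supports_param h]
  case add =>
    simp only [hC.vars_add h, Finset.mem_biUnion, List.mem_toFinset, hC.supports_add h]
    exact fun hx => exists_congr fun c => and_congr_right fun hc =>
      ih c hc fun X hX => hx X ⟨c, hc, hX⟩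
  case mul =>
    simp only [hC.vars_mul h, Finset.mem_biUnion, List.mem_toFinset, hC.supports_mul h]
    exact fun hx => forall₂_congr fun c hc => ih c hc fun X hX => hx X ⟨c, hc, hX⟩

end Leaves

section Support

variable {M : Model} {C : Circuit} {i : ℕ} {x : ℕ → ℕ}

theorem Smooth.ind_mem_of_supports (hs : C.Smooth M) (hC : C.WF M) (hi : i < C.length) :
    C.Supports x i → ∀ X ∈ C.vars i, Node.ind X (x X) ∈ C := by
  refine hC.induction (fun i X v h => ?ind) (fun i a b h => ?param) (fun i cs h ih => ?add)
    (fun i cs h ih => ?mul) hi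
  case ind =>
    rw [supports_ind h, vars_ind h]
    rintro rfl Y hY
    rw [Finset.mem_singleton.1 hY]
    exact List.mem_of_getElem? h
  case param => simp [vars_param h]
  case add =>
    rw [hC.supports_add h]
    rintro ⟨c, hc, hxc⟩
    exact hs.2 i cs h c hc ▸ ih c hc hxc
  case mul =>
    simp only [hC.supports_mul h, hC.vars_mul h, Finset.mem_biUnion, List.mem_toFinset]
    rintro hx X ⟨c, hc, hX⟩
    exact ih c hc (hx c hc) X hX

theorem Decomposable.sum_vars {R : Type} [AddCommMonoid R] (hd : C.Decomposable) (hC : C.WF M)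
    {cs : List ℕ} (h : C[i]? = some (.mul cs)) (g : ℕ → R) :
    ∑ X ∈ C.vars i, g X = (cs.map fun c => ∑ X ∈ C.vars c, g X).sum :=
  sum_eq_sum_map_of_pairwise_disjoint (hd i cs h) (by simp [hC.vars_mul h]) g

theorem Decomposable.exists_glue (hd : C.Decomposable) {cs : List ℕ}
    (h : C[i]? = some (.mul cs)) (y : ℕ → ℕ → ℕ) :
    ∃ x : ℕ → ℕ, ∀ c ∈ cs, ∀ X ∈ C.vars c, x X = y c X := by
  classical
  refine ⟨fun X => if hX : ∃ c ∈ cs, X ∈ C.vars c then y hX.choose X else 0, fun c hc X hX => ?_⟩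
  have hex : ∃ c ∈ cs, X ∈ C.vars c := ⟨c, hc, hX⟩
  have hcX := hex.choose_spec
  simp only [dif_pos hex]
  congr 1
  by_contra hne
  exact Finset.disjoint_left.1
    ((hd i cs h).forall hcX.1 hc hne) hcX.2 hX

variable {R : Type} [AddCommMonoid R] [LinearOrder R]

theorem Decomposable.exists_maxPlus_eq (hd : C.Decomposable) (hs : C.Smooth M) (hC : C.WF M)
    (ω : ℕ → ℕ → R) (hi : i < C.length) : C.maxPlus ω i ≠ ⊥ →
      ∃ x, C.Supports x i ∧ C.maxPlus ω i = ((∑ X ∈ C.vars i, ω X (x X) : R) : WithBot R) := by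
  refine hC.induction (fun i X v h => ?ind) (fun i a b h => ?param) (fun i cs h ih => ?add)
    (fun i cs h ih => ?mul) hi
  case ind =>
    exact fun _ => ⟨fun _ => v, (supports_ind h).2 rfl, by
      rw [maxPlus, getD_bottomUp _ h, vars_ind h]; simp [Node.maxPlus]⟩
  case param =>
    rw [maxPlus, getD_bottomUp _ h, vars_param h]
    intro ha
    have ha : a ≠ 0 := by simpa [Node.maxPlus] using ha
    exact ⟨0, (hC.supports_param h).2 ha, by simp [Node.maxPlus, ha]⟩
  case add =>
    rw [hC.maxPlus_add _ h]
    intro hne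
    have hcs : cs.toFinset.Nonempty := by
      by_contra! hcs
      simp only [hcs, Finset.sup_empty, ne_eq, not_true_eq_false] at hne
    obtain ⟨c, hc, hmax⟩ := Finset.exists_mem_eq_sup _ hcs (C.maxPlus ω)
    have hc : c ∈ cs := List.mem_toFinset.1 hc
    obtain ⟨x, hx, hsum⟩ := ih c hc (hmax ▸ hne)
    exact ⟨x, (hC.supports_add h).2 ⟨c, hc, hx⟩, by rw [hmax, hsum, hs.2 i cs h c hc]⟩
  case mul =>
    rw [hC.maxPlus_mul _ h]
    intro hne
    have hne' : ∀ c ∈ cs, C.maxPlus ω c ≠ ⊥ := fun c hc hbot =>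
      hne (sum_eq_bot_of_mem (List.mem_map.2 ⟨c, hc, hbot⟩))
    choose! y hy hsum using fun c hc => ih c hc (hne' c hc)
    obtain ⟨x, hx⟩ := hd.exists_glue h y
    have hlt := hC.child_lt i _ h
    refine ⟨x, (hC.supports_mul h).2 fun c hc => ?_, ?_⟩
    · have hc' : c < C.length := (hlt c hc).trans (List.getElem?_eq_some_iff.1 h).1
      exact (hC.supports_congr hc' (hx c hc)).2 (hy c hc)
    · rw [hd.sum_vars hC h, coe_sum_map]
      refine congrArg List.sum <| List.map_congr_left fun c hc => ?_
      simp +contextual only [hsum c hc, hx c hc]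

variable [IsOrderedAddMonoid R]

theorem Decomposable.sum_le_maxPlus (hd : C.Decomposable) (hs : C.Smooth M) (hC : C.WF M)
    (ω : ℕ → ℕ → R) (hi : i < C.length) : C.Supports x i →
      ((∑ X ∈ C.vars i, ω X (x X) : R) : WithBot R) ≤ C.maxPlus ω i := by
  refine hC.induction (fun i X v h => ?ind) (fun i a b h => ?param) (fun i cs h ih => ?add)
    (fun i cs h ih => ?mul) hi
  case ind =>
    rw [supports_ind h, maxPlus, getD_bottomUp _ h, vars_ind h]
    rintro rfl
    simp [Node.maxPlus]
  case param =>
    rw [hC.supports_param h, maxPlus, getD_bottomUp _ h, vars_param h]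
    intro ha
    simp [Node.maxPlus, ha]
  case add =>
    rw [hC.supports_add h, hC.maxPlus_add _ h]
    rintro ⟨c, hc, hx⟩
    rw [hs.2 i cs h c hc]
    exact (ih c hc hx).trans (Finset.le_sup (f := C.maxPlus ω) (by simpa using hc))
  case mul =>
    rw [hC.supports_mul h, hC.maxPlus_mul _ h, hd.sum_vars hC h, coe_sum_map]
    exact fun hx => List.sum_le_sum fun c hc => ih c hc (hx c hc)

end Support

section Root

variable {M : Model} {C : Circuit} {i : ℕ}

theorem WF.root_lt (hC : C.WF M) : C.length - 1 < C.length :=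
  Nat.sub_one_lt (List.length_pos_of_ne_nil hC.ne_nil).ne'

theorem WF.vars_subset_root (hC : C.WF M) (hi : i < C.length) :
    C.vars i ⊆ C.vars (C.length - 1) := by
  induction i using Nat.strong_decreasing_induction with
  | base => exact ⟨C.length, fun m hm h => absurd h (by omega)⟩
  | step i ih =>
    obtain hi' | hi' : i = C.length - 1 ∨ i + 1 < C.length := by omega
    · rw [hi']
    obtain ⟨nd, hnd, hich⟩ := hC.rooted i hi'
    obtain ⟨j, hj, hCj⟩ := List.mem_iff_getElem.1 hnd
    have hnd' : C[j]? = some nd := by rw [List.getElem?_eq_getElem hj, hCj]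
    refine Finset.Subset.trans ?_ (ih j (hC.child_lt j nd hnd' i hich) hj)
    cases nd with
    | ind | param => simp [Node.children] at hich
    | add cs =>
      rw [hC.vars_add hnd']
      exact Finset.subset_biUnion_of_mem C.vars (by simpa [Node.children] using hich)
    | mul cs =>
      rw [hC.vars_mul hnd']
      exact Finset.subset_biUnion_of_mem C.vars (by simpa [Node.children] using hich)

theorem WF.vars_subset_range (hC : C.WF M) (hi : i < C.length) :
    C.vars i ⊆ Finset.range M.dom.length := by
  refine hC.induction (fun i X v h => ?ind) (fun i a b h => ?param) (fun i cs h ih => ?add)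
    (fun i cs h ih => ?mul) hi
  case ind => simpa [vars_ind h] using (hC.ind_lt X v (List.mem_of_getElem? h)).1
  case param => simp [vars_param h]
  case add => simpa [hC.vars_add h, Finset.biUnion_subset] using ih
  case mul => simpa [hC.vars_mul h, Finset.biUnion_subset] using ih

theorem Smooth.vars_root (hs : C.Smooth M) (hC : C.WF M) :
    C.vars (C.length - 1) = Finset.range M.dom.length := by
  refine (hC.vars_subset_range hC.root_lt).antisymm fun X hX => ?_
  obtain ⟨v, hv⟩ := hs.1 X (Finset.mem_range.1 hX)
  obtain ⟨j, hj, hCj⟩ := List.mem_iff_getElem.1 hv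
  have hvars : C.vars j = {X} := vars_ind (by rw [List.getElem?_eq_getElem hj, hCj])
  exact hC.vars_subset_root hj (by simp [hvars])

end Root

/-- `C` is a decomposable and smooth circuit that computes the marginals of `M`. -/
structure Compiles (C : Circuit) (M : Model) : Prop where
  wf : C.WF M
  decomposable : C.Decomposable
  smooth : C.Smooth M
  computes : C.ComputesMarginals M

end Circuit

theorem Model.marginal_some (M : Model) (x : M.Inst) :
    M.marginal (fun X => some (x X)) = M.value x := by
  classical
  have hx : ∀ x' : M.Inst, Compatible (fun X => some (x X)) x' ↔ x' = x := fun x' => by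
    simp [Compatible, funext_iff, eq_comm]
  rw [marginal, Finset.filter_congr fun x' _ => hx x', Finset.filter_eq' _ x]
  simp

namespace Circuit.Compiles

variable {M : Model} {C : Circuit} (hC : C.Compiles M)
include hC

theorem supports_root_iff (x : M.Inst) :
    C.Supports x.get (C.length - 1) ↔ M.value x ≠ 0 := by
  rw [← M.marginal_some, ← hC.computes, Supports, ← eval_eq_nodeValue,
    eval_congr fun X v hXv => ?_]
  have hX := (hC.wf.ind_lt X v hXv).1
  simp [Model.PInst.input, Model.Inst.get, hX]

variable {R : Type} [AddCommMonoid R] [LinearOrder R] (ω : ℕ → ℕ → R)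

theorem sum_le_maxPlus_root [IsOrderedAddMonoid R] {x : M.Inst} (hx : M.value x ≠ 0) :
    ((∑ X ∈ Finset.range M.dom.length, ω X (x.get X) : R) : WithBot R) ≤
      C.maxPlus ω (C.length - 1) :=
  hC.smooth.vars_root hC.wf ▸ hC.decomposable.sum_le_maxPlus hC.smooth hC.wf ω hC.wf.root_lt
    ((hC.supports_root_iff x).2 hx)

theorem ind_mem {x : M.Inst} (hx : M.value x ≠ 0) {X : ℕ} (hX : X < M.dom.length) :
    Node.ind X (x.get X) ∈ C :=
  hC.smooth.ind_mem_of_supports hC.wf hC.wf.root_lt ((hC.supports_root_iff x).2 hx) X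
    (by simpa [hC.smooth.vars_root hC.wf] using hX)

theorem exists_maxPlus_root_eq (h : C.maxPlus ω (C.length - 1) ≠ ⊥) :
    ∃ x : M.Inst, M.value x ≠ 0 ∧ C.maxPlus ω (C.length - 1) =
      ((∑ X ∈ Finset.range M.dom.length, ω X (x.get X) : R) : WithBot R) := by
  have hvars := hC.smooth.vars_root hC.wf
  obtain ⟨g, hg, hsum⟩ := hC.decomposable.exists_maxPlus_eq hC.smooth hC.wf ω hC.wf.root_lt h
  have hind := hC.smooth.ind_mem_of_supports hC.wf hC.wf.root_lt hg
  rw [hvars] at hind hsum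
  let x : M.Inst := fun X => ⟨g X, (hC.wf.ind_lt X (g X) (hind X (by simp))).2⟩
  have hxg : ∀ X ∈ Finset.range M.dom.length, g X = x.get X := fun X hX => by
    simp [Model.Inst.get, Finset.mem_range.1 hX, x]
  refine ⟨x, ?_, ?_⟩
  · rw [← hC.supports_root_iff]
    exact (hC.wf.supports_congr hC.wf.root_lt (hvars ▸ hxg)).1 hg
  · rw [hsum, Finset.sum_congr rfl fun X hX => by rw [hxg X hX]]

end Circuit.Compiles

/-! ### The expanded model -/

theorem foldl_mul_add_lt (card g : ℕ → ℕ) {scope : List ℕ} (h : ∀ X ∈ scope, g X < card X)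
    (r : ℕ) :
    scope.foldl (fun r X => r * card X + g X) r < (r + 1) * (scope.map card).prod := by
  induction scope generalizing r with
  | nil => simp
  | cons X scope ih =>
    have hX := h X (by simp)
    calc scope.foldl (fun r X => r * card X + g X) (r * card X + g X)
        < (r * card X + g X + 1) * (scope.map card).prod := ih (fun Y hY => h Y (by simp [hY])) _
      _ ≤ (r + 1) * card X * (scope.map card).prod := Nat.mul_le_mul_right _ (by grind)
      _ = (r + 1) * ((X :: scope).map card).prod := by simp [mul_assoc]

/-- A list of `n` zeros and ones: `t` zeros, and then ones separated by `L` zeros. -/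
def spacedOnes (L : ℕ) : ℕ → ℕ → List ℚ≥0
  | _, 0 => []
  | 0, n + 1 => 1 :: spacedOnes L L n
  | t + 1, n + 1 => 0 :: spacedOnes L t n

theorem length_spacedOnes (L t n : ℕ) : (spacedOnes L t n).length = n := by
  fun_induction spacedOnes <;> simp [*]

theorem getD_spacedOnes_ne_zero_iff (L t n k : ℕ) :
    (spacedOnes L t n).getD k 0 ≠ 0 ↔ k < n ∧ ∃ q, k = t + q * (L + 1) := by
  induction n generalizing t k with
  | zero => simp [spacedOnes]
  | succ n ih =>
    cases t with
    | zero =>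
      cases k with
      | zero => simp [spacedOnes]
      | succ k =>
        rw [spacedOnes, List.getD_cons_succ, ih, Nat.succ_lt_succ_iff]
        refine and_congr_right fun _ => ⟨?_, ?_⟩
        · rintro ⟨q, rfl⟩
          exact ⟨q + 1, by ring⟩
        · rintro ⟨_ | q, hq⟩
          · omega
          · exact ⟨q, by linarith⟩
    | succ t =>
      cases k with
      | zero => simp [spacedOnes]; omega
      | succ k =>
        rw [spacedOnes, List.getD_cons_succ, ih, Nat.succ_lt_succ_iff]
        exact and_congr_right fun _ => exists_congr fun q => by omega

/-- The identity matrix of order `L`, row after row. -/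
def diagTable (L : ℕ) : List ℚ≥0 := spacedOnes L 0 (L * L)

theorem getD_diagTable_ne_zero_iff {L r c : ℕ} (hr : r < L) (hc : c < L) :
    (diagTable L).getD (r * L + c) 0 ≠ 0 ↔ c = r := by
  rw [diagTable, getD_spacedOnes_ne_zero_iff]
  constructor
  · rintro ⟨-, q, hq⟩
    obtain h | rfl | h := lt_trichotomy q r
    · nlinarith
    · linarith
    · nlinarith
  · rintro rfl
    exact ⟨by nlinarith, c, by ring⟩

namespace Model

section Tables

variable {M : Model}

theorem Inst.get_lt (x : M.Inst) {X : ℕ} (hX : X < M.dom.length) : x.get X < M.card X := by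
  simp [Inst.get, hX]

theorem value_ne_zero_iff {x : M.Inst} :
    M.value x ≠ 0 ↔ ∀ f ∈ M.factors, M.factorValue f x ≠ 0 := by
  simp [value, List.prod_eq_zero_iff]

theorem rowIndex_append_singleton (x : M.Inst) (scope : List ℕ) (X : ℕ) :
    M.rowIndex x (scope ++ [X]) = M.rowIndex x scope * M.card X + x.get X := by
  simp [rowIndex]

theorem rowIndex_congr {N : Model} {x : M.Inst} {y : N.Inst} {scope : List ℕ}
    (hcard : ∀ X ∈ scope, M.card X = N.card X) (hget : ∀ X ∈ scope, x.get X = y.get X) :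
    M.rowIndex x scope = N.rowIndex y scope := by
  unfold rowIndex
  exact List.foldl_ext _ _ _ fun r X hX => by rw [hcard X hX, hget X hX]

variable (hM : M.WF)
include hM

theorem WF.card_pos_of_lt {X : ℕ} (hX : X < M.dom.length) : 0 < M.card X := by
  rw [card, List.getD_eq_getElem _ _ hX]
  exact hM.card_pos _ (List.getElem_mem hX)

theorem WF.table_length_pos {f : Factor} (hf : f ∈ M.factors) : 0 < f.table.length := by
  rw [hM.table_length f hf]
  refine List.prod_pos ?_
  simpa using fun X hX => hM.card_pos_of_lt (hM.scope_lt f hf X hX)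

theorem WF.rowIndex_lt {f : Factor} (hf : f ∈ M.factors) (x : M.Inst) :
    M.rowIndex x f.scope < f.table.length := by
  rw [hM.table_length f hf]
  simpa [rowIndex] using
    foldl_mul_add_lt M.card x.get (fun X hX => x.get_lt (hM.scope_lt f hf X hX)) 0

theorem WF.factorValue_mem {f : Factor} (hf : f ∈ M.factors) (x : M.Inst) :
    M.factorValue f x ∈ f.table := by
  rw [factorValue, List.getD_eq_getElem _ _ (hM.rowIndex_lt hf x)]
  exact List.getElem_mem _

end Tables

/-- The factor that couples the variables of `f` to the row variable `R`: its value is `1` if `R`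
is the row of `f` chosen by the other variables, and `0` otherwise. -/
def rowFactor (f : Factor) (R : ℕ) : Factor := ⟨f.scope ++ [R], diagTable f.table.length⟩

/-- A factor over the variable `Z` with `D` values that vanishes nowhere and whose last entry has
as many bits as we please. -/
def paddingFactor (Z D j : ℕ) : Factor := ⟨[Z], List.replicate (D - 1) 1 ++ [((2 ^ j : ℕ) : ℚ≥0)]⟩

/-- The model with the variables of `M`, a row variable for each factor of `M`, and a padding
variable with `D` values. Each factor of `M` is replaced by the factor that determines the row. -/
def expand (M : Model) (D j : ℕ) : Model where
  dom := M.dom ++ (M.factors.map (fun f => f.table.length) ++ [D])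
  factors := (M.factors.zipIdx M.dom.length).map (fun fR => rowFactor fR.1 fR.2) ++
    [paddingFactor (M.dom.length + M.factors.length) D j]

variable {M : Model} {D j : ℕ}

theorem length_expand_dom : (M.expand D j).dom.length = M.dom.length + M.factors.length + 1 := by
  simp [expand, add_assoc]

theorem mem_expand_factors {g : Factor} : g ∈ (M.expand D j).factors ↔
    (∃ (i : ℕ) (h : i < M.factors.length), g = rowFactor M.factors[i] (M.dom.length + i)) ∨
      g = paddingFactor (M.dom.length + M.factors.length) D j := by
  simp only [expand, List.mem_append, List.mem_map, List.mem_iff_getElem (a := (_ : _ × _)),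
    List.getElem_zipIdx, List.length_zipIdx, List.mem_singleton]
  grind

theorem card_expand_of_lt {X : ℕ} (hX : X < M.dom.length) :
    (M.expand D j).card X = M.card X := by
  rw [card, card, expand, List.getD_append _ _ _ _ hX]

theorem card_expand_row {i : ℕ} (hi : i < M.factors.length) :
    (M.expand D j).card (M.dom.length + i) = M.factors[i].table.length := by
  simp [card, expand, List.getD_eq_getElem?_getD, List.getElem?_append, hi]

theorem card_expand_padding :
    (M.expand D j).card (M.dom.length + M.factors.length) = D := by
  simp [card, expand, List.getD_eq_getElem?_getD]

theorem expand_variable_cases {X : ℕ} (hX : X < (M.expand D j).dom.length) :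
    X < M.dom.length ∨ (∃ i < M.factors.length, X = M.dom.length + i) ∨
      X = M.dom.length + M.factors.length := by
  rw [length_expand_dom] at hX
  by_cases h : M.dom.length ≤ X ∧ X < M.dom.length + M.factors.length
  · exact .inr (.inl ⟨X - M.dom.length, by omega, by omega⟩)
  · omega

theorem WF.rowFactor_length (hM : M.WF) {i : ℕ} (hi : i < M.factors.length) :
    (diagTable M.factors[i].table.length).length =
      ((M.factors[i].scope ++ [M.dom.length + i]).map (M.expand D j).card).prod := by
  have hf := List.getElem_mem hi
  have hcard : M.factors[i].scope.map (M.expand D j).card = M.factors[i].scope.map M.card :=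
    List.map_congr_left fun X hX => card_expand_of_lt (hM.scope_lt _ hf X hX)
  simp [diagTable, length_spacedOnes, hcard, card_expand_row hi, hM.table_length _ hf]

theorem WF.expand (hM : M.WF) (hD : 0 < D) : (M.expand D j).WF where
  card_pos d hd := by
    simp only [Model.expand, List.mem_append, List.mem_map, List.mem_singleton] at hd
    obtain hd | ⟨f, hf, rfl⟩ | rfl := hd
    exacts [hM.card_pos d hd, hM.table_length_pos hf, hD]
  scope_nodup g hg := by
    obtain ⟨i, hi, rfl⟩ | rfl := mem_expand_factors.1 hg
    · have hf := List.getElem_mem hi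
      refine List.nodup_append.2 ⟨hM.scope_nodup _ hf, by simp, fun a ha b hb => ?_⟩
      have := hM.scope_lt _ hf a ha
      simp only [List.mem_singleton] at hb
      omega
    · simp [paddingFactor]
  scope_lt g hg X hX := by
    rw [length_expand_dom]
    obtain ⟨i, hi, rfl⟩ | rfl := mem_expand_factors.1 hg
    · obtain hX | hX := List.mem_append.1 hX
      · have := hM.scope_lt _ (List.getElem_mem hi) X hX
        omega
      · simp only [List.mem_singleton] at hX
        omega
    · simp only [paddingFactor, List.mem_singleton] at hX
      omega
  table_length g hg := by
    obtain ⟨i, hi, rfl⟩ | rfl := mem_expand_factors.1 hg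
    · exact hM.rowFactor_length hi
    · simp [paddingFactor, card_expand_padding, Nat.sub_add_cancel hD]
  covered X hX := by
    simp only [mem_expand_factors]
    obtain hX | ⟨i, hi, rfl⟩ | rfl := expand_variable_cases hX
    · obtain ⟨f, hf, hXf⟩ := hM.covered X hX
      obtain ⟨i, hi, rfl⟩ := List.mem_iff_getElem.1 hf
      exact ⟨_, .inl ⟨i, hi, rfl⟩, by simp [rowFactor, hXf]⟩
    · exact ⟨_, .inl ⟨i, hi, rfl⟩, by simp [rowFactor]⟩
    · exact ⟨_, .inr rfl, by simp [paddingFactor]⟩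

/-- The part of an instantiation of the expanded model on the original variables. -/
def restrict (y : (M.expand D j).Inst) : M.Inst := fun X =>
  ⟨y.get X, by
    rw [← card_expand_of_lt (D := D) (j := j) X.2]
    exact y.get_lt (by rw [length_expand_dom]; omega)⟩

theorem restrict_get (y : (M.expand D j).Inst) {X : ℕ} (hX : X < M.dom.length) :
    (restrict y).get X = y.get X := by
  simp [Inst.get, hX, restrict]

theorem factorValue_paddingFactor_ne_zero (y : (M.expand D j).Inst) :
    (M.expand D j).factorValue (paddingFactor (M.dom.length + M.factors.length) D j) y ≠ 0 := by
  have hy := y.get_lt (X := M.dom.length + M.factors.length) (by simp [length_expand_dom])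
  rw [card_expand_padding] at hy
  simp only [factorValue, paddingFactor, rowIndex, List.foldl_cons, List.foldl_nil, zero_mul,
    zero_add]
  rw [List.getD_eq_getElem _ _ (by simp; omega), List.getElem_append]
  split <;> simp

theorem WF.factorValue_rowFactor_ne_zero_iff (hM : M.WF) (y : (M.expand D j).Inst) {i : ℕ}
    (hi : i < M.factors.length) :
    (M.expand D j).factorValue (rowFactor M.factors[i] (M.dom.length + i)) y ≠ 0 ↔
      y.get (M.dom.length + i) = M.rowIndex (restrict y) M.factors[i].scope := by
  have hf := List.getElem_mem hi
  have hy := y.get_lt (X := M.dom.length + i) (by rw [length_expand_dom]; omega)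
  rw [card_expand_row hi] at hy
  have hrow : (M.expand D j).rowIndex y M.factors[i].scope =
      M.rowIndex (restrict y) M.factors[i].scope :=
    rowIndex_congr (fun X hX => card_expand_of_lt (hM.scope_lt _ hf X hX))
      (fun X hX => (restrict_get y (hM.scope_lt _ hf X hX)).symm)
  simp only [factorValue, rowFactor, rowIndex_append_singleton, card_expand_row hi, hrow]
  exact getD_diagTable_ne_zero_iff (hM.rowIndex_lt hf _) hy

theorem WF.value_expand_ne_zero_iff (hM : M.WF) (y : (M.expand D j).Inst) :
    (M.expand D j).value y ≠ 0 ↔ ∀ i (h : i < M.factors.length),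
      y.get (M.dom.length + i) = M.rowIndex (restrict y) M.factors[i].scope := by
  simp only [value_ne_zero_iff, mem_expand_factors]
  constructor
  · exact fun h i hi => (hM.factorValue_rowFactor_ne_zero_iff y hi).1 (h _ (.inl ⟨i, hi, rfl⟩))
  · rintro h _ (⟨i, hi, rfl⟩ | rfl)
    exacts [(hM.factorValue_rowFactor_ne_zero_iff y hi).2 (h i hi),
      factorValue_paddingFactor_ne_zero y]

theorem WF.exists_value_expand_ne_zero (hM : M.WF) (x : M.Inst) {z : ℕ} (hz : z < D) :
    ∃ y : (M.expand D j).Inst, (M.expand D j).value y ≠ 0 ∧ restrict y = x ∧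
      y.get (M.dom.length + M.factors.length) = z := by
  have hlen := length_expand_dom (M := M) (D := D) (j := j)
  let g : ℕ → ℕ := fun X => if X < M.dom.length then x.get X else
    if h : X - M.dom.length < M.factors.length then
      M.rowIndex x M.factors[X - M.dom.length].scope else z
  have hg : ∀ X < (M.expand D j).dom.length, g X < (M.expand D j).card X := fun X hX => by
    obtain hX | ⟨i, hi, rfl⟩ | rfl := expand_variable_cases hX
    · simpa [g, hX, card_expand_of_lt hX] using x.get_lt hX
    · simpa [g, hi, card_expand_row hi] using hM.rowIndex_lt (List.getElem_mem hi) x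
    · simpa [g, card_expand_padding] using hz
  let y : (M.expand D j).Inst := fun X => ⟨g X, hg X X.2⟩
  have hy : ∀ X < (M.expand D j).dom.length, y.get X = g X := fun X hX => by
    simp only [Inst.get, hX, y, dif_pos]
  have hres : restrict y = x := by
    ext X
    change y.get X = x X
    rw [hy X (by omega)]
    simp [g, Inst.get]
  refine ⟨y, (hM.value_expand_ne_zero_iff y).2 fun i h => ?_, hres, ?_⟩
  · simp [hres, hy _ (by omega : M.dom.length + i < _), g, h]
  · simp [hy _ (by omega : M.dom.length + M.factors.length < _), g]

theorem le_length_of_compiles (hM : M.WF) {C : Circuit} (hC : C.Compiles (M.expand D j)) :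
    D ≤ C.length := by
  let x : M.Inst := fun X => ⟨0, hM.card_pos_of_lt X.2⟩
  have hsub : (List.range D).map (Node.ind (M.dom.length + M.factors.length)) ⊆ C := by
    intro nd hnd
    obtain ⟨z, hz, rfl⟩ := List.mem_map.1 hnd
    obtain ⟨y, hy, -, hyz⟩ := hM.exists_value_expand_ne_zero (j := j) x (List.mem_range.1 hz)
    rw [← hyz]
    exact hC.ind_mem hy (by simp [length_expand_dom])
  have hnd : ((List.range D).map (Node.ind (M.dom.length + M.factors.length))).Nodup :=
    List.nodup_range.map fun a b h => by injection h
  simpa using (hnd.subperm hsub).length_le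

end Model

/-! ### Integer logarithms -/

section Logarithms

open Real

/-- Halves the mantissa `m` of the number `2 ^ e * m` until it has at most `P + 1` bits, adjusting
the exponent `e`. Numbers are written as pairs `(e, m)`. -/
def normalize (P : ℕ) (em : ℕ × ℕ) : ℕ × ℕ :=
  (em.1 + (em.2.size - (P + 1)), em.2 / 2 ^ (em.2.size - (P + 1)))

/-- The square of the number `2 ^ e * m`, rounded to a mantissa of `P + 1` bits. -/
def roundedSquare (P : ℕ) (em : ℕ × ℕ) : ℕ × ℕ :=
  normalize P (em.1 + em.1, em.2 * em.2)

/-- The exponent of `(2 ^ P * a) ^ 2 ^ Q`, computed by `Q` squarings with mantissas of `P + 1`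
bits. Up to an additive constant and rounding errors this is `2 ^ Q * logb 2 a`. -/
def ilog (P Q a : ℕ) : ℕ := ((roundedSquare P)^[Q] (normalize P (0, 2 ^ P * a))).1

/-- The binary logarithm of the number `2 ^ e * m`. -/
noncomputable def floatLog (em : ℕ × ℕ) : ℝ := em.1 + logb 2 em.2

theorem normalize_mantissa_lt (P : ℕ) (em : ℕ × ℕ) : (normalize P em).2 < 2 ^ (P + 1) := by
  rw [normalize, Nat.div_lt_iff_lt_mul (by positivity), ← pow_add]
  exact (Nat.lt_size_self em.2).trans_le (Nat.pow_le_pow_right two_pos (by omega))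

theorem le_normalize_mantissa {P e m : ℕ} (h : 2 ^ P ≤ m) : 2 ^ P ≤ (normalize P (e, m)).2 := by
  rw [normalize, Nat.le_div_iff_mul_le (by positivity), ← pow_add]
  have := Nat.lt_size.2 h
  exact Nat.lt_size.1 (by dsimp only; omega)

theorem logb_two_one_add_le {x : ℝ} (hx : 0 ≤ x) : logb 2 (1 + x) ≤ 2 * x := by
  rw [logb, div_le_iff₀ (log_pos one_lt_two)]
  have := log_le_sub_one_of_pos (by linarith : 0 < 1 + x)
  nlinarith [log_two_gt_d9]

theorem le_logb_two_one_add {x : ℝ} (hx : 0 ≤ x) (hx1 : x ≤ 1) : x ≤ logb 2 (1 + x) := by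
  rw [le_logb_iff_rpow_le one_lt_two (by linarith)]
  have := rpow_one_add_le_one_add_mul_self (s := 1) (by norm_num) hx hx1
  norm_num at this
  linarith

theorem floatLog_normalize_bounds {P e m : ℕ} (h : 2 ^ P ≤ m) :
    floatLog (e, m) - 2 / 2 ^ P ≤ floatLog (normalize P (e, m)) ∧
      floatLog (normalize P (e, m)) ≤ floatLog (e, m) := by
  have hq := le_normalize_mantissa (e := e) h
  simp only [normalize, floatLog] at hq ⊢
  generalize m.size - (P + 1) = c at hq ⊢
  have hle := Nat.div_mul_le_self m (2 ^ c)
  have hlt : m < (m / 2 ^ c + 1) * 2 ^ c :=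
    Nat.lt_mul_of_div_lt (Nat.lt_succ_self _) (by positivity)
  generalize m / 2 ^ c = q at hq hle hlt ⊢
  have hqR : (2 : ℝ) ^ P ≤ q := by exact_mod_cast hq
  have hq0 : (0 : ℝ) < q := lt_of_lt_of_le (by positivity) hqR
  have hm0 : (0 : ℝ) < m := by exact_mod_cast lt_of_lt_of_le (by positivity) h
  have hshift : logb 2 (q * 2 ^ c) = c + logb 2 q := by
    rw [logb_mul hq0.ne' (by positivity), logb_pow]; simp [add_comm]
  push_cast
  constructor
  · have hround : logb 2 m ≤ logb 2 (q * 2 ^ c) + 2 * (1 / q) := by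
      calc logb 2 m ≤ logb 2 (q * 2 ^ c * (1 + 1 / q)) := by
            refine logb_le_logb_of_le one_lt_two hm0 ?_
            rw [mul_right_comm, mul_add, mul_one, mul_one_div_cancel hq0.ne']
            exact_mod_cast hlt.le
        _ = logb 2 (q * 2 ^ c) + logb 2 (1 + 1 / q) := logb_mul (by positivity) (by positivity)
        _ ≤ _ := by gcongr; exact logb_two_one_add_le (by positivity)
    have : 2 * (1 / (q : ℝ)) ≤ 2 / 2 ^ P := by rw [mul_one_div]; gcongr
    linarith
  · have : logb 2 (q * 2 ^ c) ≤ logb 2 m :=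
      logb_le_logb_of_le one_lt_two (by positivity) (by exact_mod_cast hle)
    linarith

theorem floatLog_iterate_roundedSquare_bounds {P : ℕ} {em : ℕ × ℕ} (h : 2 ^ P ≤ em.2)
    (h' : em.2 < 2 ^ (P + 1)) (i : ℕ) :
    2 ^ P ≤ ((roundedSquare P)^[i] em).2 ∧ ((roundedSquare P)^[i] em).2 < 2 ^ (P + 1) ∧
      2 ^ i * floatLog em - (2 ^ i - 1) * (2 / 2 ^ P) ≤ floatLog ((roundedSquare P)^[i] em) ∧
      floatLog ((roundedSquare P)^[i] em) ≤ 2 ^ i * floatLog em := by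
  induction i with
  | zero => simp [h, h']
  | succ i ih =>
    rw [Function.iterate_succ_apply']
    generalize (roundedSquare P)^[i] em = fm at ih
    obtain ⟨f, m⟩ := fm
    obtain ⟨hm, -, hlow, hup⟩ := ih
    have hsq : 2 ^ P ≤ m * m := hm.trans (Nat.le_mul_self m)
    have hm0 : (m : ℝ) ≠ 0 := by
      exact_mod_cast (lt_of_lt_of_le (by positivity : 0 < 2 ^ P) hm).ne'
    have hdouble : floatLog (f + f, m * m) = 2 * floatLog (f, m) := by
      simp only [floatLog, Nat.cast_add, Nat.cast_mul, logb_mul hm0 hm0]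
      ring
    obtain ⟨hlow', hup'⟩ := floatLog_normalize_bounds (e := f + f) hsq
    have hm1 := le_normalize_mantissa (e := f + f) hsq
    rw [hdouble] at hlow' hup'
    refine ⟨hm1, normalize_mantissa_lt P _, ?_, ?_⟩
    · simp only [roundedSquare, pow_succ] at hlow' ⊢
      linarith
    · simp only [roundedSquare, pow_succ] at hup' ⊢
      linarith

theorem ilog_bounds {P Q a : ℕ} (hPQ : Q + 1 ≤ P) (ha : a ≠ 0) :
    2 ^ Q * logb 2 a + (2 ^ Q - 1) * P - 3 ≤ ilog P Q a ∧
      ilog P Q a ≤ 2 ^ Q * logb 2 a + (2 ^ Q - 1) * P := by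
  have hinit : 2 ^ P ≤ 2 ^ P * a := Nat.le_mul_of_pos_right _ (Nat.pos_of_ne_zero ha)
  have hm := le_normalize_mantissa (e := 0) hinit
  obtain ⟨hlow, hup⟩ := floatLog_normalize_bounds (e := 0) hinit
  obtain ⟨hq, hq', hlow', hup'⟩ := floatLog_iterate_roundedSquare_bounds hm
    (normalize_mantissa_lt P _) Q
  have hlog : floatLog (0, 2 ^ P * a) = P + logb 2 a := by
    have : (a : ℝ) ≠ 0 := by exact_mod_cast ha
    simp [floatLog, logb_mul, logb_pow, this]
  rw [hlog] at hlow hup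
  unfold ilog
  generalize normalize P (0, 2 ^ P * a) = em at *
  generalize (roundedSquare P)^[Q] em = fm at *
  have hmantissa : (P : ℝ) ≤ logb 2 fm.2 ∧ logb 2 fm.2 ≤ P + 1 := by
    have h0 : (0 : ℝ) < fm.2 := by exact_mod_cast lt_of_lt_of_le (by positivity) hq
    rw [le_logb_iff_rpow_le one_lt_two h0, logb_le_iff_le_rpow one_lt_two h0]
    exact ⟨by exact_mod_cast hq, by exact_mod_cast hq'.le⟩
  have herror : (2 ^ Q : ℝ) * (2 / 2 ^ P) ≤ 1 := by
    rw [← mul_div_assoc, div_le_one (by positivity), ← pow_succ]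
    exact pow_le_pow_right₀ one_le_two hPQ
  have hpow : (0 : ℝ) < 2 ^ Q := by positivity
  have hε : (0 : ℝ) < 2 / 2 ^ P := by positivity
  simp only [floatLog] at *
  constructor <;> nlinarith

theorem ilog_le {P Q s a : ℕ} (hPQ : Q + 1 ≤ P) (ha : a ≠ 0) (has : a.size ≤ s) :
    ilog P Q a ≤ 2 ^ Q * (s + P) := by
  have hlog : logb 2 a ≤ s := by
    rw [logb_le_iff_le_rpow one_lt_two (by positivity)]
    exact_mod_cast (Nat.size_le.1 has).le
  have hbound : (ilog P Q a : ℝ) ≤ 2 ^ Q * (s + P) := by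
    have h := (ilog_bounds hPQ ha).2
    have hpow : (0 : ℝ) < 2 ^ Q := by positivity
    nlinarith [(Nat.cast_nonneg P : (0 : ℝ) ≤ P)]
  exact_mod_cast hbound

/-- The weight of a row with the value `q`. Up to an additive constant and rounding errors the
weight of a nonzero `q` is `2 ^ (4 * s) * logb 2 q`; the constant is so large that a sum of weights
over the factors of a model of size `s` is not maximal if a weight is `0`. -/
def rowWeight (s : ℕ) (q : ℚ≥0) : ℕ :=
  if q.num = 0 then 0
  else 2 ^ (12 * s) + ilog (8 * s) (4 * s) q.num + (2 ^ (8 * s) - ilog (8 * s) (4 * s) q.den)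

theorem mul_lt_succ_pow (a n : ℕ) : a * n < (a + 1) ^ n := by
  have := one_add_mul_le_pow_of_sq_nonneg (a := a) (zero_le) (zero_le) (zero_le) n
  rw [add_comm 1 a, mul_comm] at this
  exact Nat.lt_of_succ_le (by simpa [add_comm] using this)

theorem ilog_le_two_pow {s a : ℕ} (ha : a ≠ 0) (has : a.size ≤ s) :
    ilog (8 * s) (4 * s) a ≤ 2 ^ (8 * s) := by
  have hs : 0 < s := (Nat.size_pos.2 (Nat.pos_of_ne_zero ha)).trans_le has
  calc ilog (8 * s) (4 * s) a ≤ 2 ^ (4 * s) * (s + (8 * s : ℕ)) := by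
        exact_mod_cast ilog_le (by omega) ha has
    _ ≤ 2 ^ (4 * s) * 2 ^ (4 * s) := by
        gcongr
        have := mul_lt_succ_pow 15 s
        rw [pow_mul]
        norm_num at this ⊢
        omega
    _ = 2 ^ (8 * s) := by ring

theorem rowWeight_bounds {s : ℕ} {q : ℚ≥0} (hq : q ≠ 0) (hnum : q.num.size ≤ s)
    (hden : q.den.size ≤ s) :
    |(rowWeight s q : ℝ) - (2 ^ (12 * s) + 2 ^ (8 * s) +
      2 ^ (4 * s) * (logb 2 q.num - logb 2 q.den))| ≤ 3 := by
  have hnum0 : q.num ≠ 0 := NNRat.num_ne_zero.2 hq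
  have hs : 0 < s := (Nat.size_pos.2 (Nat.pos_of_ne_zero hnum0)).trans_le hnum
  have hle := ilog_le_two_pow q.den_ne_zero hden
  obtain ⟨h1, h2⟩ := ilog_bounds (P := 8 * s) (Q := 4 * s) (by omega) hnum0
  obtain ⟨h3, h4⟩ := ilog_bounds (P := 8 * s) (Q := 4 * s) (by omega) q.den_ne_zero
  rw [rowWeight, if_neg hnum0]
  push_cast [Nat.cast_sub hle] at *
  rw [abs_le]
  constructor <;> linarith

theorem prod_num_ne_zero {l : List ℚ≥0} (hl : ∀ q ∈ l, q ≠ 0) : (l.map NNRat.num).prod ≠ 0 := by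
  simpa [List.prod_eq_zero_iff] using fun q hq => hl q hq

theorem prod_den_ne_zero (l : List ℚ≥0) : (l.map NNRat.den).prod ≠ 0 := by
  simp [List.prod_eq_zero_iff]

theorem sum_rowWeight_bounds {s : ℕ} {l : List ℚ≥0} (hl : ∀ q ∈ l, q ≠ 0)
    (hs : ∀ q ∈ l, q.num.size ≤ s ∧ q.den.size ≤ s) :
    |((l.map (rowWeight s)).sum : ℝ) - (l.length * (2 ^ (12 * s) + 2 ^ (8 * s)) +
      2 ^ (4 * s) * (logb 2 (l.map NNRat.num).prod - logb 2 (l.map NNRat.den).prod))| ≤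
        3 * l.length := by
  induction l with
  | nil => simp
  | cons q l ih =>
    have hq := rowWeight_bounds (hl q (by simp)) (hs q (by simp)).1 (hs q (by simp)).2
    have ih := ih (fun r hr => hl r (by simp [hr])) (fun r hr => hs r (by simp [hr]))
    have hnum : ((l.map NNRat.num).prod : ℝ) ≠ 0 := by
      exact_mod_cast prod_num_ne_zero fun r hr => hl r (by simp [hr])
    have hden : ((l.map NNRat.den).prod : ℝ) ≠ 0 := by exact_mod_cast prod_den_ne_zero l
    have hnumq : (q.num : ℝ) ≠ 0 := by exact_mod_cast NNRat.num_ne_zero.2 (hl q (by simp))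
    have hdenq : (q.den : ℝ) ≠ 0 := by exact_mod_cast q.den_ne_zero
    simp only [List.map_cons, List.sum_cons, List.prod_cons, List.length_cons, Nat.cast_add,
      Nat.cast_mul, Nat.cast_one, logb_mul hnumq hnum, logb_mul hdenq hden]
    rw [abs_le] at *
    constructor <;> linarith

theorem one_div_le_logb_sub_logb {a b : ℕ} (ha : a ≠ 0) (h : a < b) :
    1 / (a : ℝ) ≤ logb 2 b - logb 2 a := by
  have ha' : (0 : ℝ) < a := by exact_mod_cast Nat.pos_of_ne_zero ha
  have ha1 : (1 : ℝ) ≤ a := by exact_mod_cast Nat.pos_of_ne_zero ha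
  calc 1 / (a : ℝ) ≤ logb 2 (1 + 1 / a) :=
        le_logb_two_one_add (by positivity) ((div_le_one ha').2 ha1)
    _ = logb 2 (a + 1) - logb 2 a := by
        rw [← logb_div (by positivity) ha'.ne']
        congr 1
        field_simp
    _ ≤ logb 2 b - logb 2 a := by
        gcongr
        · exact one_lt_two
        · exact_mod_cast h

theorem prod_le_two_pow_sum_size (l : List ℕ) : l.prod ≤ 2 ^ (l.map Nat.size).sum := by
  induction l with
  | nil => simp
  | cons a l ih =>
    simp only [List.prod_cons, List.map_cons, List.sum_cons, pow_add]
    exact Nat.mul_le_mul (Nat.lt_size_self a).le ih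

theorem prod_eq_div (l : List ℚ≥0) :
    l.prod = ((l.map NNRat.num).prod : ℚ≥0) / ((l.map NNRat.den).prod : ℚ≥0) := by
  induction l with
  | nil => simp
  | cons q l ih => simp [ih, mul_div_mul_comm, NNRat.num_div_den]

/-- The number of bits of the numerators and denominators of a list of fractions. -/
def fractionBits (l : List ℚ≥0) : ℕ := (l.map fun q => q.num.size + q.den.size).sum

theorem size_le_of_mem_of_fractionBits_le {l : List ℚ≥0} {s : ℕ} (hs : fractionBits l ≤ s)
    {q : ℚ≥0} (hq : q ∈ l) : q.num.size ≤ s ∧ q.den.size ≤ s := by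
  have h := List.single_le_sum (by simp) _
    (List.mem_map_of_mem (f := fun q : ℚ≥0 => q.num.size + q.den.size) hq)
  rw [fractionBits] at hs
  omega

theorem two_mul_length_le_fractionBits {l : List ℚ≥0} (hl : ∀ q ∈ l, q ≠ 0) :
    2 * l.length ≤ fractionBits l := by
  have h := List.card_nsmul_le_sum (l.map fun q => q.num.size + q.den.size) 2 (by
    simp only [List.mem_map, forall_exists_index, and_imp]
    rintro _ q hq rfl
    have := Nat.size_pos.2 (Nat.pos_of_ne_zero (NNRat.num_ne_zero.2 (hl q hq)))
    have := Nat.size_pos.2 q.den_pos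
    omega)
  simpa [fractionBits, mul_comm] using h

theorem prod_num_mul_prod_den_le {l l' : List ℚ≥0} {s : ℕ} (hs : fractionBits l ≤ s)
    (hs' : fractionBits l' ≤ s) :
    (l.map NNRat.num).prod * (l'.map NNRat.den).prod ≤ 2 ^ (2 * s) := by
  simp only [fractionBits, List.sum_map_add] at hs hs'
  calc _ ≤ 2 ^ (l.map fun q => q.num.size).sum * 2 ^ (l'.map fun q => q.den.size).sum := by
        gcongr
        · simpa [Function.comp_def] using prod_le_two_pow_sum_size (l.map NNRat.num)
        · simpa [Function.comp_def] using prod_le_two_pow_sum_size (l'.map NNRat.den)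
    _ ≤ 2 ^ (2 * s) := by
        rw [← pow_add]
        exact Nat.pow_le_pow_right two_pos (by omega)

theorem logb_sub_logb_le_of_sum_rowWeight_le {s : ℕ} {l l' : List ℚ≥0} (hl : ∀ q ∈ l, q ≠ 0)
    (hl' : ∀ q ∈ l', q ≠ 0) (hlen : l.length = l'.length) (hs : fractionBits l ≤ s)
    (hs' : fractionBits l' ≤ s)
    (h : (l.map (rowWeight s)).sum ≤ (l'.map (rowWeight s)).sum) :
    2 ^ (4 * s) * (logb 2 ((l.map NNRat.num).prod * (l'.map NNRat.den).prod : ℕ) -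
      logb 2 ((l'.map NNRat.num).prod * (l.map NNRat.den).prod : ℕ)) ≤ 6 * l.length := by
  have hb := sum_rowWeight_bounds hl fun q hq => size_le_of_mem_of_fractionBits_le hs hq
  have hb' := sum_rowWeight_bounds hl' fun q hq => size_le_of_mem_of_fractionBits_le hs' hq
  have hn := prod_num_ne_zero hl
  have hn' := prod_num_ne_zero hl'
  have hd := prod_den_ne_zero l
  have hd' := prod_den_ne_zero l'
  have hR : ((l.map (rowWeight s)).sum : ℝ) ≤ (l'.map (rowWeight s)).sum := by exact_mod_cast h
  rw [Nat.cast_mul, Nat.cast_mul, logb_mul (by positivity) (by positivity),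
    logb_mul (by positivity) (by positivity)]
  rw [← hlen] at hb'
  rw [abs_le] at hb hb'
  linarith

theorem prod_le_prod_of_sum_rowWeight_le_of_ne_zero {s : ℕ} {l l' : List ℚ≥0}
    (hl : ∀ q ∈ l, q ≠ 0) (hl' : ∀ q ∈ l', q ≠ 0) (hlen : l.length = l'.length)
    (hs : fractionBits l ≤ s) (hs' : fractionBits l' ≤ s)
    (h : (l.map (rowWeight s)).sum ≤ (l'.map (rowWeight s)).sum) : l.prod ≤ l'.prod := by
  have hupper := logb_sub_logb_le_of_sum_rowWeight_le hl hl' hlen hs hs' h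
  have hN := prod_num_mul_prod_den_le hs' hs
  have hn' := prod_num_ne_zero hl'
  have hd := prod_den_ne_zero l
  have hd' := prod_den_ne_zero l'
  rw [prod_eq_div, prod_eq_div, div_le_div_iff₀ (by positivity) (by positivity)]
  by_contra! hlt
  have hgap := one_div_le_logb_sub_logb (mul_ne_zero hn' hd) (by exact_mod_cast hlt)
  have hlower : (1 : ℝ) / 2 ^ (2 * s) ≤
      1 / ((l'.map NNRat.num).prod * (l.map NNRat.den).prod : ℕ) := by
    gcongr
    exact_mod_cast hN
  have hsmall : (6 : ℝ) * l.length < 2 ^ (2 * s) := by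
    have hlen2 := (two_mul_length_le_fractionBits hl).trans hs
    have := mul_lt_succ_pow 3 s
    norm_num only at this
    rw [pow_mul]
    exact_mod_cast (by omega : 6 * l.length < 4 ^ s)
  have hpow : (2 : ℝ) ^ (4 * s) * (1 / 2 ^ (2 * s)) = 2 ^ (2 * s) := by
    rw [mul_one_div, div_eq_iff (by positivity), ← pow_add]
    ring
  have := mul_le_mul_of_nonneg_left (hlower.trans hgap) (by positivity : (0 : ℝ) ≤ 2 ^ (4 * s))
  linarith

theorem rowWeight_le {s : ℕ} {q : ℚ≥0} (hnum : q.num.size ≤ s) :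
    rowWeight s q ≤ 2 ^ (12 * s) + 2 * 2 ^ (8 * s) := by
  unfold rowWeight
  split_ifs with hq
  · exact Nat.zero_le _
  · have := ilog_le_two_pow hq hnum
    omega

theorem length_mul_two_pow_le_sum_rowWeight (s : ℕ) {l : List ℚ≥0} (hl : ∀ q ∈ l, q ≠ 0) :
    l.length * 2 ^ (12 * s) ≤ (l.map (rowWeight s)).sum := by
  have h := List.card_nsmul_le_sum (l.map (rowWeight s)) (2 ^ (12 * s)) (by
    simp only [List.mem_map, forall_exists_index, and_imp]
    rintro _ q hq rfl
    rw [rowWeight, if_neg (NNRat.num_ne_zero.2 (hl q hq))]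
    omega)
  simpa using h

theorem sum_rowWeight_le_of_mem_zero {s : ℕ} {l : List ℚ≥0} (h0 : 0 ∈ l)
    (hs : ∀ q ∈ l, q.num.size ≤ s) :
    (l.map (rowWeight s)).sum ≤ (l.length - 1) * (2 ^ (12 * s) + 2 * 2 ^ (8 * s)) := by
  rw [← List.sum_map_erase _ h0, ← List.length_erase_of_mem h0]
  have h := List.sum_le_card_nsmul ((l.erase 0).map (rowWeight s)) _ (by
    simp only [List.mem_map, forall_exists_index, and_imp]
    rintro _ q hq rfl
    exact rowWeight_le (hs q (List.mem_of_mem_erase hq)))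
  simpa [rowWeight] using h

theorem prod_le_prod_of_sum_rowWeight_le {s : ℕ} {l l' : List ℚ≥0} (hlen : l.length = l'.length)
    (hs : fractionBits l ≤ s) (hs' : fractionBits l' ≤ s)
    (h : (l.map (rowWeight s)).sum ≤ (l'.map (rowWeight s)).sum) : l.prod ≤ l'.prod := by
  by_cases hl : ∀ q ∈ l, q ≠ 0
  swap
  · have : l.prod = 0 := by simpa [List.prod_eq_zero_iff] using hl
    simp [this]
  by_cases hl' : ∀ q ∈ l', q ≠ 0
  · exact prod_le_prod_of_sum_rowWeight_le_of_ne_zero hl hl' hlen hs hs' h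
  exfalso
  push Not at hl'
  obtain ⟨_, h0, rfl⟩ := hl'
  have hpos := List.length_pos_of_mem h0
  have hlow := length_mul_two_pow_le_sum_rowWeight s hl
  have hup := sum_rowWeight_le_of_mem_zero h0 fun q hq =>
    (size_le_of_mem_of_fractionBits_le hs' hq).1
  have hlen2 := (two_mul_length_le_fractionBits hl).trans hs
  obtain ⟨n, hn⟩ : ∃ n, l'.length = n + 1 := ⟨l'.length - 1, by omega⟩
  rw [hlen, hn] at hlow
  rw [hn, Nat.add_sub_cancel] at hup
  have hsmall : 2 * n * 2 ^ (8 * s) < 2 ^ (12 * s) := by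
    rw [show 12 * s = 4 * s + 8 * s by ring, pow_add, pow_mul 2 4]
    refine Nat.mul_lt_mul_of_pos_right ?_ (by positivity)
    have := mul_lt_succ_pow 15 s
    norm_num only at this ⊢
    omega
  nlinarith

end Logarithms

/-! ### Weights and their digits -/

/-- The number of bits of a sequence of numbers, with one extra bit for each number. -/
def bits (l : List ℕ) : ℕ := (l.map fun w => w.size + 1).sum

theorem bits_nil : bits [] = 0 := rfl

theorem bits_cons (a : ℕ) (l : List ℕ) : bits (a :: l) = a.size + 1 + bits l := by
  simp [bits]

theorem bits_append (l l' : List ℕ) : bits (l ++ l') = bits l + bits l' := by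
  simp [bits]

theorem bits_flatMap {α : Type*} (l : List α) (g : α → List ℕ) :
    bits (l.flatMap g) = (l.map fun a => bits (g a)).sum := by
  induction l with
  | nil => rfl
  | cons a l ih => simp [bits_append, ih]

theorem length_le_bits (l : List ℕ) : l.length ≤ bits l := by
  induction l with
  | nil => simp
  | cons a l ih => simp only [List.length_cons, bits_cons]; omega

theorem size_lt_bits {l : List ℕ} {a : ℕ} (h : a ∈ l) : a.size < bits l :=
  List.single_le_sum (by simp) _ (List.mem_map_of_mem (f := fun w => w.size + 1) h)

theorem Factor.rowSize_le_bits (f : Factor) {q : ℚ≥0} (hq : q ∈ f.table) :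
    q.num.size + q.den.size ≤ bits f.encode := by
  have h := List.single_le_sum (l := f.table.map fun q => bits [q.num, q.den]) (by simp) _
    (List.mem_map_of_mem hq)
  simp only [encode, List.cons_append, bits_cons, bits_append, bits_flatMap] at h ⊢
  omega

theorem ofDigits_ofFn (b : ℕ) {n : ℕ} (g : ℕ → ℕ) :
    Nat.ofDigits b (List.ofFn fun i : Fin n => g i) = ∑ i ∈ Finset.range n, g i * b ^ i := by
  induction n with
  | zero => simp
  | succ n ih =>
    rw [List.ofFn_succ_last, Nat.ofDigits_append, Finset.sum_range_succ]
    simp [ih, mul_comm]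

namespace Model

variable {M : Model}

theorem size_eq_bits (M : Model) : M.size = bits M.encode := rfl

theorem bits_factors_le_size (M : Model) : bits (M.factors.flatMap Factor.encode) ≤ M.size := by
  simp only [size_eq_bits, encode, List.cons_append, bits_cons, bits_append]
  omega

theorem two_le_size (M : Model) : 2 ≤ M.size := by
  simp only [size_eq_bits, encode, List.cons_append, bits_cons, bits_append]
  omega

theorem card_lt_two_pow_size (M : Model) {X : ℕ} (hX : X < M.dom.length) :
    M.card X < 2 ^ M.size := by
  have h : M.card X ∈ M.encode := by
    rw [card, List.getD_eq_getElem _ _ hX]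
    simp [encode]
  exact Nat.size_le.1 (size_lt_bits h).le

theorem WF.fractionBits_factorValue_le (hM : M.WF) (x : M.Inst) :
    fractionBits (M.factors.map fun f => M.factorValue f x) ≤ M.size := by
  refine le_trans ?_ M.bits_factors_le_size
  rw [bits_flatMap, fractionBits, List.map_map]
  exact List.sum_le_sum fun f hf => f.rowSize_le_bits (hM.factorValue_mem hf x)

/-- The sum of the weights of the rows that `x` chooses. -/
def logWeight (M : Model) (x : M.Inst) : ℕ :=
  (M.factors.map fun f => rowWeight M.size (M.factorValue f x)).sum

theorem WF.value_le_of_logWeight_le (hM : M.WF) {x x' : M.Inst}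
    (h : M.logWeight x ≤ M.logWeight x') : M.value x ≤ M.value x' :=
  prod_le_prod_of_sum_rowWeight_le (s := M.size) (by simp) (hM.fractionBits_factorValue_le x)
    (hM.fractionBits_factorValue_le x') (by simpa [logWeight, Function.comp_def] using h)

/-- The weights of the values of the variables of the expanded model except the padding variable,
one row for each variable. In base `2 ^ M.size` the weights of the original variables fill the low
digits, one digit for each variable, and those of the row variables the digits above. -/
def weightTable (M : Model) : List (List ℕ) :=
  M.dom.zipIdx.map (fun dX => (List.range dX.1).map (· * (2 ^ M.size) ^ dX.2)) ++
    M.factors.map fun f => f.table.map (rowWeight M.size · * (2 ^ M.size) ^ M.dom.length)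

/-- The weight of the value `v` of the variable `X` of the expanded model. -/
def weight (M : Model) (X v : ℕ) : ℕ := (M.weightTable.getD X []).getD v 0

theorem weight_of_lt {X v : ℕ} (hX : X < M.dom.length) (hv : v < M.card X) :
    M.weight X v = v * (2 ^ M.size) ^ X := by
  rw [card, List.getD_eq_getElem _ _ hX] at hv
  simp [weight, weightTable, List.getD_eq_getElem?_getD, List.getElem?_append, hX, hv]

theorem weight_row {i r : ℕ} (hi : i < M.factors.length) (hr : r < M.factors[i].table.length) :
    M.weight (M.dom.length + i) r =
      rowWeight M.size (M.factors[i].table.getD r 0) * (2 ^ M.size) ^ M.dom.length := by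
  simp [weight, weightTable, List.getD_eq_getElem?_getD, hi, hr]

theorem weight_padding (v : ℕ) : M.weight (M.dom.length + M.factors.length) v = 0 := by
  simp [weight, weightTable, List.getD_eq_getElem?_getD]

variable {D j : ℕ}

/-- The digits, in base `2 ^ M.size`, of the total weight of an instantiation of the expanded model
that extends `x`. -/
def weightDigits (M : Model) (x : M.Inst) : List ℕ :=
  List.ofFn (fun X => (x X : ℕ)) ++ [M.logWeight x]

theorem WF.sum_weight (hM : M.WF) {y : (M.expand D j).Inst} (hy : (M.expand D j).value y ≠ 0) :
    ∑ X ∈ Finset.range (M.expand D j).dom.length, M.weight X (y.get X) =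
      Nat.ofDigits (2 ^ M.size) (M.weightDigits (restrict y)) := by
  have hrow := (hM.value_expand_ne_zero_iff y).1 hy
  have hget : (fun X => (restrict y X : ℕ)) = fun X : Fin M.dom.length => y.get X := rfl
  rw [length_expand_dom, Finset.sum_range_succ, Finset.sum_range_add, weight_padding, add_zero,
    weightDigits, Nat.ofDigits_append, Nat.ofDigits_singleton, List.length_ofFn, hget,
    ofDigits_ofFn]
  congr 1
  · refine Finset.sum_congr rfl fun X hX => ?_
    rw [Finset.mem_range] at hX
    exact weight_of_lt hX (restrict_get y hX ▸ (restrict y).get_lt hX)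
  · rw [mul_comm, logWeight, ← Fin.sum_univ_fun_getElem, Finset.sum_mul,
      ← Fin.sum_univ_eq_sum_range (fun i => M.weight (M.dom.length + i) _)]
    refine Finset.sum_congr rfl fun i _ => ?_
    have hi := hM.rowIndex_lt (List.getElem_mem i.2) (restrict y)
    rw [hrow i i.2, weight_row i.2 hi]
    rfl

theorem Inst.lt_two_pow_size_of_mem_ofFn (x : M.Inst) :
    ∀ d ∈ List.ofFn fun X => (x X : ℕ), d < 2 ^ M.size := by
  simp only [List.mem_ofFn, forall_exists_index]
  rintro _ X rfl
  exact (x X).2.trans (M.card_lt_two_pow_size X.2)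

theorem ofDigits_weightDigits (x : M.Inst) :
    ∃ r < (2 ^ M.size) ^ M.dom.length, Nat.ofDigits (2 ^ M.size) (M.weightDigits x) =
      r + (2 ^ M.size) ^ M.dom.length * M.logWeight x := by
  refine ⟨_, ?_, by rw [weightDigits, Nat.ofDigits_append, Nat.ofDigits_singleton,
    List.length_ofFn]⟩
  have hbase : 1 < 2 ^ M.size := Nat.one_lt_two_pow (by have := M.two_le_size; omega)
  exact (Nat.ofDigits_lt_base_pow_length hbase x.lt_two_pow_size_of_mem_ofFn).trans_eq
    (by rw [List.length_ofFn])

theorem logWeight_le_of_ofDigits_le {x x' : M.Inst}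
    (h : Nat.ofDigits (2 ^ M.size) (M.weightDigits x) ≤
      Nat.ofDigits (2 ^ M.size) (M.weightDigits x')) : M.logWeight x ≤ M.logWeight x' := by
  obtain ⟨r, -, hr⟩ := ofDigits_weightDigits x
  obtain ⟨r', hr', hr''⟩ := ofDigits_weightDigits x'
  rw [hr, hr''] at h
  by_contra! hlt
  nlinarith [Nat.mul_le_mul_left ((2 ^ M.size) ^ M.dom.length) hlt]

theorem WF.exists_isMPE_maxPlus_root_eq (hM : M.WF) (hD : 0 < D) {C : Circuit}
    (hC : C.Compiles (M.expand D j)) :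
    ∃ x : M.Inst, M.IsMPE x ∧ C.maxPlus M.weight (C.length - 1) =
      ((Nat.ofDigits (2 ^ M.size) (M.weightDigits x) : ℕ) : WithBot ℕ) := by
  have hbound : ∀ x : M.Inst, ((Nat.ofDigits (2 ^ M.size) (M.weightDigits x) : ℕ) : WithBot ℕ) ≤
      C.maxPlus M.weight (C.length - 1) := by
    intro x
    obtain ⟨y, hy, rfl, -⟩ := hM.exists_value_expand_ne_zero (j := j) x hD
    rw [← hM.sum_weight hy]
    exact hC.sum_le_maxPlus_root M.weight hy
  let x₀ : M.Inst := fun X => ⟨0, hM.card_pos_of_lt X.2⟩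
  have hne : C.maxPlus M.weight (C.length - 1) ≠ ⊥ :=
    ne_bot_of_le_ne_bot WithBot.coe_ne_bot (hbound x₀)
  obtain ⟨y, hy, hroot⟩ := hC.exists_maxPlus_root_eq M.weight hne
  rw [hM.sum_weight hy] at hroot
  refine ⟨restrict y, fun x' => hM.value_le_of_logWeight_le (logWeight_le_of_ofDigits_le ?_), hroot⟩
  exact WithBot.coe_le_coe.1 ((hbound x').trans_eq hroot)

end Model

/-! ### The size of the expanded model -/

theorem size_le_self (n : ℕ) : n.size ≤ n := Nat.size_le.2 Nat.lt_two_pow_self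

theorem bits_encode_spacedOnes_le (L t n : ℕ) :
    bits ((spacedOnes L t n).flatMap fun q => [q.num, q.den]) ≤ 4 * n := by
  fun_induction spacedOnes <;>
    simp only [List.flatMap_nil, List.flatMap_cons, bits_append, bits_cons, bits_nil,
      NNRat.num_one, NNRat.den_one, NNRat.num_zero, NNRat.den_zero, Nat.size_one,
      Nat.size_zero] <;>
    omega

theorem bits_flatten_replicate_one_one (n : ℕ) :
    bits (List.replicate n [1, 1]).flatten = 4 * n := by
  induction n with
  | zero => rfl
  | succ n ih =>
    simp only [List.replicate_succ, List.flatten_cons, bits_append, ih, bits_cons, bits_nil,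
      Nat.size_one]
    ring

namespace Factor

variable (f : Factor)

theorem length_add_le_bits_encode : f.scope.length + 2 * f.table.length + 2 ≤ bits f.encode := by
  refine le_trans (le_of_eq ?_) (length_le_bits f.encode)
  simp only [encode, List.cons_append, List.length_cons, List.length_append, List.length_flatMap,
    List.length_nil, List.map_const', List.sum_replicate, smul_eq_mul]
  omega

theorem bits_scope_le_bits_encode : bits f.scope ≤ bits f.encode := by
  simp only [encode, List.cons_append, bits_cons, bits_append]
  omega

end Factor

namespace Model

theorem bits_encode_rowFactor_le (f : Factor) {s R : ℕ} (hf : bits f.encode ≤ s) (hR : R < s) :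
    bits (rowFactor f R).encode ≤ 9 * (s * bits f.encode) := by
  have hlen := f.length_add_le_bits_encode
  have hscope := f.bits_scope_le_bits_encode
  have hdiag := bits_encode_spacedOnes_le f.table.length 0 (f.table.length * f.table.length)
  have hk := size_le_self (f.scope.length + 1)
  have hL := size_le_self (f.table.length * f.table.length)
  have hsq : 4 * (f.table.length * f.table.length) ≤ s * bits f.encode := by
    calc 4 * (f.table.length * f.table.length) = 2 * f.table.length * (2 * f.table.length) := by
          ring
      _ ≤ s * bits f.encode := by gcongr <;> omega
  have hb : bits f.encode ≤ s * bits f.encode := Nat.le_mul_of_pos_left _ (by omega)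
  have hs : s ≤ s * bits f.encode := Nat.le_mul_of_pos_right _ (by omega)
  have hR := size_le_self R
  generalize bits f.encode = b at *
  simp only [Factor.encode, rowFactor, diagTable, List.length_append, List.length_singleton,
    List.cons_append, bits_cons, bits_append, bits_nil, length_spacedOnes]
  omega

variable (M : Model)

theorem sum_bits_encode_le_size : (M.factors.map fun f => bits f.encode).sum ≤ M.size :=
  (bits_flatMap _ _).symm.le.trans M.bits_factors_le_size

theorem bits_encode_le_size {f : Factor} (hf : f ∈ M.factors) : bits f.encode ≤ M.size :=
  (List.single_le_sum (by simp) _ (List.mem_map_of_mem hf)).trans M.sum_bits_encode_le_size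

theorem length_add_length_lt_size : M.dom.length + M.factors.length + 1 < M.size := by
  refine lt_of_lt_of_le ?_ (length_le_bits M.encode)
  have : M.factors.length ≤ (M.factors.flatMap Factor.encode).length := by
    rw [List.length_flatMap]
    exact (List.length_le_sum_of_one_le _ (by simp [Factor.encode])).trans_eq' (by simp)
  simp only [encode, List.cons_append, List.length_cons, List.length_append]
  omega

/-- The encoding of the expanded model up to the last entry of the padding factor. -/
def expandHead (D : ℕ) : List ℕ :=
  [M.dom.length + M.factors.length + 1] ++ M.dom ++ (M.factors.map fun f => f.table.length) ++
    [D, M.factors.length + 1] ++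
    (M.factors.zipIdx M.dom.length).flatMap (fun fR => (rowFactor fR.1 fR.2).encode) ++
    [1, M.dom.length + M.factors.length, D] ++ (List.replicate (D - 1) [1, 1]).flatten

theorem encode_expand {D : ℕ} (hD : 0 < D) (j : ℕ) :
    (M.expand D j).encode = M.expandHead D ++ [2 ^ j, 1] := by
  simp only [encode, expand, expandHead, paddingFactor, Factor.encode, List.flatMap_append,
    List.flatMap_map, List.flatMap_cons, List.flatMap_nil, NNRat.num_natCast, NNRat.den_natCast,
    List.length_append, List.length_map, List.length_zipIdx, List.length_singleton,
    List.length_replicate, Nat.sub_add_cancel hD, List.flatMap_replicate, NNRat.num_one,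
    NNRat.den_one]
  simp [add_assoc]

theorem bits_lengths_le : bits (M.factors.map fun f => f.table.length) ≤ M.size := by
  rw [bits, List.map_map]
  refine (List.sum_le_sum fun f _ => ?_).trans M.sum_bits_encode_le_size
  have := size_le_self f.table.length
  have := f.length_add_le_bits_encode
  simp only [Function.comp_apply]
  omega

theorem bits_rowFactors_le :
    bits ((M.factors.zipIdx M.dom.length).flatMap fun fR => (rowFactor fR.1 fR.2).encode) ≤
      9 * M.size ^ 2 := by
  calc _ = ((M.factors.zipIdx M.dom.length).map
        fun fR => bits (rowFactor fR.1 fR.2).encode).sum := bits_flatMap _ _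
    _ ≤ ((M.factors.zipIdx M.dom.length).map
        fun fR => 9 * M.size * bits fR.1.encode).sum := List.sum_le_sum fun fR hfR => by
      rw [mul_assoc]
      obtain ⟨-, hlt, -⟩ := List.mem_zipIdx hfR
      have := M.length_add_length_lt_size
      exact bits_encode_rowFactor_le _
        (M.bits_encode_le_size (List.fst_mem_of_mem_zipIdx hfR)) (by omega)
    _ = 9 * M.size * (M.factors.map fun f => bits f.encode).sum := by
      rw [List.sum_map_mul_left]
      conv_rhs => rw [← List.zipIdx_map_fst M.dom.length M.factors, List.map_map]
      rfl
    _ ≤ 9 * M.size ^ 2 := by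
      rw [sq, ← mul_assoc]
      gcongr
      exact M.sum_bits_encode_le_size

theorem bits_expandHead_add_le : bits (M.expandHead (M.size ^ 3)) + 4 ≤ 16 * M.size ^ 3 := by
  have hs := M.two_le_size
  have hlen := M.length_add_length_lt_size
  have hdom : bits M.dom ≤ M.size := by
    simp only [size_eq_bits, encode, List.cons_append, bits_cons, bits_append]
    omega
  have hrows := M.bits_rowFactors_le
  have hlengths := M.bits_lengths_le
  have hsq : 2 * M.size ≤ M.size ^ 2 := by rw [sq]; gcongr
  have hcube : 2 * M.size ^ 2 ≤ M.size ^ 3 := by rw [pow_succ' _ 2]; gcongr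
  have := size_le_self (M.dom.length + M.factors.length + 1)
  have := size_le_self (M.dom.length + M.factors.length)
  have := size_le_self (M.factors.length + 1)
  have := size_le_self (M.size ^ 3)
  simp only [expandHead, bits_append, bits_cons, bits_nil, Nat.size_one,
    bits_flatten_replicate_one_one]
  omega

/-- The model that is compiled: the expansion with `M.size ^ 3` values of the padding variable,
whose last table entry is such that the size depends on `M.size` only. -/
def target : Model :=
  M.expand (M.size ^ 3) (16 * M.size ^ 3 - bits (M.expandHead (M.size ^ 3)) - 4)

theorem size_pow_three_pos : 0 < M.size ^ 3 := pow_pos (by have := M.two_le_size; omega) 3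

theorem size_target : M.target.size = 16 * M.size ^ 3 := by
  have h := M.bits_expandHead_add_le
  rw [size_eq_bits M.target, target, M.encode_expand M.size_pow_three_pos, bits_append]
  simp only [bits_cons, bits_nil, Nat.size_pow, Nat.size_one]
  omega

end Model

/-! ### Total correctness with time bounds -/

infixr:30 ";;" => Prog.seq

/-- The register that an instruction changes. -/
def Instr.dest? : Instr → Option ℕ
  | const d _ | add d _ _ | sub d _ _ | half d _ | load d _ _ => some d
  | store _ _ _ | emit _ => none

/-- The array that an instruction changes. -/
def Instr.array? : Instr → Option ℕ
  | store A _ _ => some A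
  | _ => none

namespace Prog

/-- Does the program contain an instruction with the property `p`? -/
def any (p : Instr → Bool) : Prog → Bool
  | basic i => p i
  | seq P Q => P.any p || Q.any p
  | cond _ P Q => P.any p || Q.any p
  | loop _ P => P.any p

/-- Does the program contain an instruction that changes the register `r`? -/
def writes (P : Prog) (r : ℕ) : Bool := P.any fun i => i.dest? == some r

/-- Does the program contain an instruction that changes the array `A`? -/
def stores (P : Prog) (A : ℕ) : Bool := P.any fun i => i.array? == some A

/-- Does the program contain an output instruction? -/
def emits (P : Prog) : Bool := P.any fun i => i matches .emit _

/-- Straight-line code. There is no empty program, and the empty list becomes an arbitrary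
instruction. -/
def block : List Instr → Prog
  | [] => basic (.const 0 0)
  | [i] => basic i
  | i :: l => basic i ;; block l

end Prog

/-- What a run of `P` from `σ` to `τ` leaves unchanged, for syntactic reasons. -/
structure Frame (P : Prog) (σ τ : State) : Prop where
  reg (r : ℕ) (h : P.writes r = false := by rfl) : τ.reg r = σ.reg r
  mem (A : ℕ) (h : P.stores A = false := by rfl) : τ.mem A = σ.mem A
  out (h : P.emits = false := by rfl) : τ.out = σ.out

namespace Frame

variable {P R : Prog} {σ τ υ : State}

theorem refl (P : Prog) (σ : State) : Frame P σ σ :=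
  ⟨fun _ _ => rfl, fun _ _ => rfl, fun _ => rfl⟩

theorem trans (h : Frame P σ τ) (h' : Frame P τ υ) : Frame P σ υ :=
  ⟨fun r hr => (h'.reg r hr).trans (h.reg r hr), fun A hA => (h'.mem A hA).trans (h.mem A hA),
    fun he => (h'.out he).trans (h.out he)⟩

theorem of_any (h : Frame P σ τ) (hR : ∀ p, R.any p = false → P.any p = false) : Frame R σ τ :=
  ⟨fun r hr => h.reg r (hR _ hr), fun A hA => h.mem A (hR _ hA), fun he => h.out (hR _ he)⟩

theorem seq (h : Frame P σ τ) (h' : Frame R τ υ) : Frame (P ;; R) σ υ :=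
  (h.of_any fun _ hp => (Bool.or_eq_false_iff.1 (by exact hp)).1).trans
    (h'.of_any fun _ hp => (Bool.or_eq_false_iff.1 (by exact hp)).2)

theorem basic (i : Instr) (σ : State) : Frame (.basic i) σ (i.run σ) := by
  refine ⟨fun r h => ?_, fun A h => ?_, fun h => ?_⟩ <;>
  cases i <;> simp_all [Prog.writes, Prog.stores, Prog.emits, Prog.any, Instr.dest?, Instr.array?,
    Instr.run, Function.update_of_ne, Ne.symm]

end Frame

theorem Exec.frame {P : Prog} {σ τ : State} {k : ℕ} (h : Exec P σ τ k) : Frame P σ τ := by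
  induction h with
  | basic i σ => exact .basic i σ
  | seq _ _ h h' => exact h.seq h'
  | cond_true _ _ h => exact h.of_any fun p hp => (Bool.or_eq_false_iff.1 (by exact hp)).1
  | cond_false _ _ h => exact h.of_any fun p hp => (Bool.or_eq_false_iff.1 (by exact hp)).2
  | loop_done _ => exact .refl _ _
  | @loop_step r P _ _ _ _ _ _ _ _ h h' =>
    exact (h.of_any (R := .loop r P) fun p hp => hp).trans h'

/-- Total correctness with a time bound: started in `σ`, the program `P` halts after at most `k`
steps in a state with the property `Q`. -/
def Runs (P : Prog) (σ : State) (k : ℕ) (Q : State → Prop) : Prop :=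
  ∃ τ k', Exec P σ τ k' ∧ k' ≤ k ∧ Q τ

namespace Runs

variable {P R : Prog} {σ : State} {k l r : ℕ} {Q Q' : State → Prop}

theorem mono (h : Runs P σ k Q) (hk : k ≤ l) (hQ : ∀ τ, Frame P σ τ → Q τ → Q' τ) :
    Runs P σ l Q' :=
  let ⟨τ, k', hP, hk', hτ⟩ := h
  ⟨τ, k', hP, hk'.trans hk, hQ τ hP.frame hτ⟩

theorem of_le (hk : k ≤ l) (h : Runs P σ k Q) : Runs P σ l Q := h.mono hk fun _ _ hτ => hτ

theorem seq (h : Runs P σ k Q) (h' : ∀ τ, Frame P σ τ → Q τ → Runs R τ l Q') :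
    Runs (P ;; R) σ (k + l) Q' :=
  let ⟨_, _, hP, hk, hτ⟩ := h
  let ⟨υ, _, hR, hl, hυ⟩ := h' _ hP.frame hτ
  ⟨υ, _, hP.seq hR, add_le_add hk hl, hυ⟩

theorem cond (hP : σ.reg r ≠ 0 → Runs P σ k Q) (hR : σ.reg r = 0 → Runs R σ k Q) :
    Runs (.cond r P R) σ (k + 1) Q := by
  by_cases hr : σ.reg r = 0
  · obtain ⟨τ, k', h, hk, hQ⟩ := hR hr
    exact ⟨τ, _, .cond_false hr h, by omega, hQ⟩
  · obtain ⟨τ, k', h, hk, hQ⟩ := hP hr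
    exact ⟨τ, _, .cond_true hr h, by omega, hQ⟩

theorem block {l : List Instr}
    (hQ : Frame (.block l) σ (l.foldl Instr.run σ) → Q (l.foldl Instr.run σ))
    (hl : l ≠ [] := by simp) : Runs (.block l) σ l.length Q := by
  suffices H : ∃ k ≤ l.length, Exec (.block l) σ (l.foldl Instr.run σ) k from
    let ⟨k, hk, h⟩ := H
    ⟨_, k, h, hk, hQ h.frame⟩
  clear hQ
  induction l generalizing σ with
  | nil => exact absurd rfl hl
  | cons i l ih =>
    cases l with
    | nil => exact ⟨1, le_rfl, .basic i σ⟩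
    | cons j l =>
      obtain ⟨k, hk, h⟩ := ih (σ := i.run σ) (List.cons_ne_nil j l)
      exact ⟨_, by simp only [List.length_cons] at hk ⊢; omega, (Exec.basic i σ).seq h⟩

theorem forEach {α : Type*} {cost : α → ℕ} {I : List α → List α → State → Prop} (l : List α)
    (hI : I [] l σ) (test : ∀ pre suf τ, I pre suf τ → (τ.reg r = 0 ↔ suf = []))
    (step : ∀ pre a suf τ, pre ++ a :: suf = l → Frame P σ τ → I pre (a :: suf) τ →
      Runs P τ (cost a) (I (pre ++ [a]) suf)) :
    Runs (.loop r P) σ ((l.map fun a => cost a + 1).sum + 1) (I l []) := by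
  suffices H : ∀ suf pre τ, pre ++ suf = l → Frame P σ τ → I pre suf τ →
      Runs (.loop r P) τ ((suf.map fun a => cost a + 1).sum + 1) (I l []) from
    H l [] σ rfl (.refl _ _) hI
  intro suf
  induction suf with
  | nil =>
    intro pre τ hl _ hτ
    rw [List.append_nil] at hl
    exact ⟨τ, 1, .loop_done ((test _ _ _ hτ).2 rfl), le_add_self, hl ▸ hτ⟩
  | cons a suf ih =>
    intro pre τ hl hf hτ
    obtain ⟨υ, k, hP, hk, hυ⟩ := step pre a suf τ hl hf hτ
    obtain ⟨ω, k', hL, hk', hω⟩ := ih _ υ (by simpa using hl) (hf.trans hP.frame) hυ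
    refine ⟨ω, _, .loop_step (by simp [test _ _ _ hτ]) hP hL, ?_, hω⟩
    simp only [List.map_cons, List.sum_cons]
    omega

theorem countUp {I : ℕ → State → Prop} (n : ℕ) (hr : σ.reg r = n) (hI : I 0 σ)
    (step : ∀ i τ, i < n → Frame P σ τ → I i τ →
      Runs P τ k fun υ => υ.reg r = τ.reg r - 1 ∧ I (i + 1) υ) :
    Runs (.loop r P) σ (n * (k + 1) + 1) (I n) := by
  refine (forEach (I := fun pre suf τ => τ.reg r = suf.length ∧ I pre.length τ)
    (cost := fun _ => k) (List.range n) (by simpa using ⟨hr, hI⟩)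
    (fun pre suf τ h => by simp [h.1]) fun pre a suf τ hl hf h => ?_).mono (by simp)
    fun τ _ h => by simpa using h.2
  have hn : pre.length < n := by
    have := congrArg List.length hl
    simp only [List.length_append, List.length_cons, List.length_range] at this
    omega
  exact (step _ τ hn hf h.2).mono le_rfl fun υ _ hυ => by simpa [h.1] using hυ

theorem descent {I : ℕ → State → Prop} (m : ℕ) (hI : I m σ)
    (test : ∀ m τ, I m τ → (τ.reg r = 0 ↔ m = 0))
    (step : ∀ m τ, Frame P σ τ → I (m + 1) τ → Runs P τ k (I m)) :
    Runs (.loop r P) σ (m * (k + 1) + 1) (I 0) := by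
  refine (forEach (I := fun _ suf => I suf.length) (cost := fun _ => k) (List.range m)
    (by simpa using hI) (fun _ suf τ h => by simp [test _ τ h])
    fun _ _ suf τ _ hf h => step _ τ hf h).mono (by simp) fun τ _ h => h

end Runs

/-- The scratch register, for constants. -/
abbrev Reg.tmp : ℕ := 1

open Reg

namespace Instr

/-- Copy the register `a` into `d`. -/
abbrev copy (d a : ℕ) : List Instr := [.const d 0, .add d d a]

/-- Add `1` to the register `r`. -/
abbrev incr (r : ℕ) : List Instr := [.const tmp 1, .add r r tmp]

/-- Subtract `1` from the register `r`. -/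
abbrev decr (r : ℕ) : List Instr := [.const tmp 1, .sub r r tmp]

end Instr

open Instr

namespace Prog

/-- Multiply the register `x` by `2 ^ c`. -/
def shiftLeft (x c : ℕ) : Prog := .loop c (.block ([.add x x x] ++ decr c))

/-- Divide the register `x` by `2 ^ c`. -/
def shiftRight (x c : ℕ) : Prog := .loop c (.block ([.half x x] ++ decr c))

/-- Add the product of the registers `x` and `y` to the register `z`, by the schoolbook method. -/
def addMul (z x y t : ℕ) : Prog :=
  .loop y
    (.block [.half t y, .add t t t, .sub t y t] ;;
      .cond t (.block [.add z z x]) (.block [.const tmp 0]) ;;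
        .block [.add x x x, .half y y])

/-- Add the number of bits of the register `x` to the register `z`. -/
def addSize (z x : ℕ) : Prog := .loop x (.block ([.half x x] ++ incr z))

end Prog

open Prog

section

variable {x y z c t a b n : ℕ} {σ : State}

theorem Runs.shiftLeft (h : [x, c, tmp].Nodup) (hx : σ.reg x = a) (hc : σ.reg c = n) :
    Runs (shiftLeft x c) σ (4 * n + 1) fun τ => τ.reg x = a * 2 ^ n := by
  simp only [List.nodup_cons, List.mem_cons, List.not_mem_nil, or_false, not_or] at h
  refine of_le (by omega) <| countUp (I := fun i τ => τ.reg x = a * 2 ^ i) (k := 3) n hc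
    (by simpa) fun i τ _ _ hτ => .block fun _ => ?_
  simp [Instr.run, h, Ne.symm, hτ, pow_succ, ← mul_two, mul_assoc]

theorem Runs.shiftRight (h : [x, c, tmp].Nodup) (hx : σ.reg x = a) (hc : σ.reg c = n) :
    Runs (shiftRight x c) σ (4 * n + 1) fun τ => τ.reg x = a / 2 ^ n := by
  simp only [List.nodup_cons, List.mem_cons, List.not_mem_nil, or_false, not_or] at h
  refine of_le (by omega) <| countUp (I := fun i τ => τ.reg x = a / 2 ^ i) (k := 3) n hc
    (by simpa) fun i τ _ _ hτ => .block fun _ => ?_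
  simp [Instr.run, h, Ne.symm, hτ, pow_succ, Nat.div_div_eq_div_mul]

theorem size_div_two (n : ℕ) : (n / 2).size = n.size - 1 :=
  eq_of_forall_ge_iff fun k => by
    rw [Nat.size_le, Nat.sub_le_iff_le_add, Nat.size_le, pow_succ]
    omega

theorem Runs.addSize (h : [z, x, tmp].Nodup) (hx : σ.reg x = a) :
    Runs (addSize z x) σ (4 * a.size + 1) fun τ => τ.reg z = σ.reg z + a.size := by
  simp only [List.nodup_cons, List.mem_cons, List.not_mem_nil, or_false, not_or] at h
  refine (descent (k := 3) (I := fun m τ => (τ.reg x).size = m ∧ τ.reg z + m = σ.reg z + a.size)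
    _ ⟨by rw [hx], rfl⟩ (fun m τ hτ => by rw [← hτ.1, Nat.size_eq_zero])
    fun m τ _ hτ => .block fun _ => ?_).mono (by omega) fun _ _ hτ => hτ.2
  simp only [List.cons_append, List.nil_append, List.foldl_cons, List.foldl_nil, Instr.run]
  simp only [Function.update_self, ne_eq, h, Ne.symm, not_false_eq_true, Function.update_of_ne,
    size_div_two]
  omega

theorem Runs.addMul (h : [z, x, y, t, tmp].Nodup) (hx : σ.reg x = a) (hy : σ.reg y = b) :
    Runs (addMul z x y t) σ (8 * b.size + 1) fun τ => τ.reg z = σ.reg z + a * b := by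
  simp only [List.nodup_cons, List.mem_cons, List.not_mem_nil, or_false, not_or] at h
  refine (descent (k := 7) (I := fun m τ => (τ.reg y).size = m ∧
    τ.reg z + τ.reg x * τ.reg y = σ.reg z + a * b) _ ⟨by rw [hy], by rw [hx, hy]⟩
    (fun m τ hτ => by rw [← hτ.1, Nat.size_eq_zero])
    fun m τ _ hτ => of_le (k := 3 + (2 + 2)) le_rfl <|
      .seq (Q := fun υ => υ.reg t = τ.reg y % 2 ∧ υ.reg x = τ.reg x ∧ υ.reg y = τ.reg y ∧
        υ.reg z = τ.reg z) (.block fun _ => ?_) fun υ _ hυ =>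
      .seq (Q := fun ω => ω.reg x = τ.reg x ∧ ω.reg y = τ.reg y ∧
        ω.reg z = τ.reg z + τ.reg x * (τ.reg y % 2))
        (.cond (fun ht => .block fun _ => ?_) fun ht => .block fun _ => ?_) fun ω _ hω =>
      .block fun _ => ?_).mono (by omega) fun τ _ hτ => ?_
  · have : τ.reg y - (τ.reg y / 2 + τ.reg y / 2) = τ.reg y % 2 := by omega
    simp [Instr.run, h, this]
  · have : τ.reg y % 2 = 1 := by omega
    simp [Instr.run, h, Ne.symm, hυ, this]
  · simp [Instr.run, h, hυ, hυ.1 ▸ ht]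
  · have : τ.reg x * τ.reg y =
        τ.reg x * (τ.reg y % 2) + (τ.reg x + τ.reg x) * (τ.reg y / 2) := by
      nlinarith [Nat.div_add_mod (τ.reg y) 2]
    simp [Instr.run, h, Ne.symm, hω, size_div_two, hτ.1, ← hτ.2, this, add_assoc]
  · simpa [Nat.size_eq_zero.1 hτ.1] using hτ.2

end

/-- The register `p` is the position in the array `A` at which the list `l` is still to be read. -/
def Reading (A p : ℕ) (l : List ℕ) (σ : State) : Prop :=
  ∀ i, σ.mem A (σ.reg p + i) = l.getD i 0

/-- The list `l` has been written to the array `A`, and the register `p` is its length. -/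
structure Writing (A p : ℕ) (l : List ℕ) (σ : State) : Prop where
  reg : σ.reg p = l.length
  mem (i : ℕ) : σ.mem A i = l.getD i 0

section

variable {P : Prog} {A p r d : ℕ} {l l' : List ℕ} {σ τ : State}

namespace Reading

theorem frame (h : Reading A p l σ) (hf : Frame P σ τ) (hA : P.stores A = false := by rfl)
    (hp : P.writes p = false := by rfl) : Reading A p l τ := fun i => by
  rw [hf.mem A hA, hf.reg p hp, h i]

theorem advance (h : Reading A p (l ++ l') σ) (hA : τ.mem A = σ.mem A)
    (hp : τ.reg p = σ.reg p + l.length) : Reading A p l' τ := fun i => by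
  rw [hA, hp, add_assoc, h, List.getD_append_right _ _ _ _ (by omega), Nat.add_sub_cancel_left]

theorem head {a : ℕ} (h : Reading A p (a :: l) σ) : σ.mem A (σ.reg p) = a := h 0

end Reading

namespace Writing

theorem frame (h : Writing A p l σ) (hf : Frame P σ τ) (hA : P.stores A = false := by rfl)
    (hp : P.writes p = false := by rfl) : Writing A p l τ :=
  ⟨(hf.reg p hp).trans h.reg, fun i => by rw [hf.mem A hA, h.mem]⟩

theorem reading (h : Writing A p l σ) (hr : σ.reg r = 0) : Reading A r l σ := fun i => by
  rw [hr, zero_add, h.mem]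

end Writing

/-- Read the next number of the array `A` at the position `p` into the register `d`. -/
abbrev Instr.next (A p d : ℕ) : List Instr := [.load d A p] ++ incr p

/-- Append the register `r` to the list that is written to the array `A` up to position `p`. -/
def Prog.push (A p r : ℕ) : Prog := .block ([.store A p r] ++ incr p)

theorem Runs.push (h : Writing A p l σ) (hp : p ≠ tmp := by decide) :
    Runs (push A p r) σ 3 fun τ => Writing A p (l ++ [σ.reg r]) τ := by
  refine .block fun _ => ⟨by simp [Instr.run, hp, h.reg], fun i => ?_⟩
  simp only [List.cons_append, List.nil_append, List.foldl_cons, List.foldl_nil, Instr.run,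
    Function.update_self, h.reg]
  rcases lt_trichotomy i l.length with hi | rfl | hi
  · rw [Function.update_of_ne hi.ne, h.mem, List.getD_append _ _ _ _ hi]
  · simp
  · rw [Function.update_of_ne hi.ne', h.mem, List.getD_eq_default _ _ hi.le,
      List.getD_eq_default _ _ (by simpa)]

theorem Runs.next {a : ℕ} (h : Reading A p (a :: l) σ) (hd : [d, p, tmp].Nodup := by decide) :
    Runs (.block (next A p d)) σ 3 fun τ => τ.reg d = a ∧ Reading A p l τ := by
  simp only [List.nodup_cons, List.mem_cons, List.not_mem_nil, or_false, not_or] at hd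
  refine .block fun _ => ⟨?_, h.advance (l := [a]) rfl ?_⟩ <;>
  simp [Instr.run, hd, Ne.symm, h.head]

end

/-! ### Computing the weights -/

/-! The array `0` holds the input, the arrays `2` and `3` the weight table, the array `4` the
circuit, and the array `5` the values of its nodes. -/

namespace Reg

abbrev x : ℕ := 2
abbrev y : ℕ := 3
abbrev z : ℕ := 4
abbrev t : ℕ := 5
abbrev cnt : ℕ := 6
abbrev acc : ℕ := 7
abbrev ptr : ℕ := 8
abbrev size : ℕ := 10
abbrev prec : ℕ := 11
abbrev iters : ℕ := 12
abbrev lim : ℕ := 13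
abbrev pow : ℕ := 14
abbrev top : ℕ := 15
abbrev exp : ℕ := 20
abbrev man : ℕ := 21
abbrev den : ℕ := 22
abbrev wt : ℕ := 23
abbrev val : ℕ := 24
abbrev unit : ℕ := 25
abbrev rows : ℕ := 26
abbrev items : ℕ := 27
abbrev vars : ℕ := 28
abbrev idx : ℕ := 29
abbrev offs : ℕ := 30
abbrev wts : ℕ := 31
abbrev start : ℕ := 32
abbrev dim : ℕ := 33
abbrev facs : ℕ := 34

end Reg

/-- Add the number of bits of the next `cnt` numbers of the array `A` to the register `acc`. -/
def Prog.addBits (A : ℕ) : Prog :=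
  .loop cnt (.block (next A ptr x) ;; addSize acc x ;; .block (incr acc ++ decr cnt))

theorem Runs.addBits {A : ℕ} {l : List ℕ} {σ : State} (hl : Reading A ptr l σ)
    (hc : σ.reg cnt = l.length) :
    Runs (addBits A) σ (9 * bits l + 1) fun τ => τ.reg acc = σ.reg acc + bits l := by
  have hcost : (l.map fun a => 4 * a.size + 8 + 1).sum ≤ 9 * bits l := by
    rw [bits, ← List.sum_map_mul_left]
    exact List.sum_le_sum fun a _ => by omega
  refine (forEach (cost := fun a => 4 * a.size + 8) (I := fun pre suf τ => Reading A ptr suf τ ∧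
    τ.reg cnt = suf.length ∧ τ.reg acc = σ.reg acc + bits pre) l ⟨hl, hc, rfl⟩
    (fun pre suf τ h => by simp [h.2.1]) fun pre a suf τ _ _ ⟨hr, hc, ha⟩ =>
      of_le (k := 3 + (4 * a.size + 1 + 4)) (by omega) <|
        .seq (.next hr) fun υ hf ⟨hx, hr⟩ =>
        .seq (.addSize (by decide) hx) fun ω hf' hω =>
        .block fun hf'' => ⟨(hr.frame hf').frame hf'', ?_, ?_⟩).mono
      (Nat.add_le_add_right hcost 1) fun τ _ hτ => hτ.2.2
  · change ω.reg cnt - 1 = suf.length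
    rw [hf'.reg cnt, hf.reg cnt, hc, List.length_cons, Nat.add_sub_cancel]
  · change ω.reg acc + 1 = _
    rw [hω, hf.reg acc, ha, bits_append, bits_cons, add_assoc, add_assoc, add_right_inj]
    rfl

/-- The registers that hold the constants of the computation of logarithms on inputs of size
`s`. -/
structure Constants (s : ℕ) (σ : State) : Prop where
  size : σ.reg size = s
  prec : σ.reg prec = 8 * s
  iters : σ.reg iters = 4 * s
  lim : σ.reg lim = 2 ^ (8 * s + 1) - 1
  pow : σ.reg pow = 2 ^ (8 * s)
  top : σ.reg top = 2 ^ (12 * s)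

theorem Constants.frame {P : Prog} {s : ℕ} {σ τ : State} (h : Constants s σ) (hf : Frame P σ τ)
    (hP : (List.range' 10 6).all (fun r => !P.writes r) = true := by rfl) : Constants s τ := by
  simp only [List.all_eq_true, Bool.not_eq_true', List.mem_range'_1] at hP
  refine ⟨?_, ?_, ?_, ?_, ?_, ?_⟩
  · rw [hf.reg _ (hP _ (by decide)), h.size]
  · rw [hf.reg _ (hP _ (by decide)), h.prec]
  · rw [hf.reg _ (hP _ (by decide)), h.iters]
  · rw [hf.reg _ (hP _ (by decide)), h.lim]
  · rw [hf.reg _ (hP _ (by decide)), h.pow]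
  · rw [hf.reg _ (hP _ (by decide)), h.top]

/-- Compute the constants from the size of the input in the register `acc`. -/
def Prog.setConstants : Prog :=
  .block (copy size acc ++ [.add iters acc acc, .add iters iters iters, .add prec iters iters,
      .const pow 1] ++ copy cnt prec) ;;
    shiftLeft pow cnt ;;
    .block ([.add lim pow pow] ++ decr lim ++ [.const top 1, .add cnt iters prec]) ;;
    shiftLeft top cnt

theorem Runs.setConstants {s : ℕ} {σ : State} (hs : σ.reg acc = s) :
    Runs setConstants σ (80 * s + 15) (Constants s) := by
  refine of_le (k := 8 + (4 * (8 * s) + 1 + (5 + (4 * (12 * s) + 1)))) (by omega) <|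
    .seq (Q := fun τ => τ.reg size = s ∧ τ.reg iters = 4 * s ∧ τ.reg prec = 8 * s ∧
      τ.reg pow = 1 ∧ τ.reg cnt = 8 * s)
      (.block fun _ => ?_) fun τ _ ⟨hsize, hiters, hprec, hpow, hcnt⟩ =>
    .seq (.shiftLeft (by decide) hpow hcnt) fun υ hf' hυ =>
    .seq (Q := fun ω => ω.reg lim = 2 ^ (8 * s + 1) - 1 ∧ ω.reg top = 1 ∧ ω.reg cnt = 12 * s)
      (.block fun _ => ⟨?_, rfl, ?_⟩) fun ω hf'' ⟨hlim, htop, hcnt⟩ =>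
    (Runs.shiftLeft (by decide) htop hcnt).mono le_rfl fun ρ hr hρ => ⟨?_, ?_, ?_, ?_, ?_, ?_⟩
  · simp only [List.cons_append, List.nil_append, List.foldl_cons, List.foldl_nil, Instr.run, ne_eq,
      Function.update_self, Function.update_of_ne, Function.update_idem, OfNat.ofNat_eq_ofNat,
      Nat.reduceEqDiff, not_false_eq_true, Nat.succ_ne_self, hs, zero_add, true_and, and_self]
    omega
  · change υ.reg pow + υ.reg pow - 1 = _
    rw [hυ, one_mul, pow_succ, mul_two]
  · change υ.reg iters + υ.reg prec = _
    rw [hf'.reg iters, hf'.reg prec, hiters, hprec]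
    omega
  · rw [hr.reg size, hf''.reg size, hf'.reg size, hsize]
  · rw [hr.reg prec, hf''.reg prec, hf'.reg prec, hprec]
  · rw [hr.reg iters, hf''.reg iters, hf'.reg iters, hiters]
  · rw [hr.reg lim, hlim]
  · rw [hr.reg pow, hf''.reg pow, hυ, one_mul]
  · rw [hρ, one_mul]

/-- Normalize the number with exponent `exp` and mantissa `man`. -/
def Prog.normalizeMantissa : Prog :=
  .block [.sub t man lim] ;;
    .loop t (.block ([.half man man] ++ incr exp ++ [.sub t man lim]))

theorem normalize_half {P e m k : ℕ} (h : m.size - (P + 1) = k + 1) :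
    normalize P (e + 1, m / 2) = normalize P (e, m) := by
  simp only [normalize, size_div_two, h, Nat.sub_right_comm _ 1, Nat.add_sub_cancel,
    Nat.div_div_eq_div_mul, pow_succ', Prod.mk.injEq, and_true]
  omega

theorem Runs.normalizeMantissa {P e m : ℕ} {σ : State} (he : σ.reg exp = e) (hm : σ.reg man = m)
    (hlim : σ.reg lim = 2 ^ (P + 1) - 1) :
    Runs normalizeMantissa σ (5 * (m.size - (P + 1)) + 2) fun τ =>
      (τ.reg exp, τ.reg man) = normalize P (e, m) := by
  refine of_le (k := 1 + ((m.size - (P + 1)) * (4 + 1) + 1)) (by omega) <|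
    .seq (Q := fun τ => τ.reg t = τ.reg man - τ.reg lim) (.block fun _ => rfl) fun τ hf hτ =>
    (Runs.descent (I := fun k τ => (τ.reg man).size - (P + 1) = k ∧
      normalize P (τ.reg exp, τ.reg man) = normalize P (e, m) ∧ τ.reg lim = 2 ^ (P + 1) - 1 ∧
        τ.reg t = τ.reg man - τ.reg lim)
      (m.size - (P + 1)) ⟨?_, ?_, ?_, hτ⟩ (fun k υ ⟨hk, _, hlim, ht⟩ => ?_)
      fun k υ _ ⟨hk, heq, hlim, _⟩ => .block fun _ => ⟨?_, ?_, ?_, rfl⟩).mono le_rfl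
      fun υ _ ⟨hk, heq, _, _⟩ => ?_
  · rw [hf.reg man, hm]
  · rw [hf.reg exp, hf.reg man, he, hm]
  · rw [hf.reg lim, hlim]
  · rw [← hk, ht, hlim, Nat.sub_eq_zero_iff_le, Nat.sub_eq_zero_iff_le, Nat.size_le,
      Nat.le_sub_one_iff_lt (by positivity)]
  · change (υ.reg man / 2).size - _ = _
    rw [size_div_two]
    omega
  · rw [← heq, ← normalize_half hk]
    rfl
  · exact hlim
  · rw [← heq, normalize, hk, pow_zero, Nat.div_one, add_zero]

/-- Square the number with exponent `exp` and mantissa `man` for `cnt` times, with rounding. -/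
def Prog.iterateSquare : Prog :=
  .loop cnt
    (.block ([.add exp exp exp] ++ copy x man ++ copy y man ++ [.const man 0]) ;;
      addMul man x y t ;; normalizeMantissa ;; .block (decr cnt))

theorem Runs.iterateSquare {P Q : ℕ} {em : ℕ × ℕ} {σ : State} (hem : (σ.reg exp, σ.reg man) = em)
    (hsize : em.2.size ≤ P + 1) (hlim : σ.reg lim = 2 ^ (P + 1) - 1) (hcnt : σ.reg cnt = Q) :
    Runs iterateSquare σ (Q * (13 * P + 25) + 1) fun τ =>
      (τ.reg exp, τ.reg man) = (roundedSquare P)^[Q] em := by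
  refine (Runs.countUp (k := 6 + ((8 * (P + 1) + 1) + ((5 * (P + 1) + 2) + 2)))
    (I := fun i τ => (τ.reg exp, τ.reg man) = (roundedSquare P)^[i] em ∧
      (τ.reg man).size ≤ P + 1) Q hcnt ⟨hem, by subst em; exact hsize⟩
    fun i τ _ hf ⟨heq, hsize⟩ => ?_).mono (by ring_nf; omega) fun τ _ hτ => hτ.1
  have hlong : (τ.reg man * τ.reg man).size - (P + 1) ≤ P + 1 := by
    rw [Nat.sub_le_iff_le_add, Nat.size_le, pow_add]
    exact Nat.mul_lt_mul'' (Nat.size_le.1 hsize) (Nat.size_le.1 hsize)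
  refine .seq (Q := fun υ => υ.reg exp = τ.reg exp + τ.reg exp ∧ υ.reg man = 0 ∧
      υ.reg x = τ.reg man ∧ υ.reg y = τ.reg man)
      (.block fun _ => by simp [Instr.run]) fun υ hf' ⟨hexp, hman, hx, hy⟩ =>
    .seq ((Runs.addMul (by decide) hx hy).of_le (by omega)) fun ω hf'' hω =>
    .seq ((Runs.normalizeMantissa (e := τ.reg exp + τ.reg exp) (m := τ.reg man * τ.reg man)
      (P := P) ?_ ?_ ?_).of_le (by omega)) fun ρ hr hρ =>
    .block fun _ => ⟨?_, ?_, ?_⟩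
  · rw [hf''.reg exp, hexp]
  · rw [hω, hman, zero_add]
  · rw [hf''.reg lim, hf'.reg lim, hf.reg lim, hlim]
  · change ρ.reg cnt - 1 = _
    rw [hr.reg cnt, hf''.reg cnt, hf'.reg cnt]
  · rw [Function.iterate_succ_apply', ← heq]
    exact hρ
  · rw [Nat.size_le]
    exact (congrArg Prod.snd hρ).trans_lt (normalize_mantissa_lt P _)

/-- Compute the integer logarithm of `man` in `exp`. -/
def Prog.logarithm : Prog :=
  .block ([.const exp 0] ++ copy cnt prec) ;; shiftLeft man cnt ;; normalizeMantissa ;;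
    .block (copy cnt iters) ;; iterateSquare

theorem Runs.logarithm {s a : ℕ} {σ : State} (hs : Constants s σ) (ha : σ.reg man = a)
    (has : a.size ≤ s) :
    Runs logarithm σ (416 * s ^ 2 + 137 * s + 9) fun τ =>
      τ.reg exp = ilog (8 * s) (4 * s) a := by
  have hlong : (2 ^ (8 * s) * a).size - (8 * s + 1) ≤ s := by
    have : 2 ^ (8 * s) * a < 2 ^ (s + (8 * s + 1)) := by
      calc 2 ^ (8 * s) * a < 2 ^ (8 * s) * 2 ^ s := by gcongr; exact Nat.size_le.1 has
        _ ≤ 2 ^ (s + (8 * s + 1)) := by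
          rw [← pow_add]
          exact Nat.pow_le_pow_right two_pos (by omega)
    rwa [Nat.sub_le_iff_le_add, Nat.size_le]
  refine of_le (k := 3 + ((4 * (8 * s) + 1) + ((5 * s + 2) + (2 +
      (4 * s * (13 * (8 * s) + 25) + 1))))) (by ring_nf; omega) <|
    .seq (Q := fun τ => τ.reg exp = 0 ∧ τ.reg cnt = 8 * s ∧ τ.reg man = a)
      (.block fun _ => ⟨rfl, (zero_add _).trans hs.prec, ha⟩) fun τ hf ⟨hexp, hcnt, hman⟩ =>
    .seq (.shiftLeft (by decide) hman hcnt) fun υ hf' hυ =>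
    .seq ((Runs.normalizeMantissa (e := 0) (m := 2 ^ (8 * s) * a) (P := 8 * s) ?_ ?_ ?_).of_le
      (by gcongr)) fun ω hf'' hω =>
    .seq (Q := fun ρ => (ρ.reg exp, ρ.reg man) = (ω.reg exp, ω.reg man) ∧ ρ.reg cnt = 4 * s)
      (.block fun _ => ⟨rfl, ?_⟩) fun ρ hr ⟨hρ, hcnt⟩ =>
    (Runs.iterateSquare (hρ.trans hω) (Nat.size_le.2 (normalize_mantissa_lt _ _)) ?_ hcnt).mono
      le_rfl fun _ _ h => congrArg Prod.fst h
  · rw [hf'.reg exp, hexp]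
  · rw [hυ, mul_comm]
  · rw [hf'.reg lim, hf.reg lim, hs.lim]
  · change 0 + ω.reg iters = _
    rw [hf''.reg iters, hf'.reg iters, hf.reg iters, hs.iters, zero_add]
  · rw [hr.reg lim, hf''.reg lim, hf'.reg lim, hf.reg lim, hs.lim]

/-- Read a row of a factor, and compute its weight in the register `wt`. -/
def Prog.weighRow : Prog :=
  .block (next 0 ptr man) ;; .block (next 0 ptr den) ;;
    .cond man
      (logarithm ;; .block ([.add wt top exp] ++ copy man den) ;; logarithm ;;
        .block [.sub exp pow exp, .add wt wt exp])
      (.block [.const wt 0])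

theorem Runs.weighRow {s : ℕ} {q : ℚ≥0} {l : List ℕ} {σ : State} (hs : Constants s σ)
    (hl : Reading 0 ptr ([q.num, q.den] ++ l) σ) (hnum : q.num.size ≤ s) (hden : q.den.size ≤ s) :
    Runs weighRow σ (832 * s ^ 2 + 274 * s + 30) fun τ =>
      τ.reg wt = rowWeight s q ∧ Reading 0 ptr l τ := by
  refine of_le (k := 3 + (3 + ((416 * s ^ 2 + 137 * s + 9) + (3 +
      ((416 * s ^ 2 + 137 * s + 9) + 2)) + 1))) (by omega) <|
    .seq (.next hl) fun τ hf ⟨hman, hl⟩ => .seq (.next hl) fun υ hf' ⟨hden', hl⟩ =>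
    (Runs.cond (Q := fun τ => τ.reg wt = rowWeight s q) (fun h =>
        .seq (.logarithm ((hs.frame hf).frame hf') ((hf'.reg man).trans hman) hnum)
          fun ω hg hω =>
        .seq (Q := fun ρ => ρ.reg wt = 2 ^ (12 * s) + ilog (8 * s) (4 * s) q.num ∧
          ρ.reg man = q.den) (.block fun _ => ⟨?_, ?_⟩) fun ρ hg' ⟨hwt, hρ⟩ =>
        .seq (.logarithm ((((hs.frame hf).frame hf').frame hg).frame hg') hρ hden)
          fun π hg'' hπ => .block fun _ => ?_)
      fun h => (Runs.block fun _ => ?_).of_le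
        (by rw [List.length_singleton]; omega)).mono le_rfl
        fun _ hg h => ⟨h, hl.frame hg⟩
  · change ω.reg top + ω.reg exp = _
    rw [hg.reg top, hf'.reg top, hf.reg top, hs.top, hω]
  · change 0 + ω.reg den = _
    rw [hg.reg den, hden', zero_add]
  · have hnum : q.num ≠ 0 := fun h0 => h (by rw [hf'.reg man, hman, h0])
    change π.reg wt + (π.reg pow - π.reg exp) = _
    rw [hg''.reg wt, hg''.reg pow, hg'.reg pow, hg.reg pow, hf'.reg pow, hf.reg pow, hs.pow, hπ,
      hwt, rowWeight, if_neg hnum]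
  · have hnum : q.num = 0 := by rw [← hman, ← hf'.reg man, h]
    exact (if_pos hnum).symm

/-- A table with rows of different lengths, as the concatenation of its rows in the array `3` and
the positions at which the rows start in the array `2`. -/
structure Rows (l : List (List ℕ)) (σ : State) : Prop where
  offsets : Writing 2 offs ((List.range l.length).map fun X => (l.take X).flatten.length) σ
  entries : Writing 3 wts l.flatten σ

theorem getD_flatten {α : Type*} (l : List (List α)) {X v : ℕ} (a : α)
    (hv : X < l.length → v < (l.getD X []).length) :
    l.flatten.getD ((l.take X).flatten.length + v) a = (l.getD X []).getD v a := by
  rcases lt_or_ge X l.length with hX | hX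
  · have hv := hv hX
    rw [List.getD_eq_getElem _ _ hX] at hv ⊢
    conv_lhs => rw [← List.take_append_drop X l]
    rw [List.take_append_of_le_length (by simp [hX.le]), List.take_take, min_self,
      List.flatten_append, List.getD_append_right _ _ _ _ (by omega), Nat.add_sub_cancel_left,
      List.drop_eq_getElem_cons hX, List.flatten_cons, List.getD_append _ _ _ _ hv]
  · rw [List.take_of_length_le hX, List.getD_eq_default _ _ (by omega),
      List.getD_eq_default _ [] hX, List.getD_nil]

namespace Rows

variable {l : List (List ℕ)} {σ τ : State}

theorem frame {P : Prog} (h : Rows l σ) (hf : Frame P σ τ)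
    (hP : (P.stores 2 || P.stores 3 || P.writes offs || P.writes wts) = false := by rfl) :
    Rows l τ := by
  simp only [Bool.or_eq_false_iff] at hP
  exact ⟨h.offsets.frame hf hP.1.1.1 hP.1.2, h.entries.frame hf hP.1.1.2 hP.2⟩

theorem lookup {X v : ℕ} (h : Rows (l ++ [[]]) σ) (hX : X ≤ l.length)
    (hv : X < l.length → v < (l.getD X []).length) :
    σ.mem 3 (σ.mem 2 X + v) = (l.getD X []).getD v 0 := by
  have hoffset : ((List.range (l ++ [[]]).length).map fun X =>
      ((l ++ [[]]).take X).flatten.length).getD X 0 = (l.take X).flatten.length := by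
    rw [List.getD_eq_getElem _ _ (by simpa using Nat.lt_succ_of_le hX), List.getElem_map,
      List.getElem_range, List.take_append_of_le_length hX]
  rw [h.offsets.mem, hoffset, h.entries.mem, List.flatten_append, List.flatten_singleton,
    List.append_nil, getD_flatten l 0 hv]

end Rows

/-- Start a new row of the table. -/
def Prog.newRow : Prog := push 2 offs wts

section

variable {l : List (List ℕ)} {row : List ℕ} {σ : State}

theorem Runs.newRow (h : Rows l σ) : Runs newRow σ 3 (Rows (l ++ [[]])) := by
  refine (Runs.push h.offsets).mono le_rfl fun τ hf hτ => ⟨?_, ?_⟩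
  · rw [h.entries.reg] at hτ
    convert hτ using 1
    simp +contextual [List.range_succ, List.take_append_of_le_length, le_of_lt]
  · simpa using h.entries.frame hf

theorem Runs.pushEntry {r : ℕ} (h : Rows (l ++ [row]) σ) :
    Runs (.push 3 wts r) σ 3 (Rows (l ++ [row ++ [σ.reg r]])) := by
  refine (Runs.push h.entries).mono le_rfl fun τ hf hτ => ⟨?_, by simpa using hτ⟩
  convert h.offsets.frame hf using 1
  simp +contextual [List.range_succ, List.take_append_of_le_length, le_of_lt]

/-- Append the first `rows` multiples of `unit` to the last row of the table. -/
def Prog.multiples : Prog :=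
  .block [.const val 0] ;;
    .loop rows (.push 3 wts val ;; .block ([.add val val unit] ++ decr rows))

theorem Runs.multiples {d b : ℕ} (h : Rows (l ++ [[]]) σ) (hd : σ.reg rows = d)
    (hb : σ.reg unit = b) :
    Runs multiples σ (7 * d + 2) (Rows (l ++ [(List.range d).map (· * b)])) := by
  refine of_le (k := 1 + (d * ((3 + 3) + 1) + 1)) (by omega) <|
    .seq (Q := fun τ => τ.reg val = 0 ∧ τ.reg unit = b) (.block fun _ => ⟨rfl, hb⟩)
      fun τ hf ⟨hval, hunit⟩ =>
    (Runs.countUp (I := fun i τ => Rows (l ++ [(List.range i).map (· * b)]) τ ∧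
      τ.reg val = i * b ∧ τ.reg unit = b) d ((hf.reg rows).trans hd)
      ⟨h.frame hf, by rw [hval, zero_mul], hunit⟩ fun i υ _ _ ⟨hrows, hval, hunit⟩ =>
      .seq (.pushEntry hrows) fun ω hf' hω =>
      .block fun hf'' => ⟨congrArg (· - 1) (hf'.reg rows), ?_, ?_, ?_⟩).mono le_rfl
      fun _ _ h => h.1
  · convert hω.frame hf'' using 1
    simp [List.range_succ, hval]
  · change ω.reg val + ω.reg unit = _
    rw [hf'.reg val, hf'.reg unit, hval, hunit, add_mul, one_mul]
  · exact (hf'.reg unit).trans hunit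

end

/-! ### Writing the input of the compilation algorithm -/

/-- The registers and the arrays of the compilation algorithm are shifted by `base`, such that its
input is the array `base` and the length of its input is the register `base`. -/
abbrev Reg.base : ℕ := 50

/-- Append the register `r` to the input of the compilation algorithm. -/
def Prog.write (r : ℕ) : Prog := push base base r

/-- Append a number to the input of the compilation algorithm. -/
def Prog.writeConst (c : ℕ) : Prog := .block [.const t c] ;; write t

section

variable {s u : ℕ} {l rest : List ℕ} {T : List (List ℕ)} {σ : State}

theorem Runs.write {r : ℕ} (hw : Writing base base l σ) :
    Runs (write r) σ 3 (Writing base base (l ++ [σ.reg r])) := .push hw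

theorem Runs.writeConst {c : ℕ} (hw : Writing base base l σ) :
    Runs (writeConst c) σ 4 (Writing base base (l ++ [c])) :=
  .seq (l := 3) (Q := fun τ => τ.reg t = c ∧ Writing base base l τ)
    (.block fun hf => ⟨rfl, hw.frame hf⟩) fun _ _ ⟨ht, hw⟩ => ht ▸ .write hw

/-- Copy the numbers of values of the variables, and write the rows of the weight table that
belong to the variables. -/
def Prog.writeDomain : Prog :=
  .loop items (.block (next 0 ptr rows) ;; write rows ;; newRow ;; multiples ;;
    .block (copy cnt size) ;; shiftLeft unit cnt ;; .block (decr items))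

theorem Runs.writeDomain {dom : List ℕ} (hs : σ.reg size = s)
    (hr : Reading 0 ptr (dom ++ rest) σ) (hw : Writing base base l σ) (hT : Rows [] σ)
    (hu : σ.reg unit = 1) (hi : σ.reg items = dom.length) (hdom : ∀ d ∈ dom, d ≤ s) :
    Runs writeDomain σ (dom.length * (11 * s + 17) + 1) fun τ =>
      Reading 0 ptr rest τ ∧ Writing base base (l ++ dom) τ ∧
        Rows (dom.zipIdx.map fun dX => (List.range dX.1).map (· * (2 ^ s) ^ dX.2)) τ ∧
        τ.reg unit = (2 ^ s) ^ dom.length := by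
  refine (Runs.forEach (cost := fun _ => 11 * s + 16) (I := fun pre suf τ =>
    τ.reg items = suf.length ∧ Reading 0 ptr (suf ++ rest) τ ∧ Writing base base (l ++ pre) τ ∧
      Rows (pre.zipIdx.map fun dX => (List.range dX.1).map (· * (2 ^ s) ^ dX.2)) τ ∧
      τ.reg unit = (2 ^ s) ^ pre.length) dom ⟨hi, hr, by simpa using hw, hT, hu⟩
    (fun pre suf τ h => by simp [h.1]) fun pre d suf τ hl hf₀ ⟨hi, hr, hw, hT, hu⟩ => ?_).mono
    (by simp) fun τ _ h => ⟨h.2.1, h.2.2.1, h.2.2.2.1, h.2.2.2.2⟩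
  have hd : d ≤ s := hdom d (by simp [← hl])
  refine of_le (k := 3 + (3 + (3 + ((7 * d + 2) + (2 + ((4 * s + 1) + 2)))))) (by omega) <|
    .seq (.next hr) fun τ₁ hf₁ ⟨hd, hr⟩ => .seq (.write (hw.frame hf₁)) fun τ₂ hf₂ hw =>
    .seq (.newRow (hT.frame (hf₁.seq hf₂))) fun τ₃ hf₃ hT =>
    .seq (.multiples hT (by rw [(hf₂.seq hf₃).reg rows, hd])
      (by rw [(hf₁.seq (hf₂.seq hf₃)).reg unit, hu])) fun τ₄ hf₄ hT =>
    have hf := hf₁.seq <| hf₂.seq <| hf₃.seq hf₄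
    .seq (Q := fun τ => τ.reg cnt = s) (.block fun _ => ?_) fun τ₅ hf₅ hc =>
    .seq (.shiftLeft (by decide) rfl hc) fun τ₆ hf₆ hu' =>
    .block fun hf₇ => ⟨?_, ?_, ?_, ?_, ?_⟩
  · change 0 + τ₄.reg size = s
    rw [zero_add, hf.reg size, hf₀.reg size, hs]
  · change τ₆.reg items - 1 = suf.length
    rw [(hf.seq (hf₅.seq hf₆)).reg items, hi, List.length_cons, Nat.add_sub_cancel]
  · exact hr.frame (hf₂.seq <| hf₃.seq <| hf₄.seq <| hf₅.seq <| hf₆.seq hf₇)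
  · rw [hd, List.append_assoc] at hw
    exact hw.frame (hf₃.seq <| hf₄.seq <| hf₅.seq <| hf₆.seq hf₇)
  · simpa [List.zipIdx_append] using hT.frame (hf₅.seq <| hf₆.seq hf₇)
  · change τ₆.reg unit = _
    rw [hu', (hf.seq hf₅).reg unit, hu, List.length_append, List.length_singleton, pow_succ]

/-- Write the rest of a row of the weight table: the weights of the next `rows` rows of a factor,
multiplied by `unit`. -/
def Prog.weighTable : Prog :=
  .loop rows (weighRow ;; .block ([.const val 0] ++ copy x unit ++ copy y wt) ;;
    addMul val x y t ;; push 3 wts val ;; .block (decr rows))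

/-- A bound on the cost of `Prog.weighTable` for each row. -/
def rowCost (s : ℕ) : ℕ := 832 * s ^ 2 + 370 * s + 58

theorem Runs.weighTable {table : List ℚ≥0} (hs : Constants s σ)
    (hr : Reading 0 ptr (table.flatMap (fun q => [q.num, q.den]) ++ rest) σ)
    (hT : Rows (T ++ [[]]) σ) (hu : σ.reg unit = u) (hn : σ.reg rows = table.length)
    (htable : ∀ q ∈ table, q.num.size ≤ s ∧ q.den.size ≤ s) :
    Runs weighTable σ (table.length * rowCost s + 1) fun τ =>
      Reading 0 ptr rest τ ∧ Rows (T ++ [table.map (rowWeight s · * u)]) τ := by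
  refine (Runs.forEach (cost := fun _ => 832 * s ^ 2 + 370 * s + 57) (I := fun pre suf τ =>
    τ.reg rows = suf.length ∧ Reading 0 ptr (suf.flatMap (fun q => [q.num, q.den]) ++ rest) τ ∧
      Rows (T ++ [pre.map (rowWeight s · * u)]) τ) table ⟨hn, hr, hT⟩
    (fun pre suf τ h => by simp [h.1]) fun pre q suf τ hl hf₀ ⟨hn, hr, hT⟩ => ?_).mono
    (by simp [rowCost]) fun τ _ h => h.2
  obtain ⟨hnum, hden⟩ := htable q (by simp [← hl])
  have hsize : (rowWeight s q).size ≤ 12 * s + 2 := Nat.size_le.2 <| by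
    have : 2 ^ (8 * s) ≤ 2 ^ (12 * s) := Nat.pow_le_pow_right two_pos (by omega)
    have := rowWeight_le hnum
    have := Nat.two_pow_pos (12 * s)
    rw [pow_add]
    omega
  refine of_le (k := (832 * s ^ 2 + 274 * s + 30) + (5 + ((8 * (rowWeight s q).size + 1) +
      (3 + 2)))) (by omega) <|
    .seq (.weighRow (hs.frame hf₀) (by simpa using hr) hnum hden) fun τ₁ hf₁ ⟨hw, hr⟩ =>
    .seq (Q := fun τ => τ.reg val = 0 ∧ τ.reg x = u ∧ τ.reg y = rowWeight s q)
      (.block fun _ => ⟨rfl, ?_, (zero_add _).trans hw⟩) fun τ₂ hf₂ ⟨hval, hx, hy⟩ =>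
    .seq (.addMul (by decide) hx hy) fun τ₃ hf₃ hval' =>
    .seq (.pushEntry (hT.frame (hf₁.seq <| hf₂.seq hf₃))) fun τ₄ hf₄ hT =>
    .block fun hf₅ => ⟨?_, hr.frame (hf₂.seq <| hf₃.seq <| hf₄.seq hf₅), ?_⟩
  · change 0 + τ₁.reg unit = u
    rw [zero_add, hf₁.reg unit, hf₀.reg unit, hu]
  · change τ₄.reg rows - 1 = suf.length
    rw [(hf₁.seq <| hf₂.seq <| hf₃.seq hf₄).reg rows, hn, List.length_cons, Nat.add_sub_cancel]
  · rw [hval', hval, zero_add, mul_comm] at hT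
    simpa using hT.frame hf₅

/-- Copy the numbers of rows of the factors, and write the rows of the weight table that belong to
the factors. -/
def Prog.writeTableLengths : Prog :=
  .loop items (.block (next 0 ptr x) ;; .block [.add ptr ptr x] ;; .block (next 0 ptr rows) ;;
    write rows ;; newRow ;; weighTable ;; .block (decr items))

theorem sum_rowCost_le (s : ℕ) (factors : List Factor) :
    (factors.map fun f => f.table.length * rowCost s + 16 + 1).sum ≤
      rowCost s * bits (factors.flatMap Factor.encode) := by
  rw [bits_flatMap, ← List.sum_map_mul_left]
  refine List.sum_le_sum fun f _ => ?_
  calc f.table.length * rowCost s + 16 + 1 ≤ rowCost s * (f.table.length + 1) := by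
        rw [mul_add, mul_comm, rowCost]
        omega
    _ ≤ rowCost s * bits f.encode := by
        gcongr
        have := f.length_add_le_bits_encode
        omega

theorem Runs.writeTableLengths {factors : List Factor} (hs : Constants s σ)
    (hr : Reading 0 ptr (factors.flatMap Factor.encode) σ) (hw : Writing base base l σ)
    (hT : Rows T σ) (hu : σ.reg unit = u) (hi : σ.reg items = factors.length)
    (hfactors : ∀ f ∈ factors, bits f.encode ≤ s) :
    Runs writeTableLengths σ (rowCost s * bits (factors.flatMap Factor.encode) + 1) fun τ =>
      Writing base base (l ++ factors.map fun f => f.table.length) τ ∧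
        Rows (T ++ factors.map fun f => f.table.map (rowWeight s · * u)) τ := by
  refine (Runs.forEach (cost := fun f => f.table.length * rowCost s + 16) (I := fun pre suf τ =>
    τ.reg items = suf.length ∧ Reading 0 ptr (suf.flatMap Factor.encode) τ ∧
      Writing base base (l ++ pre.map fun f => f.table.length) τ ∧
        Rows (T ++ pre.map fun f => f.table.map (rowWeight s · * u)) τ) factors
    ⟨hi, hr, by simpa using hw, by simpa using hT⟩
    (fun pre suf τ h => by simp [h.1]) fun pre f suf τ hl hf₀ ⟨hi, hr, hw, hT⟩ => ?_).mono
    (Nat.add_le_add_right (sum_rowCost_le s factors) 1) fun τ _ h => h.2.2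
  have htable (q) (hq : q ∈ f.table) : q.num.size ≤ s ∧ q.den.size ≤ s := by
    have := f.rowSize_le_bits hq
    have := hfactors f (by simp [← hl])
    omega
  rw [List.flatMap_cons, Factor.encode, List.append_assoc, List.cons_append, List.cons_append] at hr
  refine of_le (k := 3 + (1 + (3 + (3 + (3 + ((f.table.length * rowCost s + 1) + 2))))))
      (by omega) <|
    .seq (.next hr) fun τ₁ hf₁ ⟨hx, hr⟩ =>
    .seq (Q := Reading 0 ptr _) (.block fun _ => hr.advance rfl (congrArg (_ + ·) hx))
      fun τ₂ hf₂ hr =>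
    .seq (.next hr) fun τ₃ hf₃ ⟨hrows, hr⟩ =>
    .seq (.write (hw.frame (hf₁.seq <| hf₂.seq hf₃))) fun τ₄ hf₄ hw =>
    .seq (.newRow (hT.frame (hf₁.seq <| hf₂.seq <| hf₃.seq hf₄))) fun τ₅ hf₅ hT =>
    have hf := hf₁.seq <| hf₂.seq <| hf₃.seq <| hf₄.seq hf₅
    .seq (.weighTable (u := u) (hs.frame (hf₀.seq hf)) (hr.frame (hf₄.seq hf₅)) hT
      (by rw [hf.reg unit, hf₀.reg unit, hu]) (by rw [(hf₄.seq hf₅).reg rows, hrows]) htable)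
      fun τ₆ hf₆ ⟨hr, hT⟩ =>
    .block fun hf₇ => ⟨?_, hr.frame hf₇, ?_, ?_⟩
  · change τ₆.reg items - 1 = suf.length
    rw [(hf.seq hf₆).reg items, hi, List.length_cons, Nat.add_sub_cancel]
  · rw [hrows] at hw
    simpa using hw.frame (hf₅.seq <| hf₆.seq hf₇)
  · simpa using hT.frame hf₇

end

section

open Model

variable {s n v L R D Z : ℕ} {l rest : List ℕ} {σ : State}

/-- Copy the next `cnt` numbers of the input. -/
def Prog.copyNext : Prog :=
  .loop cnt (.block (next 0 ptr x) ;; write x ;; .block (decr cnt))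

theorem Runs.copyNext {l' : List ℕ} (hr : Reading 0 ptr (l' ++ rest) σ)
    (hw : Writing base base l σ) (hn : σ.reg cnt = l'.length) :
    Runs copyNext σ (9 * l'.length + 1) fun τ =>
      Reading 0 ptr rest τ ∧ Writing base base (l ++ l') τ := by
  refine (Runs.forEach (cost := fun _ => 8) (I := fun pre suf τ => τ.reg cnt = suf.length ∧
    Reading 0 ptr (suf ++ rest) τ ∧ Writing base base (l ++ pre) τ) l' ⟨hn, hr, by simpa using hw⟩
    (fun pre suf τ h => by simp [h.1]) fun pre a suf τ _ _ ⟨hn, hr, hw⟩ =>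
    .of_le (k := 3 + (3 + 2)) le_rfl <|
    .seq (.next hr) fun τ₁ hf₁ ⟨hx, hr⟩ => .seq (.write (hw.frame hf₁)) fun τ₂ hf₂ hw =>
    .block fun hf₃ => ⟨?_, hr.frame (hf₂.seq hf₃), ?_⟩).mono (by simp [mul_comm])
    fun _ _ h => h.2
  · change τ₂.reg cnt - 1 = suf.length
    rw [(hf₁.seq hf₂).reg cnt, hn, List.length_cons, Nat.add_sub_cancel]
  · rw [hx] at hw
    simpa using hw.frame hf₃

/-- Write the next `z` numbers of a table of spaced ones; the next `1` comes after `val` zeros. -/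
def Prog.writeSpacedOnes : Prog :=
  .loop z
    (.cond val (.block ([.const x 0] ++ decr val)) (.block ([.const x 1] ++ copy val rows)) ;;
      write x ;; writeConst 1 ;; .block (decr z))

theorem Runs.writeSpacedOnes (hw : Writing base base l σ) (hn : σ.reg z = n)
    (hv : σ.reg val = v) (hL : σ.reg rows = L) :
    Runs writeSpacedOnes σ (14 * n + 1) (Writing base base
      (l ++ (spacedOnes L v n).flatMap fun q => [q.num, q.den])) := by
  refine (Runs.descent (k := 13) (I := fun m τ => τ.reg z = m ∧ τ.reg rows = L ∧ ∃ l',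
    Writing base base l' τ ∧ l' ++ (spacedOnes L (τ.reg val) m).flatMap (fun q => [q.num, q.den]) =
      l ++ (spacedOnes L v n).flatMap fun q => [q.num, q.den]) n ⟨hn, hL, l, hw, by rw [hv]⟩
    (fun m τ h => by rw [h.1]) fun m τ _ ⟨hn, hL, l', hw, hl'⟩ => ?_).mono (by omega)
    fun τ _ ⟨_, _, l', hw, hl'⟩ => by simpa [← hl', spacedOnes] using hw
  refine of_le (k := (3 + 1) + (3 + (4 + 2))) (by omega) <|
    .seq (Q := fun υ => Writing base base l' υ ∧ l' ++ [υ.reg x, 1] ++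
        (spacedOnes L (υ.reg val) m).flatMap (fun q => [q.num, q.den]) =
      l ++ (spacedOnes L v n).flatMap fun q => [q.num, q.den])
      (.cond (fun h => .block fun hf => ⟨hw.frame hf, ?_⟩)
        fun h => .block fun hf => ⟨hw.frame hf, ?_⟩) fun τ₁ hf₁ ⟨hw, hl'⟩ =>
    .seq (.write hw) fun τ₂ hf₂ hw => .seq (.writeConst hw) fun τ₃ hf₃ hw =>
    have hf := hf₂.seq hf₃
    .block fun hf₄ => ⟨?_, ?_, _, hw.frame hf₄, ?_⟩
  · rw [← hl', ← Nat.succ_pred_eq_of_ne_zero h]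
    simp [Instr.run, spacedOnes]
  · rw [← hl', h]
    simp [Instr.run, spacedOnes, hL]
  · change τ₃.reg z - 1 = m
    rw [hf.reg z, hf₁.reg z, hn, Nat.add_sub_cancel]
  · exact (hf.reg rows).trans ((hf₁.reg rows).trans hL)
  · change l' ++ [τ₁.reg x] ++ [1] ++ (spacedOnes L (τ₃.reg val) m).flatMap _ = _
    rw [← hl', hf.reg val, List.append_assoc l']
    rfl

/-- Read a factor, and write the factor that determines its row. -/
def Prog.writeRowFactor : Prog :=
  .block (next 0 ptr cnt) ;; .block (copy x cnt ++ incr x) ;; write x ;; copyNext ;; write idx ;;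
    .block (next 0 ptr rows) ;;
    .block (copy x rows ++ copy y rows ++ [.const z 0, .const val 0]) ;; addMul z x y t ;;
    write z ;; writeSpacedOnes ;; .block ([.add ptr ptr rows, .add ptr ptr rows] ++ incr idx)

theorem Runs.writeRowFactor {f : Factor} (hr : Reading 0 ptr (f.encode ++ rest) σ)
    (hw : Writing base base l σ) (hR : σ.reg idx = R) :
    Runs writeRowFactor σ
      (9 * f.scope.length + 8 * f.table.length.size + 14 * f.table.length ^ 2 + 32) fun τ =>
        Reading 0 ptr rest τ ∧ Writing base base (l ++ (rowFactor f R).encode) τ ∧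
          τ.reg idx = R + 1 := by
  rw [Factor.encode, List.append_assoc, List.cons_append, List.cons_append] at hr
  generalize hL : f.table.length = L at hr ⊢
  refine of_le (k := 3 + (4 + (3 + ((9 * f.scope.length + 1) + (3 + (3 + (6 + ((8 * L.size + 1) +
      (3 + ((14 * L ^ 2 + 1) + 4)))))))))) (by omega) <|
    .seq (.next hr) fun τ₁ hf₁ ⟨hk, hr⟩ =>
    .seq (Q := fun τ => τ.reg x = f.scope.length + 1) (.block fun _ => ?_) fun τ₂ hf₂ hx =>
    .seq (.write (hw.frame (hf₁.seq hf₂))) fun τ₃ hf₃ hw =>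
    .seq (.copyNext (hr.frame (hf₂.seq hf₃)) hw (by rw [(hf₂.seq hf₃).reg cnt, hk]))
      fun τ₄ hf₄ ⟨hr, hw⟩ =>
    .seq (.write hw) fun τ₅ hf₅ hw => .seq (.next (hr.frame hf₅)) fun τ₆ hf₆ ⟨hrows, hr⟩ =>
    .seq (Q := fun τ => τ.reg x = L ∧ τ.reg y = L ∧ τ.reg z = 0 ∧ τ.reg val = 0)
      (.block fun _ => ⟨?_, ?_, rfl, rfl⟩) fun τ₇ hf₇ ⟨hx', hy, hz, hval⟩ =>
    .seq (.addMul (by decide) hx' hy) fun τ₈ hf₈ hz' =>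
    .seq (.write (hw.frame (hf₆.seq <| hf₇.seq hf₈))) fun τ₉ hf₉ hw =>
    .seq (.writeSpacedOnes (n := L ^ 2) (v := 0) (L := L) hw
      (by rw [hf₉.reg z, hz', hz, zero_add, sq]) (by rw [(hf₈.seq hf₉).reg val, hval])
      (by rw [(hf₇.seq <| hf₈.seq hf₉).reg rows, hrows])) fun τ₁₀ hf₁₀ hw =>
    .block fun hf₁₁ => ⟨?_, ?_, ?_⟩
  · change 0 + τ₁.reg cnt + 1 = _
    rw [zero_add, hk]
  · exact (zero_add _).trans hrows
  · exact (zero_add _).trans hrows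
  · refine (hr.frame (hf₇.seq <| hf₈.seq <| hf₉.seq hf₁₀)).advance rfl ?_
    change τ₁₀.reg ptr + τ₁₀.reg rows + τ₁₀.reg rows = _
    rw [(hf₇.seq <| hf₈.seq <| hf₉.seq hf₁₀).reg rows, hrows, ← hL]
    simp [add_assoc, mul_two]
  · convert hw.frame hf₁₁ using 1
    simp [Factor.encode, rowFactor, diagTable, length_spacedOnes, hL, hx, hz, hz', sq,
      (hf₁.seq <| hf₂.seq <| hf₃.seq hf₄).reg idx, hR]
  · change τ₁₀.reg idx + 1 = _
    rw [(hf₁.seq <| hf₂.seq <| hf₃.seq <| hf₄.seq <| hf₅.seq <| hf₆.seq <| hf₇.seq <| hf₈.seq <|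
      hf₉.seq hf₁₀).reg idx, hR]

/-- Read the factors, and write the factors that determine their rows. -/
def Prog.writeRowFactors : Prog := .loop items (writeRowFactor ;; .block (decr items))

theorem Runs.writeRowFactors {factors : List Factor}
    (hr : Reading 0 ptr (factors.flatMap Factor.encode) σ) (hw : Writing base base l σ)
    (hR : σ.reg idx = R) (hi : σ.reg items = factors.length)
    (hfactors : ∀ f ∈ factors, bits f.encode ≤ s) :
    Runs writeRowFactors σ ((14 * s + 18) * bits (factors.flatMap Factor.encode) + 1) fun τ =>
      Writing base base (l ++ (factors.zipIdx R).flatMap fun fR => (rowFactor fR.1 fR.2).encode) τ ∧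
        τ.reg idx = R + factors.length := by
  have hcost : (factors.map fun f => 9 * f.scope.length + 8 * f.table.length.size +
      14 * f.table.length ^ 2 + 34 + 1).sum ≤
        (14 * s + 18) * bits (factors.flatMap Factor.encode) := by
    rw [bits_flatMap, ← List.sum_map_mul_left]
    refine List.sum_le_sum fun f hf => ?_
    have hlen := f.length_add_le_bits_encode
    have hsize := size_le_self f.table.length
    have hsq : f.table.length ^ 2 ≤ s * bits f.encode := by
      rw [sq]
      exact Nat.mul_le_mul (by have := hfactors f hf; omega) (by omega)
    rw [add_mul, mul_assoc]
    omega
  refine (Runs.forEach (cost := fun f => 9 * f.scope.length + 8 * f.table.length.size +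
      14 * f.table.length ^ 2 + 34) (I := fun pre suf τ => τ.reg items = suf.length ∧
        Reading 0 ptr (suf.flatMap Factor.encode) τ ∧ Writing base base
          (l ++ (pre.zipIdx R).flatMap fun fR => (rowFactor fR.1 fR.2).encode) τ ∧
        τ.reg idx = R + pre.length) factors ⟨hi, hr, by simpa using hw, hR⟩
    (fun pre suf τ h => by simp [h.1]) fun pre f suf τ _ _ ⟨hi, hr, hw, hR⟩ =>
      .of_le (k := (9 * f.scope.length + 8 * f.table.length.size + 14 * f.table.length ^ 2 + 32) +
        2) le_rfl <|
      .seq (.writeRowFactor (by simpa using hr) hw hR) fun τ₁ hf₁ ⟨hr, hw, hR⟩ =>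
      .block fun hf₂ =>
        ⟨?_, hr.frame hf₂, ?_, by simpa [add_assoc] using (hf₂.reg idx).trans hR⟩).mono
    (Nat.add_le_add_right hcost 1) fun τ _ h => h.2.2
  · change τ₁.reg items - 1 = suf.length
    rw [hf₁.reg items, hi, List.length_cons, Nat.add_sub_cancel]
  · convert hw.frame hf₂ using 1
    simp [List.zipIdx_append]

/-- Write `cnt` pairs of ones. -/
def Prog.writeOnes : Prog := .loop cnt (writeConst 1 ;; writeConst 1 ;; .block (decr cnt))

theorem Runs.writeOnes (hw : Writing base base l σ) (hn : σ.reg cnt = n) :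
    Runs writeOnes σ (11 * n + 1)
      (Writing base base (l ++ (List.replicate n [1, 1]).flatten)) := by
  refine (Runs.countUp (k := 10) (I := fun i τ => Writing base base
    (l ++ (List.replicate i [1, 1]).flatten) τ) n hn (by simpa using hw) fun i τ _ _ hw =>
    .of_le (k := 4 + (4 + 2)) le_rfl <| .seq (.writeConst hw) fun τ₁ hf₁ hw =>
    .seq (.writeConst hw) fun τ₂ hf₂ hw =>
    .block fun hf₃ => ⟨congrArg (· - 1) ((hf₁.seq hf₂).reg cnt), ?_⟩).of_le (by omega)
  convert hw.frame hf₃ using 1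
  simp [List.replicate_succ']

/-- Write the last entry of the padding factor, such that the total number of bits becomes
`16 * dim`. -/
def Prog.writePaddingEntry : Prog :=
  .block ([.const acc 0, .const ptr 0] ++ copy cnt base) ;; addBits base ;;
    .block (copy x dim ++ [.add x x x, .add x x x, .add x x x, .add x x x, .sub x x acc,
      .const tmp 4, .sub cnt x tmp, .const y 1]) ;;
    shiftLeft y cnt ;; write y ;; writeConst 1

theorem Runs.writePaddingEntry (hw : Writing base base l σ) (hD : σ.reg dim = D)
    (hl : bits l + 4 ≤ 16 * D) :
    Runs writePaddingEntry σ (208 * D + 23)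
      (Writing base base (l ++ [2 ^ (16 * D - bits l - 4), 1])) := by
  refine of_le (k := 4 + ((9 * bits l + 1) + (10 + ((4 * (16 * D - bits l - 4) + 1) +
      (3 + 4))))) (by omega) <|
    .seq (Q := fun τ => τ.reg acc = 0 ∧ τ.reg ptr = 0 ∧ τ.reg cnt = l.length)
      (.block fun _ => ⟨rfl, rfl, (zero_add _).trans hw.reg⟩) fun τ₁ hf₁ ⟨hacc, hptr, hcnt⟩ =>
    .seq (.addBits ((hw.frame hf₁).reading hptr) hcnt) fun τ₂ hf₂ hbits =>
    .seq (Q := fun τ => τ.reg cnt = 16 * D - bits l - 4 ∧ τ.reg y = 1)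
      (.block fun _ => ⟨?_, rfl⟩) fun τ₃ hf₃ ⟨hcnt, hy⟩ =>
    .seq (.shiftLeft (by decide) hy hcnt) fun τ₄ hf₄ hy =>
    .seq (.write (hw.frame (hf₁.seq <| hf₂.seq <| hf₃.seq hf₄))) fun τ₅ _ hw =>
    (Runs.writeConst hw).mono le_rfl fun _ _ hw => ?_
  · have hdim := ((hf₁.seq hf₂).reg dim).trans hD
    simp only [List.cons_append, List.nil_append, List.foldl_cons, List.foldl_nil, Instr.run]
    simp only [Function.update_self, Function.update_of_ne, Function.update_idem, ne_eq,
      OfNat.ofNat_eq_ofNat, OfNat.ofNat_ne_one, Nat.reduceEqDiff, not_false_eq_true, zero_add, hdim,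
      hbits, hacc]
    omega
  · simpa [hy] using hw

/-- Write the padding factor. -/
def Prog.writePaddingFactor : Prog :=
  writeConst 1 ;; write idx ;; write dim ;; .block (copy cnt dim ++ decr cnt) ;; writeOnes ;;
    writePaddingEntry

theorem Runs.writePaddingFactor (hw : Writing base base l σ) (hZ : σ.reg idx = Z)
    (hD : σ.reg dim = D)
    (hl : bits (l ++ [1, Z, D] ++ (List.replicate (D - 1) [1, 1]).flatten) + 4 ≤ 16 * D) :
    Runs writePaddingFactor σ (219 * D + 38) (Writing base base
      (l ++ [1, Z, D] ++ (List.replicate (D - 1) [1, 1]).flatten ++ [2 ^ (16 * D -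
        bits (l ++ [1, Z, D] ++ (List.replicate (D - 1) [1, 1]).flatten) - 4), 1])) := by
  refine of_le (k := 4 + (3 + (3 + (4 + ((11 * (D - 1) + 1) + (208 * D + 23)))))) (by omega) <|
    .seq (.writeConst hw) fun τ₁ hf₁ hw => .seq (.write hw) fun τ₂ hf₂ hw =>
    .seq (.write hw) fun τ₃ hf₃ hw =>
    have hf := hf₁.seq <| hf₂.seq hf₃
    .seq (Q := fun τ => τ.reg cnt = D - 1) (.block fun _ => ?_) fun τ₄ hf₄ hcnt =>
    .seq (.writeOnes (l := l ++ [1, Z, D]) ?_ hcnt) fun τ₅ hf₅ hw =>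
    .writePaddingEntry hw (by rw [(hf.seq <| hf₄.seq hf₅).reg dim, hD]) hl
  · change 0 + τ₃.reg dim - 1 = _
    rw [zero_add, hf.reg dim, hD]
  · convert hw.frame hf₄ using 1
    simp [hf₁.reg idx, (hf₁.seq hf₂).reg dim, hZ, hD]

end

section

variable {M : Model} {σ : State}

theorem Model.WF.card_le_size (hM : M.WF) {d : ℕ} (hd : d ∈ M.dom) : d ≤ M.size := by
  obtain ⟨X, hX, rfl⟩ := List.getElem_of_mem hd
  obtain ⟨f, hf, hXf⟩ := hM.covered X hX
  have hle : M.card X ≤ (f.scope.map M.card).prod := by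
    refine List.single_le_prod (fun a ha => ?_) _ (List.mem_map_of_mem hXf)
    obtain ⟨Y, hY, rfl⟩ := List.mem_map.1 ha
    exact hM.card_pos_of_lt (hM.scope_lt f hf Y hY)
  rw [← hM.table_length f hf, Model.card, List.getD_eq_getElem _ _ hX] at hle
  have := f.length_add_le_bits_encode
  have := M.bits_encode_le_size hf
  omega

/-- Compute the size of the input, the constants of the logarithm, and the number of values of the
padding variable. -/
def Prog.prepare : Prog :=
  .block (copy cnt 0) ;; addBits 0 ;; setConstants ;;
    .block (copy x size ++ copy y size ++ [.const z 0]) ;; addMul z x y t ;;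
    .block (copy x z ++ copy y size ++ [.const dim 0]) ;; addMul dim x y t

theorem Runs.prepare (w : List ℕ) :
    Runs prepare (.init w) (105 * bits w + 30) fun τ =>
      Constants (bits w) τ ∧ τ.reg dim = bits w ^ 3 := by
  generalize hs : bits w = s
  have hsize := size_le_self s
  refine of_le (k := 2 + ((9 * bits w + 1) + ((80 * s + 15) + (5 + ((8 * s.size + 1) + (5 +
      (8 * s.size + 1))))))) (by omega) <|
    .seq (Q := fun τ => τ.reg cnt = w.length ∧ τ.reg acc = 0 ∧ Reading 0 ptr w τ)
      (.block fun _ => ⟨zero_add _, rfl, fun i => ?_⟩) fun τ₁ _ ⟨hc, hacc, hr⟩ =>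
    .seq (.addBits hr hc) fun τ₂ _ hacc' =>
    .seq (.setConstants (s := s) (by rw [hacc', hacc, hs, zero_add])) fun τ₃ _ hτ =>
    .seq (Q := fun τ => τ.reg x = s ∧ τ.reg y = s ∧ τ.reg z = 0)
      (.block fun _ => ⟨?_, ?_, rfl⟩) fun τ₄ hf₄ ⟨hx, hy, hz⟩ =>
    .seq (.addMul (by decide) hx hy) fun τ₅ hf₅ hz' =>
    .seq (Q := fun τ => τ.reg x = s * s ∧ τ.reg y = s ∧ τ.reg dim = 0)
      (.block fun _ => ⟨?_, ?_, rfl⟩) fun τ₆ hf₆ ⟨hx, hy, hd⟩ =>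
    (Runs.addMul (by decide) hx hy).mono le_rfl fun τ₇ hf₇ hd' =>
      ⟨hτ.frame (hf₄.seq <| hf₅.seq <| hf₆.seq hf₇), ?_⟩
  · exact congrArg (State.mem (.init w) 0) (zero_add i)
  · exact (zero_add _).trans hτ.size
  · exact (zero_add _).trans hτ.size
  · exact (zero_add _).trans (hz'.trans (by rw [hz, zero_add]))
  · exact (zero_add _).trans (((hf₄.seq hf₅).reg size).trans hτ.size)
  · rw [hd', hd]
    ring

/-- Write the numbers of values of the variables of `M` as the head of the domain of the target,
and the rows of the weight table that belong to them. -/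
def Prog.writeVariables : Prog :=
  .block (next 0 ptr vars) ;;
    .block ([.add t ptr vars, .load facs 0 t, .add x vars facs] ++ incr x ++
      copy items vars ++ [.const unit 1]) ;;
    write x ;; writeDomain ;; .block (incr ptr)

theorem Runs.writeVariables (hM : M.WF) (hs : σ.reg size = M.size)
    (hr : Reading 0 ptr M.encode σ) (hw : Writing base base [] σ) (hT : Rows [] σ) :
    Runs writeVariables σ (M.size * (11 * M.size + 17) + 17) fun τ =>
      Reading 0 ptr (M.factors.flatMap Factor.encode) τ ∧
      Writing base base ([M.dom.length + M.factors.length + 1] ++ M.dom) τ ∧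
      Rows (M.dom.zipIdx.map fun dX => (List.range dX.1).map (· * (2 ^ M.size) ^ dX.2)) τ ∧
      τ.reg unit = (2 ^ M.size) ^ M.dom.length ∧ τ.reg vars = M.dom.length ∧
      τ.reg facs = M.factors.length := by
  have hn : M.dom.length ≤ M.size := by
    have := M.length_add_length_lt_size
    omega
  have hcost := Nat.mul_le_mul_right (11 * M.size + 17) hn
  rw [Model.encode, List.cons_append] at hr
  refine of_le (k := 3 + (8 + (3 + ((M.dom.length * (11 * M.size + 17) + 1) + 2)))) (by omega) <|
    .seq (.next hr) fun τ₁ hf₁ ⟨hn, hr⟩ =>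
    .seq (Q := fun τ => τ.reg facs = M.factors.length ∧
        τ.reg x = M.dom.length + M.factors.length + 1 ∧ τ.reg items = M.dom.length ∧
        τ.reg unit = 1)
      (.block fun _ => ?_) fun τ₂ hf₂ ⟨hm, hx, hi, hu⟩ =>
    .seq (.write (hw.frame (hf₁.seq hf₂))) fun τ₃ hf₃ hw =>
    have hf := hf₁.seq <| hf₂.seq hf₃
    .seq (.writeDomain ((hf.reg size).trans hs) (hr.frame (hf₂.seq hf₃)) hw (hT.frame hf)
      (by rw [hf₃.reg unit, hu]) (by rw [hf₃.reg items, hi]) fun d => hM.card_le_size)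
      fun τ₄ hf₄ ⟨hr, hw, hT, hu⟩ =>
    .block fun hf₅ => ⟨hr.advance (l := [_]) rfl rfl, ?_, hT.frame hf₅, (hf₅.reg unit).trans hu,
      ?_, ?_⟩
  · have hm : τ₁.mem 0 (τ₁.reg ptr + M.dom.length) = M.factors.length := by
      rw [hr, List.getD_append_right _ _ _ _ le_rfl, Nat.sub_self, List.getD_cons_zero]
    simp [Instr.run, hn, hm]
  · simpa [hx] using hw.frame hf₅
  · rw [(hf₂.seq <| hf₃.seq <| hf₄.seq hf₅).reg vars, hn]
  · rw [(hf₃.seq <| hf₄.seq hf₅).reg facs, hm]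

/-- Write the numbers of values of the variables of the target and the number of its factors, and
write the weight table. -/
def Prog.writeHeader : Prog :=
  writeVariables ;; .block (copy start ptr ++ copy items facs) ;; writeTableLengths ;; newRow ;;
    write dim ;; .block (copy x facs ++ incr x) ;; write x

theorem Runs.writeHeader {D : ℕ} (hM : M.WF) (hs : Constants M.size σ)
    (hr : Reading 0 ptr M.encode σ) (hw : Writing base base [] σ) (hT : Rows [] σ)
    (hD : σ.reg dim = D) :
    Runs writeHeader σ (M.size * (rowCost M.size + 11 * M.size + 17) + 35) fun τ =>
      Writing base base ([M.dom.length + M.factors.length + 1] ++ M.dom ++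
        (M.factors.map fun f => f.table.length) ++ [D, M.factors.length + 1]) τ ∧
      Rows (M.weightTable ++ [[]]) τ ∧ Reading 0 start (M.factors.flatMap Factor.encode) τ ∧
      τ.reg vars = M.dom.length ∧ τ.reg facs = M.factors.length := by
  have hcost : rowCost M.size * bits (M.factors.flatMap Factor.encode) ≤
      rowCost M.size * M.size :=
    Nat.mul_le_mul_left _ ((bits_flatMap _ _).trans_le M.sum_bits_encode_le_size)
  refine of_le (k := (M.size * (11 * M.size + 17) + 17) + (4 +
      ((rowCost M.size * bits (M.factors.flatMap Factor.encode) + 1) + (3 + (3 + (4 + 3))))))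
      (by nlinarith) <|
    .seq (.writeVariables hM hs.size hr hw hT) fun τ₁ hf₁ ⟨hr, hw, hT, hu, hn, hm⟩ =>
    .seq (Q := fun τ => τ.reg start = τ₁.reg ptr ∧ τ.reg items = M.factors.length)
      (.block fun _ => ⟨zero_add _, (zero_add _).trans hm⟩) fun τ₂ hf₂ ⟨hstart, hi⟩ =>
    have hf := hf₁.seq hf₂
    .seq (.writeTableLengths (u := (2 ^ M.size) ^ M.dom.length) (hs.frame hf) (hr.frame hf₂)
      (hw.frame hf₂) (hT.frame hf₂) (by rw [hf₂.reg unit, hu]) hi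
      fun f => M.bits_encode_le_size) fun τ₃ hf₃ ⟨hw, hT⟩ =>
    .seq (.newRow hT) fun τ₄ hf₄ hT => .seq (.write (hw.frame hf₄)) fun τ₅ hf₅ hw =>
    have hf' := hf₂.seq <| hf₃.seq <| hf₄.seq hf₅
    .seq (Q := fun τ => τ.reg x = M.factors.length + 1)
      (.block fun _ => congrArg (· + 1) ((zero_add _).trans ((hf'.reg facs).trans hm)))
      fun τ₆ hf₆ hx =>
    (Runs.write (hw.frame hf₆)).mono le_rfl fun τ₇ hf₇ hw =>
      ⟨?_, hT.frame (hf₅.seq <| hf₆.seq hf₇), ?_, ?_, ?_⟩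
  · rw [(hf.seq <| hf₃.seq hf₄).reg dim, hD, hx] at hw
    simpa using hw
  · intro i
    rw [(hf'.seq <| hf₆.seq hf₇).mem 0, (hf₃.seq <| hf₄.seq <| hf₅.seq <| hf₆.seq hf₇).reg start,
      hstart, hr i]
  · rw [(hf'.seq <| hf₆.seq hf₇).reg vars, hn]
  · rw [(hf'.seq <| hf₆.seq hf₇).reg facs, hm]

/-- Write the target, as input of the compilation algorithm, and the weight table. -/
def Prog.writeTarget : Prog :=
  prepare ;; .block [.const ptr 0] ;; writeHeader ;;
    .block (copy ptr start ++ copy items facs ++ copy idx vars) ;; writeRowFactors ;;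
    writePaddingFactor

theorem Runs.writeTarget (hM : M.WF) :
    Runs writeTarget (.init M.encode) (1400 * M.size ^ 3) fun τ =>
      Writing base base M.target.encode τ ∧ Rows (M.weightTable ++ [[]]) τ ∧
        τ.reg size = M.size ∧ τ.reg vars = M.dom.length := by
  have hs₂ := M.two_le_size
  have hfactors : bits (M.factors.flatMap Factor.encode) ≤ M.size :=
    (bits_flatMap _ _).trans_le M.sum_bits_encode_le_size
  have hprefix := M.bits_expandHead_add_le
  have hw : Writing base base [] (.init M.encode) := ⟨rfl, fun _ => rfl⟩
  have hT : Rows [] (.init M.encode) := ⟨⟨rfl, fun _ => rfl⟩, ⟨rfl, fun _ => rfl⟩⟩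
  rw [Model.target, M.encode_expand M.size_pow_three_pos]
  refine of_le (k := (105 * bits M.encode + 30) + (1 +
      ((M.size * (rowCost M.size + 11 * M.size + 17) + 35) + (6 +
      (((14 * M.size + 18) * bits (M.factors.flatMap Factor.encode) + 1) +
      (219 * M.size ^ 3 + 38)))))) ?_ <|
    .seq (.prepare M.encode) fun τ₁ hf₁ ⟨hs, hd⟩ =>
    .seq (Q := Reading 0 ptr M.encode) (.block fun _ i => ?_) fun τ₂ hf₂ hr =>
    have hf := hf₁.seq hf₂
    .seq (.writeHeader (D := M.size ^ 3) hM (hs.frame hf₂) hr (hw.frame hf) (hT.frame hf)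
      ((hf₂.reg dim).trans hd)) fun τ₃ hf₃ ⟨hw, hT, hr, hn, hm⟩ =>
    .seq (Q := fun τ => Reading 0 ptr (M.factors.flatMap Factor.encode) τ ∧
        τ.reg items = M.factors.length ∧ τ.reg idx = M.dom.length)
      (.block fun _ => ⟨fun i => ?_, (zero_add _).trans hm, (zero_add _).trans hn⟩)
      fun τ₄ hf₄ ⟨hr, hi, hR⟩ =>
    .seq (.writeRowFactors hr (hw.frame hf₄) hR hi fun f => M.bits_encode_le_size)
      fun τ₅ hf₅ ⟨hw, hZ⟩ =>
    (Runs.writePaddingFactor hw hZ (((hf₂.seq <| hf₃.seq <| hf₄.seq hf₅).reg dim).trans hd)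
      hprefix).mono le_rfl fun τ₆ hf₆ hw => ⟨hw, ?_, ?_, ?_⟩
  · have hsq : 2 * M.size ≤ M.size ^ 2 := by rw [sq]; gcongr
    have hcube : 2 * M.size ^ 2 ≤ M.size ^ 3 := by rw [pow_succ' _ 2]; gcongr
    have hmul := Nat.mul_le_mul_left (14 * M.size + 18) hfactors
    rw [← M.size_eq_bits, rowCost]
    ring_nf at hmul hsq hcube ⊢
    omega
  · exact (congrArg (τ₁.mem 0) (zero_add i)).trans (congrFun (hf₁.mem 0) i)
  · exact (congrArg (τ₃.mem 0 <| · + i) (zero_add _)).trans (hr i)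
  · exact hT.frame (hf₄.seq <| hf₅.seq hf₆)
  · exact ((hf₂.seq <| hf₃.seq <| hf₄.seq <| hf₅.seq hf₆).reg size).trans hs.size
  · exact ((hf₄.seq <| hf₅.seq hf₆).reg vars).trans hn

end

/-! ### Simulating the compilation algorithm -/

/-- The length of the output of the compilation algorithm, which is collected in the array `4`. -/
abbrev Reg.len : ℕ := 35

/-- The instruction with its registers and arrays shifted by `base`, as a part of a subroutine
whose output is collected in the array `4`. -/
def Instr.shift : Instr → Prog
  | const d n => .basic (.const (base + d) n)
  | add d a b => .basic (.add (base + d) (base + a) (base + b))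
  | sub d a b => .basic (.sub (base + d) (base + a) (base + b))
  | half d a => .basic (.half (base + d) (base + a))
  | load d A a => .basic (.load (base + d) (base + A) (base + a))
  | store A a b => .basic (.store (base + A) (base + a) (base + b))
  | emit a => push 4 len (base + a)

/-- The program as a subroutine, with its registers and arrays shifted by `base`, and with its
output collected in the array `4`. -/
def Prog.shift : Prog → Prog
  | basic i => i.shift
  | seq P Q => P.shift ;; Q.shift
  | cond r P Q => cond (base + r) P.shift Q.shift
  | loop r P => loop (base + r) P.shift

/-- The state `τ` represents the state `σ` of a subroutine. -/
structure Simulates (σ τ : State) : Prop where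
  reg (r : ℕ) : τ.reg (base + r) = σ.reg r
  mem (A : ℕ) : τ.mem (base + A) = σ.mem A
  out : Writing 4 len σ.out τ

namespace Simulates

variable {σ τ : State}

theorem update_reg (h : Simulates σ τ) (d v : ℕ) :
    Simulates { σ with reg := Function.update σ.reg d v }
      { τ with reg := Function.update τ.reg (base + d) v } := by
  refine ⟨fun r => ?_, h.mem, ?_, h.out.mem⟩
  · simp [Function.update_apply, h.reg]
  · exact (Function.update_of_ne (by simp only [len, base]; omega) _ _).trans h.out.reg

theorem update_mem (h : Simulates σ τ) (A a v : ℕ) :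
    Simulates { σ with mem := Function.update σ.mem A (Function.update (σ.mem A) a v) }
      { τ with
        mem := Function.update τ.mem (base + A) (Function.update (τ.mem (base + A)) a v) } := by
  refine ⟨h.reg, fun B => ?_, h.out.reg, fun i => ?_⟩
  · simp [Function.update_apply, h.mem]
  · exact (congrFun (Function.update_of_ne (by simp only [base]; omega) _ _) i).trans (h.out.mem i)

theorem runs_instr (h : Simulates σ τ) (i : Instr) :
    Runs i.shift τ 3 (Simulates (i.run σ)) := by
  cases i with
  | const d n => exact ⟨_, 1, .basic _ τ, by omega, h.update_reg d n⟩
  | add d a b | sub d a b | half d a =>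
    exact ⟨_, 1, .basic _ τ, by omega, by simpa [Instr.run, h.reg] using h.update_reg d _⟩
  | load d A a =>
    exact ⟨_, 1, .basic _ τ, by omega, by simpa [Instr.run, h.reg, h.mem] using h.update_reg d _⟩
  | store A a b =>
    exact ⟨_, 1, .basic _ τ, by omega, by simpa [Instr.run, h.reg] using h.update_mem A _ _⟩
  | emit a =>
    refine (Runs.push h.out).mono le_rfl fun υ hf hυ => ⟨fun r => ?_, fun A => ?_, ?_⟩
    · refine (hf.reg _ ?_).trans (h.reg r)
      simp only [push, List.cons_append, List.nil_append, block, writes, any, Instr.dest?, base,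
        len, tmp, Option.none_beq_some, Option.some_beq_some, Bool.false_or, Bool.or_eq_false_iff,
        beq_eq_false_iff_ne, ne_eq]
      omega
    · refine (hf.mem _ ?_).trans (h.mem A)
      simp only [push, List.cons_append, List.nil_append, block, stores, any, Instr.array?, base,
        Option.some_beq_some, Option.none_beq_some, Bool.or_false, beq_eq_false_iff_ne, ne_eq]
      omega
    · rwa [h.reg] at hυ

end Simulates

theorem Exec.runs_shift {P : Prog} {σ σ' : State} {k : ℕ} (hP : Exec P σ σ' k) {τ : State}
    (h : Simulates σ τ) : Runs P.shift τ (3 * k) (Simulates σ') := by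
  induction hP generalizing τ with
  | basic i σ => exact h.runs_instr i
  | seq _ _ ih ih' => exact .of_le (by omega) (.seq (ih h) fun _ _ => ih')
  | cond_true hr _ ih =>
    exact .of_le (by omega) (.cond (fun _ => ih h) fun hr' => absurd ((h.reg _).symm.trans hr') hr)
  | cond_false hr _ ih =>
    exact .of_le (by omega) (.cond (fun hr' => absurd hr (h.reg _ ▸ hr')) fun _ => ih h)
  | loop_done hr => exact ⟨τ, 1, .loop_done ((h.reg _).trans hr), by omega, h⟩
  | loop_step hr _ _ ih ih' =>
    obtain ⟨υ, l, hυ, hl, h'⟩ := ih h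
    obtain ⟨ω, m, hω, hm, h''⟩ := ih' h'
    exact ⟨ω, _, .loop_step (h.reg _ ▸ hr) hυ hω, by omega, h''⟩

theorem Exec.length_out_le {P : Prog} {σ τ : State} {k : ℕ} (h : Exec P σ τ k) :
    τ.out.length ≤ σ.out.length + k := by
  induction h with
  | basic i σ => cases i <;> simp [Instr.run]
  | loop_done _ => omega
  | _ => omega

namespace Prog

variable {P : Prog} {p q : Instr → Bool}

theorem any_shift (hp : ∀ i : Instr, i.shift.any p = false) : P.shift.any p = false := by
  induction P with
  | basic i => exact hp i
  | seq _ _ hP hQ | cond _ _ _ hP hQ => exact Bool.or_eq_false_iff.2 ⟨hP, hQ⟩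
  | loop _ _ hP => exact hP

theorem writes_shift {r : ℕ} (hr : r < base) (hr' : r ∉ [tmp, len]) : P.shift.writes r = false :=
  any_shift fun i => by
    cases i <;> simp_all [Instr.shift, push, block, any, Instr.dest?, base] <;> omega

theorem stores_shift {A : ℕ} (hA : A < base) (hA' : A ≠ 4) : P.shift.stores A = false :=
  any_shift fun i => by
    cases i <;> simp_all [Instr.shift, push, block, any, Instr.array?, base] <;> omega

theorem emits_shift : P.shift.emits = false :=
  any_shift fun i => by cases i <;> rfl

theorem any_eq_false_of_imp (hpq : ∀ i, q i → p i) (hP : P.any p = false) : P.any q = false := by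
  induction P with
  | basic i => exact Bool.eq_false_iff.2 fun hi => Bool.eq_false_iff.1 hP (hpq i hi)
  | seq _ _ ihP ihQ | cond _ _ _ ihP ihQ =>
    have hP := Bool.or_eq_false_iff.1 hP
    exact Bool.or_eq_false_iff.2 ⟨ihP hP.1, ihQ hP.2⟩
  | loop _ _ ih => exact ih hP

end Prog

theorem simulates_init {v w : List ℕ} {τ : State} (hf : Frame writeTarget (.init v) τ)
    (hw : Writing base base w τ) : Simulates (.init w) τ := by
  refine ⟨fun r => ?_, fun A => ?_, ⟨hf.reg len, fun i => by rw [hf.mem 4]; rfl⟩⟩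
  · rcases Nat.eq_zero_or_pos r with rfl | hr
    · exact hw.reg
    · have : writeTarget.writes (base + r) = false :=
        any_eq_false_of_imp (p := fun i => i.dest?.any (base < ·)) (fun i hi => by
          simp [eq_of_beq hi, hr]) rfl
      rw [hf.reg _ this]
      simp [State.init, hr.ne']
  · rcases Nat.eq_zero_or_pos A with rfl | hA
    · exact funext hw.mem
    · have : writeTarget.stores (base + A) = false :=
        any_eq_false_of_imp (p := fun i => i.array?.any (base < ·)) (fun i hi => by
          simp [eq_of_beq hi, hA]) rfl
      rw [hf.mem _ this]
      simp [State.init, hA.ne']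

/-! ### Evaluating the circuit -/

/-- An element of `WithBot ℕ` as a natural number in a register, with `⊥` as `0`. -/
def botCode : WithBot ℕ → ℕ := WithBot.recBotCoe 0 (· + 1)

theorem botCode_sup (a b : WithBot ℕ) :
    botCode (a ⊔ b) = botCode a + (botCode b - botCode a) := by
  cases a <;> cases b <;> simp [botCode, ← WithBot.coe_sup]
  omega

theorem botCode_add (a b : WithBot ℕ) :
    botCode (a + b) =
      if botCode a = 0 ∨ botCode b = 0 then 0 else botCode a + botCode b - 1 := by
  cases a <;> cases b <;> simp [botCode, ← WithBot.coe_add]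
  omega

/-- The list `l` is the part of the circuit in the array `4` that is still to be read, at the
position `ptr`. -/
structure Scanning (l : List ℕ) (σ : State) : Prop where
  reading : Reading 4 ptr l σ
  length : σ.reg ptr + l.length = σ.reg len

/-- The table `W` of weights is stored, and the array `5` holds the values `vs` of the nodes. -/
structure Evaluating (W : List (List ℕ)) (vs : List (WithBot ℕ)) (σ : State) : Prop where
  rows : Rows (W ++ [[]]) σ
  values : Writing 5 idx (vs.map botCode) σ

section

variable {P : Prog} {W : List (List ℕ)} {vs : List (WithBot ℕ)} {l : List ℕ} {σ τ : State} {k : ℕ}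

theorem Scanning.frame (h : Scanning l σ) (hf : Frame P σ τ)
    (hP : (P.stores 4 || P.writes ptr || P.writes len) = false := by rfl) : Scanning l τ := by
  simp only [Bool.or_eq_false_iff] at hP
  exact ⟨h.reading.frame hf hP.1.1 hP.1.2, by rw [hf.reg _ hP.1.2, hf.reg _ hP.2, h.length]⟩

theorem Runs.scan {a d : ℕ} (h : Scanning (a :: l) σ) (hd : [d, ptr, len, tmp].Nodup := by decide) :
    Runs (.block (Instr.next 4 ptr d)) σ 3 fun τ => τ.reg d = a ∧ Scanning l τ := by
  simp only [List.nodup_cons, List.mem_cons, List.not_mem_nil, or_false, not_or] at hd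
  have hlen := h.length
  refine .block fun _ => ⟨?_, h.reading.advance (l := [a]) rfl ?_, ?_⟩ <;>
  simp [Instr.run, hd, Ne.symm, h.reading.head] at hlen ⊢
  omega

theorem Evaluating.frame (h : Evaluating W vs σ) (hf : Frame P σ τ)
    (hP : ((P.stores 2 || P.stores 3 || P.writes offs || P.writes wts) ||
      (P.stores 5 || P.writes idx)) = false := by rfl) : Evaluating W vs τ := by
  have h' := Bool.or_eq_false_iff.1 (Bool.or_eq_false_iff.1 hP).2
  exact ⟨h.rows.frame hf (Bool.or_eq_false_iff.1 hP).1, h.values.frame hf h'.1 h'.2⟩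

theorem Evaluating.getD (h : Evaluating W vs σ) (c : ℕ) :
    σ.mem 5 c = botCode (vs.getD c ⊥) :=
  (h.values.mem c).trans (List.getD_map vs ⊥ botCode)

/-- Fold the values of the next `cnt` children into the register `acc`, where `P` combines `acc`
with the value in the register `y`. -/
def Prog.foldChildren (P : Prog) : Prog :=
  .loop cnt (.block (next 4 ptr x) ;; .block [.load y 5 x] ;; P ;; .block (decr cnt))

theorem Runs.foldChildren {op : WithBot ℕ → WithBot ℕ → WithBot ℕ} {cs : List ℕ} {a : WithBot ℕ}
    (hP : ∀ τ a b, τ.reg acc = botCode a → τ.reg y = botCode b →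
      Runs P τ k fun υ => υ.reg acc = botCode (op a b))
    (h : Evaluating W vs σ) (hl : Scanning (cs ++ l) σ) (hc : σ.reg cnt = cs.length)
    (ha : σ.reg acc = botCode a)
    (hP₁ : (P.stores 4 || P.writes ptr || P.writes len) = false := by rfl)
    (hP₂ : ((P.stores 2 || P.stores 3 || P.writes offs || P.writes wts) ||
      (P.stores 5 || P.writes idx)) = false := by rfl)
    (hP₃ : P.writes cnt = false := by rfl) :
    Runs (foldChildren P) σ (cs.length * (k + 7) + 1) fun τ =>
      τ.reg acc = botCode ((cs.map fun c => vs.getD c ⊥).foldl op a) ∧ Scanning l τ := by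
  refine (forEach (cost := fun _ => 3 + (1 + (k + 2))) (I := fun pre suf τ => Evaluating W vs τ ∧
      Scanning (suf ++ l) τ ∧ τ.reg cnt = suf.length ∧
      τ.reg acc = botCode ((pre.map fun c => vs.getD c ⊥).foldl op a)) cs ⟨h, hl, hc, ha⟩
    (fun pre suf τ h => by simp [h.2.2.1]) fun pre c suf τ _ _ ⟨h, hl, hc, ha⟩ =>
      .seq (.scan hl) fun υ hf ⟨hx, hl⟩ =>
      .seq (Q := fun ω => ω.reg y = botCode (vs.getD c ⊥)) (.block fun _ => ?_) fun ω hf' hy =>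
      .seq (hP _ _ _ (((hf.seq hf').reg acc).trans ha) hy) fun ρ hf'' hρ =>
      .block fun hr => ⟨(((h.frame hf).frame hf').frame hf'' hP₂).frame hr,
        ((hl.frame hf').frame hf'' hP₁).frame hr, ?_, ?_⟩).mono
      (by simp; ring_nf; omega) fun τ _ h => ⟨h.2.2.2, h.2.1⟩
  · change υ.mem 5 (υ.reg x) = _
    rw [hx, (h.frame hf).getD]
  · change ρ.reg cnt - 1 = _
    rw [hf''.reg cnt hP₃, (hf.seq hf').reg cnt, hc, List.length_cons, Nat.add_sub_cancel]
  · rw [List.map_append, List.foldl_append]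
    exact hρ

/-- Combine the registers `acc` and `y` by the maximum. -/
def Prog.maxStep : Prog := .block [.sub y y acc, .add acc acc y]

/-- Combine the registers `acc` and `y` by addition. -/
def Prog.addStep : Prog :=
  .cond acc (.cond y (.block ([.add acc acc y] ++ decr acc)) (.block [.const acc 0]))
    (.block [.const acc 0])

theorem Runs.maxStep {a b : WithBot ℕ} (ha : σ.reg acc = botCode a) (hb : σ.reg y = botCode b) :
    Runs maxStep σ 2 fun τ => τ.reg acc = botCode (a ⊔ b) :=
  .block fun _ => by
    change σ.reg acc + (σ.reg y - σ.reg acc) = _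
    rw [ha, hb, botCode_sup]

theorem Runs.addStep {a b : WithBot ℕ} (ha : σ.reg acc = botCode a) (hb : σ.reg y = botCode b) :
    Runs addStep σ 5 fun τ => τ.reg acc = botCode (a + b) := by
  rw [← funext fun τ : State => congrArg (τ.reg acc = ·) (botCode_add a b).symm, ← ha, ← hb]
  refine .cond (fun ha => .cond (fun hb => .block fun _ => ?_) fun hb =>
    (Runs.block fun _ => ?_).of_le (by simp)) fun ha => (Runs.block fun _ => ?_).of_le (by simp)
  · rw [if_neg (by tauto)]
    rfl
  · rw [if_pos (.inr hb)]
    rfl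
  · rw [if_pos (.inl ha)]
    rfl

/-- Run the program whose position in the list is in the register `t`. -/
def Prog.switch (t : ℕ) : List Prog → Prog
  | [] => .block []
  | P :: Ps => .cond t (.block (decr t) ;; switch t Ps) P

theorem Runs.switch {t i : ℕ} {Ps : List Prog} {Q : State → Prop} (hPs : Ps[i]? = some P)
    (ht : σ.reg t = i) (htmp : t ≠ tmp)
    (h : ∀ τ, Frame (.block (decr t)) σ τ → Runs P τ k Q) :
    Runs (switch t Ps) σ (k + 3 * i + 1) Q := by
  induction Ps generalizing i σ with
  | nil => simp at hPs
  | cons P' Ps ih =>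
    cases i with
    | zero =>
      obtain rfl : P' = P := by simpa using hPs
      exact .cond (fun h' => absurd ht h') fun _ => h σ (.refl _ _)
    | succ i =>
      refine of_le (k := 2 + (k + 3 * i + 1) + 1) (by omega) <|
        .cond (fun _ => .seq (Q := fun τ => τ.reg t = i) (.block fun _ => ?_) fun τ hf hτ =>
          ih hPs hτ fun υ hf' => h υ (hf.trans hf')) fun h' => by omega
      simp [Instr.run, htmp, ht]

/-- Compute the value of an indicator of the variable `cnt`. -/
def Prog.evalInd : Prog :=
  .block (next 4 ptr x) ;; .block ([.load y 2 cnt, .add y y x, .load acc 3 y] ++ incr acc)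

/-- Compute the value of a parameter with numerator `cnt`. -/
def Prog.evalParam : Prog :=
  .block (next 4 ptr x) ;; .cond cnt (.block [.const acc 1]) (.block [.const acc 0])

/-- Compute the value of a `+`-node with `cnt` children. -/
def Prog.evalAdd : Prog := .block [.const acc 0] ;; foldChildren maxStep

/-- Compute the value of a `*`-node with `cnt` children. -/
def Prog.evalMul : Prog := .block [.const acc 1] ;; foldChildren addStep

/-- Compute the value of the next node of the circuit in the register `acc`. -/
def Prog.evalNode : Prog :=
  .block (next 4 ptr t) ;; .block (next 4 ptr cnt) ;;
    switch t [evalInd, evalParam, evalAdd, evalMul]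

theorem Runs.evalInd {X v : ℕ} (h : Evaluating W vs σ) (hl : Scanning (v :: l) σ)
    (hX : σ.reg cnt = X) (hXW : X ≤ W.length) (hv : X < W.length → v < (W.getD X []).length) :
    Runs evalInd σ 8 fun τ => τ.reg acc = (W.getD X []).getD v 0 + 1 ∧ Scanning l τ := by
  refine of_le (k := 3 + 5) le_rfl <| .seq (.scan hl) fun τ hf ⟨hx, hl⟩ =>
    .block fun hf' => ⟨?_, hl.frame hf'⟩
  change τ.mem 3 (τ.mem 2 (τ.reg cnt) + τ.reg x) + 1 = _
  rw [hf.reg cnt, hX, hx, (h.frame hf).rows.lookup hXW hv]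

theorem Runs.evalParam {b : ℕ} (hl : Scanning (b :: l) σ) :
    Runs evalParam σ 5 fun τ =>
      τ.reg acc = botCode (if σ.reg cnt = 0 then ⊥ else 0) ∧ Scanning l τ := by
  refine of_le (k := 3 + 2) le_rfl <| .seq (.scan hl) fun τ hf ⟨_, hl⟩ => ?_
  rw [← hf.reg cnt]
  exact .cond (fun h => .block fun hf' => ⟨by rw [if_neg h]; rfl, hl.frame hf'⟩)
    fun h => .block fun hf' => ⟨by rw [if_pos h]; rfl, hl.frame hf'⟩

theorem foldl_max_eq_sup (f : ℕ → WithBot ℕ) (cs : List ℕ) :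
    (cs.map f).foldl (· ⊔ ·) ⊥ = cs.toFinset.sup f := by
  induction cs using List.reverseRecOn with
  | nil => rfl
  | append_singleton cs c ih => simp [ih, max_comm]

theorem Runs.evalAdd {cs : List ℕ} (h : Evaluating W vs σ) (hl : Scanning (cs ++ l) σ)
    (hc : σ.reg cnt = cs.length) :
    Runs evalAdd σ (9 * cs.length + 2) fun τ =>
      τ.reg acc = botCode (cs.toFinset.sup fun c => vs.getD c ⊥) ∧ Scanning l τ := by
  rw [← foldl_max_eq_sup]
  exact of_le (k := 1 + (cs.length * 9 + 1)) (by omega) <|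
    .seq (Q := fun τ => τ.reg acc = botCode ⊥) (.block fun _ => rfl) fun τ hf hacc =>
    .foldChildren (fun _ _ _ => .maxStep) (h.frame hf) (hl.frame hf) ((hf.reg cnt).trans hc) hacc

theorem Runs.evalMul {cs : List ℕ} (h : Evaluating W vs σ) (hl : Scanning (cs ++ l) σ)
    (hc : σ.reg cnt = cs.length) :
    Runs evalMul σ (12 * cs.length + 2) fun τ =>
      τ.reg acc = botCode (cs.map fun c => vs.getD c ⊥).sum ∧ Scanning l τ := by
  rw [List.sum_eq_foldl]
  exact of_le (k := 1 + (cs.length * 12 + 1)) (by omega) <|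
    .seq (Q := fun τ => τ.reg acc = botCode 0) (.block fun _ => rfl) fun τ hf hacc =>
    .foldChildren (fun _ _ _ => .addStep) (h.frame hf) (hl.frame hf) ((hf.reg cnt).trans hc) hacc

theorem Runs.evalNode_of_tag {i a : ℕ} {Q : State → Prop} (h : Evaluating W vs σ)
    (hl : Scanning (i :: a :: l) σ)
    (hP : [Prog.evalInd, Prog.evalParam, Prog.evalAdd, Prog.evalMul][i]? = some P)
    (hQ : ∀ τ, Evaluating W vs τ → Scanning l τ → τ.reg cnt = a → Runs P τ k Q) :
    Runs evalNode σ (k + 3 * i + 7) Q :=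
  of_le (k := 3 + (3 + (k + 3 * i + 1))) (by omega) <|
    .seq (.scan hl) fun _ hf ⟨ht, hl⟩ => .seq (.scan hl) fun _ hf' ⟨hcnt, hl⟩ =>
    .switch hP ((hf'.reg t).trans ht) (by decide) fun _ hf'' =>
      hQ _ (((h.frame hf).frame hf').frame hf'') (hl.frame hf'') ((hf''.reg cnt).trans hcnt)

theorem Runs.evalNode {nd : Node} (h : Evaluating W vs σ) (hl : Scanning (nd.encode ++ l) σ)
    (hnd : ∀ X v, nd = .ind X v → X ≤ W.length ∧ (X < W.length → v < (W.getD X []).length)) :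
    Runs evalNode σ (12 * nd.encode.length) fun τ =>
      τ.reg acc = botCode (nd.maxPlus (fun X v => (W.getD X []).getD v 0) vs) ∧
        Scanning l τ := by
  cases nd with
  | ind X v =>
    exact of_le (by simp [Node.encode]) <| .evalNode_of_tag (k := 8) h hl rfl fun τ h hl hX =>
      .evalInd h hl hX (hnd X v rfl).1 (hnd X v rfl).2
  | param a b =>
    exact of_le (by simp [Node.encode]) <| .evalNode_of_tag (k := 5) h hl rfl fun τ _ hl ha =>
      ha ▸ .evalParam hl
  | add cs =>
    exact of_le (by simp [Node.encode]; omega) <| .evalNode_of_tag h hl rfl fun τ h hl hc =>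
      .evalAdd h hl hc
  | mul cs =>
    exact of_le (by simp [Node.encode]; omega) <| .evalNode_of_tag h hl rfl fun τ h hl hc =>
      .evalMul h hl hc

end

theorem Node.two_le_length_encode (nd : Node) : 2 ≤ nd.encode.length := by
  cases nd <;> simp [Node.encode]

theorem Circuit.length_le_length_encode (C : Circuit) : C.length ≤ C.encode.length := by
  rw [encode, List.length_flatMap, ← List.length_map (f := fun nd => nd.encode.length)]
  refine List.length_le_sum_of_one_le _ fun n hn => ?_
  obtain ⟨nd, -, rfl⟩ := List.mem_map.1 hn
  exact one_le_two.trans nd.two_le_length_encode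

/-- Append the values of the nodes of the rest of the circuit to the array `5`. -/
def Prog.evalNodes : Prog :=
  .loop items (evalNode ;; push 5 idx acc ;; .block [.sub items len ptr])

/-- Compute the value of the circuit in the array `4`, i.e. that of its root, in the register
`y`. -/
def Prog.evaluate : Prog :=
  .block ([.const ptr 0, .const idx 0] ++ copy items len) ;; evalNodes ;;
    .block (copy x idx ++ decr x ++ [.load y 5 x] ++ decr y)

section

variable {W : List (List ℕ)} {C : Circuit} {σ : State}

theorem Runs.evalNodes (h : Evaluating W [] σ) (hl : Scanning (Circuit.encode C) σ)
    (hitems : σ.reg items = (Circuit.encode C).length)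
    (hind : ∀ X v, .ind X v ∈ C → X ≤ W.length ∧ (X < W.length → v < (W.getD X []).length)) :
    Runs evalNodes σ (15 * C.encode.length + 1)
      (Evaluating W (bottomUp (Node.maxPlus fun X v => (W.getD X []).getD v 0) C)) := by
  have hcost : (C.map fun nd => 12 * nd.encode.length + 4 + 1).sum ≤
      15 * (Circuit.encode C).length := by
    rw [Circuit.encode, List.length_flatMap, ← List.sum_map_mul_left]
    exact List.sum_le_sum fun nd _ => by have := nd.two_le_length_encode; omega
  refine (forEach (cost := fun nd => 12 * nd.encode.length + 4)
    (I := fun pre suf τ =>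
      Evaluating W (bottomUp (Node.maxPlus fun X v => (W.getD X []).getD v 0) pre) τ ∧
        Scanning (Circuit.encode suf) τ ∧ τ.reg items = (Circuit.encode suf).length)
    C ⟨h, hl, hitems⟩ (fun pre suf τ h => ?_)
    fun pre nd suf τ hC _ ⟨h, hl, _⟩ =>
      .seq (.evalNode h (l := Circuit.encode suf) hl fun X v hnd => hind X v (by simp [← hC, hnd]))
        fun υ hf ⟨hacc, hl⟩ =>
      .seq (.push (h.frame hf).values) fun ω hf' hω =>
      .block fun hf'' => ⟨⟨((h.frame hf).rows.frame hf').frame hf'', ?_⟩,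
        (hl.frame hf').frame hf'', ?_⟩).mono
      (Nat.add_le_add_right hcost 1) fun τ _ h => h.1
  · have := Circuit.length_le_length_encode suf
    exact ⟨fun h0 => List.length_eq_zero_iff.1 (by omega), by rintro rfl; exact h.2.2⟩
  · rw [bottomUp_append_singleton, List.map_append, List.map_singleton, ← hacc]
    exact hω.frame hf''
  · change ω.reg len - ω.reg ptr = _
    rw [← (hl.frame hf').length, Nat.add_sub_cancel_left]

theorem Runs.evaluate {V : ℕ} (hrows : Rows (W ++ [[]]) σ) (hC : Writing 4 len C.encode σ)
    (hvalues : ∀ i, σ.mem 5 i = 0)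
    (hind : ∀ X v, .ind X v ∈ C → X ≤ W.length ∧ (X < W.length → v < (W.getD X []).length))
    (hV : C.maxPlus (fun X v => (W.getD X []).getD v 0) (C.length - 1) = V) :
    Runs evaluate σ (15 * C.encode.length + 12) fun τ => τ.reg y = V := by
  refine of_le (k := 4 + ((15 * C.encode.length + 1) + 7)) (by omega) <|
    .seq (Q := fun τ => Evaluating W [] τ ∧ Scanning C.encode τ ∧ τ.reg items = C.encode.length)
      (.block fun hf => ⟨⟨hrows.frame hf, rfl, hvalues⟩,
        ⟨(hC.frame (A := 4) hf).reading rfl, (zero_add _).trans hC.reg.symm⟩,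
        (zero_add _).trans hC.reg⟩) fun τ _ ⟨h, hl, hitems⟩ =>
    .seq (.evalNodes h hl hitems hind) fun υ _ h => .block fun _ => ?_
  change υ.mem 5 (0 + υ.reg idx - 1) - 1 = V
  rw [zero_add, h.values.reg, List.length_map, length_bottomUp, h.getD]
  exact congrArg (botCode · - 1) hV

end

/-! ### The algorithm -/

/-- Print the `vars` lowest digits, in base `2 ^ size`, of the register `y`. -/
def Prog.decode : Prog :=
  .loop vars
    (.block (copy x y ++ copy cnt size) ;; shiftRight x cnt ;; .block (copy z x ++ copy cnt size) ;;
      shiftLeft z cnt ;; .block ([.sub t y z, .emit t] ++ copy y x ++ decr vars))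

theorem Runs.decode {s G : ℕ} {l : List ℕ} {σ : State} (hl : ∀ d ∈ l, d < 2 ^ s)
    (hy : σ.reg y = Nat.ofDigits (2 ^ s) (l ++ [G])) (hs : σ.reg size = s)
    (hn : σ.reg vars = l.length) :
    Runs decode σ (l.length * (8 * s + 17) + 1) fun τ => τ.out = σ.out ++ l := by
  refine (forEach (cost := fun _ => 8 * s + 16) (I := fun pre suf τ =>
      τ.reg y = Nat.ofDigits (2 ^ s) (suf ++ [G]) ∧ τ.reg vars = suf.length ∧ τ.out = σ.out ++ pre)
    l ⟨hy, hn, by simp⟩ (fun pre suf τ h => by simp [h.2.1])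
    fun pre d suf τ hpre hf ⟨hy, hn, hout⟩ => ?_).mono (by simp) fun τ _ h => h.2.2
  have hd : d < 2 ^ s := hl d (by simp [← hpre])
  rw [List.cons_append, Nat.ofDigits_cons] at hy
  set q := Nat.ofDigits (2 ^ s) (suf ++ [G])
  have hq : (d + 2 ^ s * q) / 2 ^ s = q := by
    rw [Nat.add_mul_div_left _ _ (by positivity), Nat.div_eq_of_lt hd, zero_add]
  refine of_le (k := 4 + ((4 * s + 1) + (4 + ((4 * s + 1) + 6)))) (by omega) <|
    .seq (Q := fun τ₁ => τ₁.reg x = d + 2 ^ s * q ∧ τ₁.reg cnt = s) (.block fun _ => ?_)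
      fun τ₁ hf₁ ⟨hx, hc⟩ =>
    .seq (.shiftRight (by decide) hx hc) fun τ₂ hf₂ hx =>
    .seq (Q := fun τ₃ => τ₃.reg z = q ∧ τ₃.reg x = q ∧ τ₃.reg cnt = s) (.block fun _ => ?_)
      fun τ₃ hf₃ ⟨hz, hx, hc⟩ =>
    .seq (.shiftLeft (by decide) hz hc) fun τ₄ hf₄ hz =>
    have hf' := hf₁.seq <| hf₂.seq <| hf₃.seq hf₄
    .block fun _ => ⟨?_, ?_, ?_⟩
  · exact ⟨(zero_add _).trans hy, (zero_add _).trans ((hf.reg size).trans hs)⟩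
  · have hx := hx.trans hq
    exact ⟨(zero_add _).trans hx, hx,
      (zero_add _).trans (((hf.seq <| hf₁.seq hf₂).reg size).trans hs)⟩
  · exact (zero_add _).trans ((hf₄.reg x).trans hx)
  · change τ₄.reg vars - 1 = _
    rw [hf'.reg vars, hn, List.length_cons, Nat.add_sub_cancel]
  · change τ₄.out ++ [τ₄.reg y - τ₄.reg z] = _
    rw [hf'.out, hf'.reg y, hy, hz, hout, mul_comm q, Nat.add_sub_cancel_right, List.append_assoc]

namespace Model

variable {M : Model} {D j : ℕ}

theorem length_weightTable : M.weightTable.length = M.dom.length + M.factors.length := by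
  simp [weightTable]

theorem length_getD_weightTable {X : ℕ} (hX : X < M.weightTable.length) :
    (M.weightTable.getD X []).length = (M.expand D j).card X := by
  have hrows : M.weightTable.map List.length = M.dom ++ M.factors.map fun f => f.table.length := by
    simp [weightTable, Function.comp_def]
  rw [card, expand, ← List.append_assoc, ← hrows, List.getD_append _ _ _ _ (by simpa)]
  exact (List.getD_map _ [] List.length).symm

end Model

theorem Circuit.WF.lt_length_weightTable {M : Model} {D j : ℕ} {C : Circuit}
    (hC : C.WF (M.expand D j)) {X v : ℕ} (hv : .ind X v ∈ C) :
    X ≤ M.weightTable.length ∧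
      (X < M.weightTable.length → v < (M.weightTable.getD X []).length) := by
  obtain ⟨hX, hv⟩ := hC.ind_lt X v hv
  rw [Model.length_expand_dom, ← Model.length_weightTable] at hX
  exact ⟨by omega, fun hX => by rwa [Model.length_getD_weightTable hX]⟩

/-- Turns a compilation algorithm into an algorithm that finds an MPE. -/
def Prog.mpe (Ξ : Prog) : Prog := writeTarget ;; Ξ.shift ;; evaluate ;; decode

theorem Model.decode_cost_le (M : Model) : M.dom.length * (8 * M.size + 17) ≤ 9 * M.size ^ 3 := by
  have hlen := M.length_add_length_lt_size
  have hs := M.two_le_size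
  have hsq : 2 * M.size ≤ M.size ^ 2 := by rw [sq]; gcongr
  have hcube : 2 * M.size ^ 2 ≤ M.size ^ 3 := by rw [pow_succ' _ 2]; gcongr
  calc M.dom.length * (8 * M.size + 17) ≤ M.size * (8 * M.size + 17) := by gcongr; omega
    _ = 8 * M.size ^ 2 + 17 * M.size := by ring
    _ ≤ 9 * M.size ^ 3 := by omega

theorem Runs.mpe {M : Model} (hM : M.WF) {Ξ : Prog} {σ : State} {k : ℕ}
    (hΞ : Exec Ξ (.init M.target.encode) σ k) (hσ : CompilationSpec M.target σ.out) :
    Runs (mpe Ξ) (.init M.encode) (1500 * k) fun τ => MPESpec M τ.out := by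
  obtain ⟨C, hout, hwf, hdec, hsm, hcomp⟩ := hσ
  have hC : C.Compiles M.target := ⟨hwf, hdec, hsm, hcomp⟩
  obtain ⟨x, hx, hroot⟩ := hM.exists_isMPE_maxPlus_root_eq M.size_pow_three_pos hC
  have hencode : C.encode.length ≤ k := by simpa [hout, State.init] using hΞ.length_out_le
  have hk : M.size ^ 3 ≤ k :=
    (M.le_length_of_compiles hM hC).trans (C.length_le_length_encode.trans hencode)
  have hdecode := M.decode_cost_le
  have hpos := M.size_pow_three_pos
  refine of_le (k := 1400 * M.size ^ 3 + (3 * k + ((15 * C.encode.length + 12) +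
      (M.dom.length * (8 * M.size + 17) + 1)))) (by omega) <|
    .seq (.writeTarget hM) fun τ₁ hf₁ ⟨hw, hT, hsize, hvars⟩ =>
    .seq (hΞ.runs_shift (simulates_init hf₁ hw)) fun τ₂ hf₂ hsim =>
    .seq (.evaluate (C := C) (W := M.weightTable) (hT.frame hf₂ ?_) (hout ▸ hsim.out) (fun i => ?_)
      (fun X v hv => hwf.lt_length_weightTable hv) hroot) fun τ₃ hf₃ hy =>
    (Runs.decode (G := M.logWeight x) x.lt_two_pow_size_of_mem_ofFn hy ?_ ?_).mono
      (by rw [List.length_ofFn]) fun τ₄ _ h => ⟨x, ?_, hx⟩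
  · rw [stores_shift (by decide) (by decide), stores_shift (by decide) (by decide),
      writes_shift (by decide) (by decide), writes_shift (by decide) (by decide)]
    rfl
  · rw [hf₂.mem 5 (stores_shift (by decide) (by decide)), hf₁.mem 5]
    rfl
  · rw [hf₃.reg size, hf₂.reg size (writes_shift (by decide) (by decide)), hsize]
  · rw [hf₃.reg vars, hf₂.reg vars (writes_shift (by decide) (by decide)), hvars, List.length_ofFn]
  · rw [h, hf₃.out, hf₂.out emits_shift, hf₁.out]
    exact List.nil_append _

end ArithCirc

theorem mainTheorem7 :
    ∃ p : Polynomial ℕ, ∀ (Ξ : ArithCirc.Prog) (t : ℕ → ℝ),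
      ArithCirc.SolvesInTime ArithCirc.CompilationSpec Ξ t →
        ∃ A : ArithCirc.Prog,
          ArithCirc.SolvesInTime ArithCirc.MPESpec A (fun s => t (p.eval s)) := by
  refine ⟨.C 16 * .X ^ 3, fun Ξ t ⟨T, hT, ht⟩ => ⟨.mpe Ξ, fun s => 1500 * T (16 * s ^ 3), ?_, ?_⟩⟩
  · intro M hM
    obtain ⟨σ, k, hΞ, hσ, hk⟩ := hT M.target (hM.expand M.size_pow_three_pos)
    rw [M.size_target] at hk
    obtain ⟨τ, k', hexec, hk', hτ⟩ := ArithCirc.Runs.mpe hM hΞ hσ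
    exact ⟨τ, k', hexec, hτ, hk'.trans (Nat.mul_le_mul_left _ hk)⟩
  · have hp : Filter.Tendsto (fun s : ℕ => 16 * s ^ 3) .atTop .atTop :=
      Filter.tendsto_atTop_mono (fun s => (Nat.le_self_pow (by norm_num) s).trans
        (Nat.le_mul_of_pos_left _ (by norm_num))) Filter.tendsto_id
    simpa [Function.comp_def] using (ht.comp_tendsto hp).const_mul_left 1500
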